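/- Let $\Gamma=\mathbb Z+\mathbb Z\tau$ with $\operatorname{Im}\tau>0$, $\mathcal E=\mathbb C/\Gamma$, $\eta\in\mathbb C$, and write $e(x)=e^{2\pi i x}$. Let $$\theta(z)=\sum_{\alpha\in\mathbb Z}(-1)^\alpha e\bigl(\alpha z+\tfrac{\alpha(\alpha-1)}2\tau\bigr),\qquad \theta_\alpha(z)=\prod_{s=0}^{n-1}\theta\bigl(z+\tfrac sn+\tfrac\alpha n\tau\bigr)\cdot e\bigl(\alpha z+\tfrac{\alpha(\alpha-n)}{2n}\tau+\tfrac{\alpha}{2n}\bigr)\quad(\alpha\in\mathbb Z/n\mathbb Z).$$ Let $1\le k<n$ be coprime and $\frac nk=n_1-\frac1{n_2-\cdots-\frac1{n_q}}$ with all $n_\nu\ge2$. Let $d(m_1,\dots,m_t)$ be the determinant of the tridiagonal matrix with diagonal $m_1,\dots,m_t$ and entries $-1$ next to the diagonal, $d(\varnothing)=1$. **The algebra $Q_{n,k}(\mathcal E,\eta)$** is the associative unital $\mathbb C$-algebra with generators $x_i$, $i\in\mathbb Z/n\mathbb Z$, and relations, for $i,j\in\mathbb Z/n\mathbb Z$,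 $$\sum_{r\in\mathbb Z/n\mathbb Z}\frac{\theta_{j-i+r(k-1)}(0)}{\theta_{kr}(\eta)\,\theta_{j-i-r}(-\eta)}\,x_{j-r}x_{i+r}=0 ;$$ if $n\eta\in\Gamma$, the coefficients are replaced by the limits, as $t\to\eta$, of the coefficients at $t$ multiplied by $\theta(nt)$ (for $\eta=0$ this gives the commutative polynomial ring). **Theta basis.** $\Theta_{n/k}(\Gamma)$ is the space of entire functions of $z_1,\dots,z_q$ with period $1$ in each variable and $f(\dots,z_\nu+\tau,\dots)=(-1)^{n_\nu}e\bigl(-(n_\nu z_\nu-z_{\nu-1}-z_{\nu+1}-(\delta_{1,\nu}-1)\tau)\bigr)f(z)$, where $z_0=z_{q+1}=0$. Put $r_\nu=d(n_{\nu+1},\dots,n_q)/d(n_1,\dots,n_q)$. A theta basis is a basis $\{w_\alpha;\alpha\in\mathbb Z/n\mathbb Z\}$ of $\Theta_{n/k}(\Gamma)$ such that, for some constant $\varphi\in\mathbb C$, $$w_\alpha(z+r)=e\bigl(\tfrac{k\alpha}{n}\bigr)w_\alpha(z),\qquad e(z_1+\varphi)\,w_\alpha(z+r\tau)=w_{\alpha+1}(z).$$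 **The dynamical exchange algebra $C_{m_1,\dots,m_q;n,k}(\mathcal E,\eta)$** is the associative unital $\mathbb C$-algebra generated by the commutative algebra of meromorphic functions of the variables $y_{\beta,\nu}$ ($1\le\nu\le q$, $1\le\beta\le m_\nu$) and by elements $e_{\alpha_1,\dots,\alpha_q}$ ($1\le\alpha_\nu\le m_\nu$), with the following relations. First, $e_\alpha f(y)=f(y+s^\alpha)e_\alpha$ for meromorphic $f$, where $s^\alpha_{\beta,\nu}=-(d(n_1,\dots,n_{\nu-1})+d(n_{\nu+1},\dots,n_q))\eta$ if $\beta\ne\alpha_\nu$ and $s^\alpha_{\alpha_\nu,\nu}=(n-d(n_1,\dots,n_{\nu-1})-d(n_{\nu+1},\dots,n_q))\eta$. Second, for all multi-indices $\alpha,\beta$ and all $1\le a\le b\le q$ with $\alpha_t\ne\beta_t$ for $a\le t\le b$, with $\alpha_{a-1}=\beta_{a-1}$ if $a>1$ and $\alpha_{b+1}=\beta_{b+1}$ if $b<q$, $$e_\alpha e_\beta=\Lambda\,e_{\alpha[a,b]}\,e_{\beta[a,b]}+\sum_{a\le t<b}\Lambda_{t,t+1}\,e_{\alpha[a,t]}\,e_{\beta[a,t]},$$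 where $\alpha[a,t]$ and $\beta[a,t]$ arise from $\alpha$ and $\beta$ by exchanging their entries at the places $a,\dots,t$, and, with $y^\alpha_t=y_{\alpha_t,t}$, $$\Lambda=\frac{e(-n\eta)\,\theta(y^\beta_a-y^\alpha_a)\,\theta(y^\beta_b-y^\alpha_b+n\eta)}{\theta(y^\beta_a-y^\alpha_a-n\eta)\,\theta(y^\beta_b-y^\alpha_b)},\qquad \Lambda_{t,t+1}=\frac{e(-n\eta)\,\theta(n\eta)\,\theta(y^\beta_a-y^\alpha_a)}{\theta(y^\beta_a-y^\alpha_a-n\eta)}\cdot\frac{\theta(y^\beta_t+y^\beta_{t+1}-y^\alpha_t-y^\alpha_{t+1})}{\theta(y^\beta_t-y^\alpha_t)\,\theta(y^\beta_{t+1}-y^\alpha_{t+1})}.$$ **Proposition.** Let $\{w_\alpha\}$ be a theta basis of $\Theta_{n/k}(\Gamma)$. There is a homomorphism of $\mathbb C$-algebras $\phi\colon Q_{n,k}(\mathcal E,\eta)\to C_{m_1,\dots,m_q;n,k}(\mathcal E,\eta)$ with $$\phi(x_i)=\sum_{1\le\alpha_1\le m_1,\dots,1\le\alpha_q\le m_q}w_{-i}(y_{\alpha_1,1},\dots,y_{\alpha_q,q})\,e_{\alpha_1,\dots,\alpha_q}\qquad(i\in\mathbb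 Z/n\mathbb Z),$$ and there is a homomorphism of $\mathbb C$-algebras $\phi'\colon Q_{n,k}(\mathcal E,-\eta)\to C_{m_1,\dots,m_q;n,k}(\mathcal E,\eta)$ with $$\phi'(x_i)=\sum_{1\le\alpha_1\le m_1,\dots,1\le\alpha_q\le m_q}w_{i}(y_{\alpha_1,1},\dots,y_{\alpha_q,q})\,e_{\alpha_1,\dots,\alpha_q}\qquad(i\in\mathbb Z/n\mathbb Z).$$ -/

import Mathlib

noncomputable section

namespace EllipticAlg

open Filter Topology

/-! ### Continued fractions and continuants -/

/-- The value of `n₁ - 1 / (n₂ - 1 / (⋯ - 1 / n_q))`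
(the value at the empty list is a dummy). -/
def negContFrac : List ℕ → ℚ
  | [] => 0
  | [a] => a
  | a :: b :: l => a - 1 / negContFrac (b :: l)

/-- `d(m₁, …, m_t)`: the determinant of the tridiagonal matrix with diagonal entries `mᵢ` and
entries `-1` next to the diagonal; `d(∅) = 1`. -/
def d (l : List ℕ) : ℤ :=
  Matrix.det (Matrix.of fun i j : Fin l.length =>
    if i = j then (l.get i : ℤ)
    else if i.val + 1 = j.val ∨ j.val + 1 = i.val then -1 else 0)

/-- `d(n₁, …, n_{ν-1})`, where the entry `n_ν` has the zero-based position `ν`. -/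
def dLeft (ns : List ℕ) (ν : Fin ns.length) : ℤ := d (ns.take ν.val)

/-- `d(n_{ν+1}, …, n_q)`, where the entry `n_ν` has the zero-based position `ν`. -/
def dRight (ns : List ℕ) (ν : Fin ns.length) : ℤ := d (ns.drop (ν.val + 1))

/-! ### Theta functions of one variable, for the lattice generated by `1` and `τ` -/

/-- `e(x) = exp(2πix)`. -/
def e (x : ℂ) : ℂ := Complex.exp (2 * Real.pi * Complex.I * x)

/-- `θ(z) = ∑_{α ∈ ℤ} (-1)^α e(αz + α(α-1)τ/2)`. -/
def theta (τ : UpperHalfPlane) (z : ℂ) : ℂ :=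
  ∑' a : ℤ, (-1 : ℂ) ^ a * e (a * z + (a * (a - 1) : ℂ) / 2 * (τ : ℂ))

/-- The basis `θ_α`, `α ∈ ℤ/nℤ`, of the space of theta functions of order `n`:
`θ_α(z) = ∏_{0 ≤ s < n} θ(z + s/n + ατ/n) · e(αz + α(α-n)τ/(2n) + α/(2n))`.
The right-hand side is periodic in `α` with period `n`; the representative in `[0, n)` is used. -/
def thetaN (n : ℕ) (τ : UpperHalfPlane) (α : ZMod n) (z : ℂ) : ℂ :=
  (∏ s ∈ Finset.range n, theta τ (z + (s : ℂ) / n + (α.val : ℂ) / n * (τ : ℂ))) *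
    e ((α.val : ℂ) * z + (α.val : ℂ) * ((α.val : ℂ) - n) / (2 * n) * (τ : ℂ)
      + (α.val : ℂ) / (2 * n))

theorem theta_eq_jacobiTheta₂ (τ : UpperHalfPlane) (z : ℂ) :
    theta τ z = jacobiTheta₂ (z + 1 / 2 - (τ : ℂ) / 2) τ := by
  unfold theta jacobiTheta₂ jacobiTheta₂_term e
  refine tsum_congr fun a => ?_
  have h : (-1 : ℂ) ^ a = Complex.exp (a * (Real.pi * Complex.I)) := by
    rw [Complex.exp_int_mul, Complex.exp_pi_mul_I]
  rw [h, ← Complex.exp_add]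
  congr 1
  ring

theorem differentiable_theta (τ : UpperHalfPlane) : Differentiable ℂ (theta τ) := by
  have h : theta τ = fun z => jacobiTheta₂ (z + 1 / 2 - (τ : ℂ) / 2) τ :=
    funext (theta_eq_jacobiTheta₂ τ)
  rw [h]
  intro z
  have h1 := differentiableAt_jacobiTheta₂_fst (z + 1 / 2 - (τ : ℂ) / 2) τ.im_pos
  exact h1.comp z (((differentiableAt_id).add_const _).sub_const _)

/-! ### Entire and meromorphic functions of several variables -/

/-- The ring of entire functions on `ℂ^ι`. -/
def Entire (ι : Type) [Fintype ι] : Subalgebra ℂ ((ι → ℂ) → ℂ) where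
  carrier := {f | Differentiable ℂ f}
  mul_mem' hf hg := hf.mul hg
  add_mem' hf hg := hf.add hg
  algebraMap_mem' c := differentiable_const c

variable {ι κ : Type} [Fintype ι] [Fintype κ]

instance : IsDomain (Entire ι) := by
  have : NoZeroDivisors (Entire ι) := by
    refine ⟨fun {f g} h => ?_⟩
    by_contra hcon
    rw [not_or] at hcon
    obtain ⟨hf, hg⟩ := hcon
    have hf' : ∃ a, f.1 a ≠ 0 := by
      by_contra hh
      push Not at hh
      exact hf (Subtype.ext (funext hh))
    have hg' : ∃ b, g.1 b ≠ 0 := by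
      by_contra hh
      push Not at hh
      exact hg (Subtype.ext (funext hh))
    obtain ⟨a, ha⟩ := hf'
    obtain ⟨b, hb⟩ := hg'
    have hl : Differentiable ℂ (fun t : ℂ => a + t • (b - a)) :=
      (differentiable_id.smul_const (b - a)).const_add a
    have h1 : AnalyticOnNhd ℂ (fun t : ℂ => f.1 (a + t • (b - a))) Set.univ :=
      ((Differentiable.comp (g := f.1) f.2 hl).differentiableOn).analyticOnNhd isOpen_univ
    have h2 : AnalyticOnNhd ℂ (fun t : ℂ => g.1 (a + t • (b - a))) Set.univ :=
      ((Differentiable.comp (g := g.1) g.2 hl).differentiableOn).analyticOnNhd isOpen_univ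
    have h3 := AnalyticOnNhd.eq_zero_or_eq_zero_of_mul_eq_zero h1 h2
      (fun t _ => congrFun (congrArg Subtype.val h) (a + t • (b - a))) isPreconnected_univ
    rcases h3 with h3 | h3
    · exact ha (by simpa using h3 0 trivial)
    · exact hb (by simpa using h3 1 trivial)
  have : Nontrivial (Entire ι) :=
    ⟨⟨0, 1, fun h => zero_ne_one (congrFun (congrArg Subtype.val h) 0)⟩⟩
  exact NoZeroDivisors.to_isDomain _

/-- The field of meromorphic functions on `ℂ^ι`: every meromorphic function on `ℂ^ι` is a quotient
of two entire functions. -/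
abbrev Mero (ι : Type) [Fintype ι] : Type := FractionRing (Entire ι)

/-- The coordinate function `y ↦ y i`. -/
def coord (i : ι) : Entire ι :=
  ⟨fun y => y i, differentiable_apply i⟩

/-- The constant function with value `c`. -/
def cst (c : ℂ) : Entire ι := algebraMap ℂ (Entire ι) c

/-- The entire function `y ↦ θ(f(y))`. -/
def thetaOf (τ : UpperHalfPlane) (f : Entire ι) : Entire ι :=
  ⟨fun y => theta τ (f.1 y), (differentiable_theta τ).comp f.2⟩

/-- The entire function `y ↦ f(y_{g(1)}, …, y_{g(q)})`. -/
def subst (g : κ → ι) (f : Entire κ) : Entire ι :=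
  ⟨fun y => f.1 (fun j => y (g j)),
    Differentiable.comp (g := f.1) f.2 (differentiable_pi.2 fun j => differentiable_apply (g j))⟩

/-- The translation `f ↦ f(y + s)` of entire functions, as a ring automorphism. -/
def translate (s : ι → ℂ) : Entire ι ≃+* Entire ι where
  toFun f := ⟨fun y => f.1 (y + s), Differentiable.comp (g := f.1) f.2
    (differentiable_id.add_const s)⟩
  invFun f := ⟨fun y => f.1 (y - s), Differentiable.comp (g := f.1) f.2
    (differentiable_id.sub_const s)⟩
  left_inv f := Subtype.ext (funext fun y => congrArg f.1 (sub_add_cancel y s))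
  right_inv f := Subtype.ext (funext fun y => congrArg f.1 (add_sub_cancel_right y s))
  map_mul' _ _ := rfl
  map_add' _ _ := rfl

/-- The translation `f ↦ f(y + s)` of meromorphic functions. -/
def translateMero (s : ι → ℂ) : Mero ι ≃+* Mero ι :=
  IsFractionRing.ringEquivOfRingEquiv (translate s)

/-- An entire function, regarded as a meromorphic function. -/
def toMero (f : Entire ι) : Mero ι := algebraMap (Entire ι) (Mero ι) f

/-! ### The space `Θ_{n/k}(Γ)` and its theta basis -/

/-- `z_j` for the one-based index `j`, with `z_0 = z_{q+1} = 0`. -/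
def zAt {q : ℕ} (z : Fin q → ℂ) (j : ℕ) : ℂ :=
  if h : 1 ≤ j ∧ j ≤ q then z ⟨j - 1, by omega⟩ else 0

/-- The space of entire functions `f` of `q` variables with `f(…, z_ν + 1, …) = f(z)` and
`f(…, z_ν + τ, …) = (-1)^{n_ν} e(-(n_ν z_ν - z_{ν-1} - z_{ν+1} - (δ_{1,ν} - 1)τ)) f(z)`.
(The index `ν : Fin q` is zero-based, the argument of `zAt` is one-based.) -/
def ThetaSpace (ns : List ℕ) (τ : UpperHalfPlane) : Submodule ℂ (Entire (Fin ns.length)) where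
  carrier := {f | ∀ (ν : Fin ns.length) (z : Fin ns.length → ℂ),
    f.1 (z + Pi.single ν 1) = f.1 z ∧
    f.1 (z + Pi.single ν (τ : ℂ)) =
      (-1 : ℂ) ^ (ns.get ν) *
        e (-((ns.get ν : ℂ) * z ν - zAt z ν.val - zAt z (ν.val + 2)
          - ((if ν.val = 0 then 1 else 0) - 1) * (τ : ℂ))) * f.1 z}
  zero_mem' := fun ν z => ⟨rfl, (mul_zero _).symm⟩
  add_mem' := fun {f g} hf hg ν z => by
    refine ⟨?_, ?_⟩
    · change f.1 _ + g.1 _ = f.1 _ + g.1 _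
      rw [(hf ν z).1, (hg ν z).1]
    · change f.1 _ + g.1 _ = _ * (f.1 _ + g.1 _)
      rw [(hf ν z).2, (hg ν z).2, mul_add]
  smul_mem' := fun c f hf ν z => by
    refine ⟨?_, ?_⟩
    · change c * f.1 _ = c * f.1 _
      rw [(hf ν z).1]
    · change c * f.1 _ = _ * (c * f.1 _)
      rw [(hf ν z).2]
      ring

/-- The numbers `r_ν = d(n_{ν+1}, …, n_q) / d(n₁, …, n_q)`. -/
def rVec (ns : List ℕ) (ν : Fin ns.length) : ℂ := (dRight ns ν : ℂ) / (d ns : ℂ)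

/-- `{w_α; α ∈ ℤ/nℤ}` is the theta basis of `Θ_{n/k}(Γ)` (unique up to the choices of `φ` and of a
common factor): a basis with
`T_{1/n} w_α = e(kα/n) w_α` and `T_{τ/n} w_α = w_{α+1}`, where `(T_{1/n} f)(z) = f(z + r)` and
`(T_{τ/n} f)(z) = e(z₁ + φ) f(z + rτ)` for a constant `φ`. As `α` runs through `ℤ/nℤ`, the constant
`φ` is automatically such that the `n`-th power of `T_{τ/n}` is the identity of `Θ_{n/k}(Γ)`. -/
structure IsThetaBasis (n k : ℕ) (ns : List ℕ) (τ : UpperHalfPlane)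
    (w : ZMod n → Entire (Fin ns.length)) : Prop where
  linearIndependent : LinearIndependent ℂ w
  span_eq : Submodule.span ℂ (Set.range w) = ThetaSpace ns τ
  shift_one : ∀ (α : ZMod n) (z : Fin ns.length → ℂ),
    (w α).1 (z + rVec ns) = e ((k : ℂ) * (α.val : ℂ) / n) * (w α).1 z
  shift_tau : ∃ φ : ℂ, ∀ (α : ZMod n) (z : Fin ns.length → ℂ),
    e (zAt z 1 + φ) * (w α).1 (z + (τ : ℂ) • rVec ns) = (w (α + 1)).1 z

/-! ### The algebra `Q_{n,k}(ℰ, η)` -/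

/-- The relations `∑_r θ_{j-i+r(k-1)}(0) / (θ_{kr}(η) θ_{j-i-r}(-η)) x_{j-r} x_{i+r} = 0`,
`i, j ∈ ℤ/nℤ`.
Their coefficients are holomorphic at `η` if `nη ∉ Γ`, and then `θ(nη) ≠ 0`, so that the common
factor `θ(nη)` does not change the relation. If `nη ∈ Γ` (for example `η = 0`), the coefficients
multiplied by `θ(nη)` still have limits, which are the coefficients of the relation; for `η = 0`
the relations become `x_i x_j = x_j x_i`. -/
inductive QRel (n k : ℕ) [NeZero n] (τ : UpperHalfPlane) (η : ℂ) :
    FreeAlgebra ℂ (ZMod n) → FreeAlgebra ℂ (ZMod n) → Prop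
  | rel (i j : ZMod n) (c : ZMod n → ℂ)
      (hc : ∀ r : ZMod n, Tendsto (fun t : ℂ => theta τ (n * t) *
        (thetaN n τ (j - i + r * ((k : ZMod n) - 1)) 0 /
          (thetaN n τ ((k : ZMod n) * r) t * thetaN n τ (j - i - r) (-t)))) (𝓝[≠] η) (𝓝 (c r))) :
      QRel n k τ η
        (∑ r : ZMod n, c r • (FreeAlgebra.ι ℂ (j - r) * FreeAlgebra.ι ℂ (i + r))) 0

/-- The algebra `Q_{n,k}(ℰ, η)`, `ℰ = ℂ/Γ`. -/
abbrev QAlg (n k : ℕ) [NeZero n] (τ : UpperHalfPlane) (η : ℂ) : Type :=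
  RingQuot (QRel n k τ η)

/-- The generators `x_i`, `i ∈ ℤ/nℤ`. -/
def QAlg.x {n k : ℕ} [NeZero n] {τ : UpperHalfPlane} {η : ℂ} (i : ZMod n) : QAlg n k τ η :=
  RingQuot.mkAlgHom ℂ (QRel n k τ η) (FreeAlgebra.ι ℂ i)

/-! ### The dynamical exchange algebra `C_{m₁,…,m_q;n,k}(ℰ, η)` -/

/-- The index set of the dynamical variables: `⟨ν, β⟩` stands for `y_{β,ν}`, `1 ≤ β ≤ m_ν`. -/
abbrev YIdx {q : ℕ} (m : Fin q → ℕ) : Type := Σ ν : Fin q, Fin (m ν)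

/-- The index set of the generators `e_{α₁,…,α_q}`, `1 ≤ α_ν ≤ m_ν`. -/
abbrev EIdx {q : ℕ} (m : Fin q → ℕ) : Type := (ν : Fin q) → Fin (m ν)

/-- The generators of the exchange algebra: the meromorphic functions of the `y_{β,ν}`, and the
`e_{α₁,…,α_q}`. -/
inductive CGen {q : ℕ} (m : Fin q → ℕ) : Type
  | fn (f : Mero (YIdx m))
  | gen (α : EIdx m)

section Exchange

variable {q : ℕ} {m : Fin q → ℕ}

/-- `y_{α_ν,ν}`. -/
def yv (α : EIdx m) (ν : Fin q) : Entire (YIdx m) := coord ⟨ν, α ν⟩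

/-- The multi-index that agrees with `β` at the places `a, …, t` and with `α` elsewhere. -/
def replaceOn (α β : EIdx m) (a t : Fin q) : EIdx m :=
  fun s => if a ≤ s ∧ s ≤ t then β s else α s

/-- For the places `a ≤ b`:
`Λ = e(-nη) θ(y_{β_a,a} - y_{α_a,a}) θ(y_{β_b,b} - y_{α_b,b} + nη) /
(θ(y_{β_a,a} - y_{α_a,a} - nη) θ(y_{β_b,b} - y_{α_b,b}))`. -/
def Lam (n : ℕ) (τ : UpperHalfPlane) (η : ℂ) (α β : EIdx m) (a b : Fin q) : Mero (YIdx m) :=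
  toMero (cst (e (-(n * η))) * thetaOf τ (yv β a - yv α a)
      * thetaOf τ (yv β b - yv α b + cst (n * η))) /
    toMero (thetaOf τ (yv β a - yv α a - cst (n * η)) * thetaOf τ (yv β b - yv α b))

/-- For the place `a` and the consecutive places `t`, `u = t + 1`:
`Λ_{t,u} = e(-nη) θ(nη) θ(y_{β_a,a} - y_{α_a,a}) / θ(y_{β_a,a} - y_{α_a,a} - nη) ·
θ(y_{β_t,t} + y_{β_u,u} - y_{α_t,t} - y_{α_u,u}) /
(θ(y_{β_t,t} - y_{α_t,t}) θ(y_{β_u,u} - y_{α_u,u}))`. -/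
def LamStep (n : ℕ) (τ : UpperHalfPlane) (η : ℂ) (α β : EIdx m) (a t u : Fin q) :
    Mero (YIdx m) :=
  toMero (cst (e (-(n * η)) * theta τ (n * η)) * thetaOf τ (yv β a - yv α a)) /
      toMero (thetaOf τ (yv β a - yv α a - cst (n * η))) *
    (toMero (thetaOf τ (yv β t + yv β u - yv α t - yv α u)) /
      toMero (thetaOf τ (yv β t - yv α t) * thetaOf τ (yv β u - yv α u)))

end Exchange

/-- The vector `s` with `e_α y_{β,ν} = (y_{β,ν} + s_{β,ν}) e_α`. -/
def dynShift (n : ℕ) (ns : List ℕ) {m : Fin ns.length → ℕ} (η : ℂ) (α : EIdx m) :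
    YIdx m → ℂ :=
  fun p => if α p.1 = p.2 then ((n : ℂ) - dLeft ns p.1 - dRight ns p.1) * η
    else -((dLeft ns p.1 + dRight ns p.1 : ℂ) * η)

/-- The defining relations of the exchange algebra: the first three make the meromorphic functions
a (commutative) subalgebra with its ordinary operations, the fourth says that the `y_{β,ν}` are
dynamical variables, and the last one is the family of quadratic relations: one for every pair
`α, β` and every block of places `a, …, b` on which `α_t ≠ β_t`, such that `α = β` at the place
before the block and at the place after it, if there are such places. The block of all places
gives the relations in general position. -/
inductive CRel (n : ℕ) (ns : List ℕ) (m : Fin ns.length → ℕ) (τ : UpperHalfPlane) (η : ℂ) :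
    FreeAlgebra ℂ (CGen m) → FreeAlgebra ℂ (CGen m) → Prop
  | add (f g : Mero (YIdx m)) :
      CRel n ns m τ η (FreeAlgebra.ι ℂ (.fn (f + g)))
        (FreeAlgebra.ι ℂ (.fn f) + FreeAlgebra.ι ℂ (.fn g))
  | mul (f g : Mero (YIdx m)) :
      CRel n ns m τ η (FreeAlgebra.ι ℂ (.fn (f * g)))
        (FreeAlgebra.ι ℂ (.fn f) * FreeAlgebra.ι ℂ (.fn g))
  | const (c : ℂ) :
      CRel n ns m τ η (FreeAlgebra.ι ℂ (.fn (toMero (cst c))))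
        (algebraMap ℂ (FreeAlgebra ℂ (CGen m)) c)
  | dyn (α : EIdx m) (f : Mero (YIdx m)) :
      CRel n ns m τ η (FreeAlgebra.ι ℂ (.gen α) * FreeAlgebra.ι ℂ (.fn f))
        (FreeAlgebra.ι ℂ (.fn (translateMero (dynShift n ns η α) f)) * FreeAlgebra.ι ℂ (.gen α))
  | quad (α β : EIdx m) (a b : Fin ns.length) (hab : a ≤ b)
      (hne : ∀ t, a ≤ t → t ≤ b → α t ≠ β t)
      (hleft : ∀ t : Fin ns.length, t.val + 1 = a.val → α t = β t)
      (hright : ∀ t : Fin ns.length, b.val + 1 = t.val → α t = β t) :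
      CRel n ns m τ η (FreeAlgebra.ι ℂ (.gen α) * FreeAlgebra.ι ℂ (.gen β))
        (FreeAlgebra.ι ℂ (.fn (Lam n τ η α β a b)) *
            FreeAlgebra.ι ℂ (.gen (replaceOn α β a b)) *
            FreeAlgebra.ι ℂ (.gen (replaceOn β α a b)) +
          ∑ p : Fin ns.length × Fin ns.length with
              a ≤ p.1 ∧ p.1.val + 1 = p.2.val ∧ p.2 ≤ b,
            FreeAlgebra.ι ℂ (.fn (LamStep n τ η α β a p.1 p.2)) *
              FreeAlgebra.ι ℂ (.gen (replaceOn α β a p.1)) *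
              FreeAlgebra.ι ℂ (.gen (replaceOn β α a p.1)))

/-- The algebra `C_{m₁,…,m_q;n,k}(ℰ, η)`, `ℰ = ℂ/Γ`; here `ns = (n₁, …, n_q)` is the continued
fraction of `n/k`. -/
abbrev CAlg (n : ℕ) (ns : List ℕ) (m : Fin ns.length → ℕ) (τ : UpperHalfPlane) (η : ℂ) : Type :=
  RingQuot (CRel n ns m τ η)

/-- A meromorphic function of the `y_{β,ν}`, as an element of the exchange algebra. -/
def CAlg.fn {n : ℕ} {ns : List ℕ} {m : Fin ns.length → ℕ} {τ : UpperHalfPlane} {η : ℂ}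
    (f : Mero (YIdx m)) : CAlg n ns m τ η :=
  RingQuot.mkAlgHom ℂ (CRel n ns m τ η) (FreeAlgebra.ι ℂ (.fn f))

/-- The generator `e_{α₁,…,α_q}`. -/
def CAlg.gen {n : ℕ} {ns : List ℕ} {m : Fin ns.length → ℕ} {τ : UpperHalfPlane} {η : ℂ}
    (α : EIdx m) : CAlg n ns m τ η :=
  RingQuot.mkAlgHom ℂ (CRel n ns m τ η) (FreeAlgebra.ι ℂ (.gen α))

/-- `∑_{α₁,…,α_q} w(y_{α₁,1}, …, y_{α_q,q}) e_{α₁,…,α_q}`. -/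
def CAlg.sum {n : ℕ} {ns : List ℕ} {m : Fin ns.length → ℕ} {τ : UpperHalfPlane} {η : ℂ}
    (w : Entire (Fin ns.length)) : CAlg n ns m τ η :=
  ∑ α : EIdx m, CAlg.fn (toMero (subst (fun ν => (⟨ν, α ν⟩ : YIdx m)) w)) * CAlg.gen α

end EllipticAlg

end

noncomputable section

namespace EllipticAlg

open Filter Topology

set_option linter.unusedSectionVars false

/-! ### The exponential `e` -/

/-! Write a relation of `Q` with the proposed images of the generators and move all functions to the
left. The coefficient of `e_α e_β` is then a sum over `r` of products of two basis elements, one at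
the variables `y^α`, the other at the variables `y^β` translated by the dynamical shift of `e_α`. It
must be shown that these coefficients combine to zero modulo the quadratic relations.

The analytic core is the exchange identity `exchDiff_eq_zero`. It turns the sum over `r` into a sum
over `t = 0, …, q` in which the two sets of variables are exchanged at the places `1, …, t`, with
coefficients given by the Kronecker function `θ(x + y) / (θ(x) θ(y))` at `(-u_t, u_{t+1})`, where
the `u_j` are the differences of the two sets. Both sides, as functions of a parameter `A`, are
invariant under `A ↦ A + n` and acquire the factor `e(-B)` under `A ↦ A + nτ`. For generic variables
all poles are simple. At a lattice point one summand on each side is singular, and the residues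
agree because `w_α` is a theta basis; at a zero of `θ(u_j)`, `1 ≤ j ≤ q`, the residues of the
summands `t = j - 1` and `t = j` cancel. The difference is therefore entire, and it vanishes by
Liouville's theorem because `B` is not a lattice point. The recursions and the constant Wronskian of
the continuants supply the multipliers. Continuity removes the genericity assumption.

Putting `A = -nη`, `B = nη` and multiplying by `θ(nη)` produces the coefficients of the relations of
`Q`. At the places where `α = β` the difference `u_j` becomes `nη`, and the factor `θ(nη)` cancels
the resulting poles, so that the limit of `η` can be taken (`exchange_limit`).

The algebra is a resummation. For each `t` the multi-indices are exchanged on the places after the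
last agreement up to `t`. This is an involution on the pairs `(α, β)`, and it makes the product of
theta functions depend only on the pair and the place of that agreement (`exchProd_flip`). The terms
with a common agreement place then form a multiple of one quadratic relation, or a single zero term
if the block is empty (`sum_blockTerm_eq_zero`). The second homomorphism follows from the first by
the symmetry `(i, j, r, η) ↦ (-i, -j, -r, -η)` of the coefficients (`tendsto_coefficient_neg`). -/

theorem e_add (x y : ℂ) : e (x + y) = e x * e y := by
  simp only [e, mul_add, Complex.exp_add]

theorem e_zero : e 0 = 1 := by simp [e]

theorem e_ne_zero (x : ℂ) : e x ≠ 0 := Complex.exp_ne_zero _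

theorem e_neg (x : ℂ) : e (-x) = (e x)⁻¹ := by
  simp only [e, mul_neg, Complex.exp_neg]

theorem e_sub (x y : ℂ) : e (x - y) = e x / e y := by
  rw [sub_eq_add_neg, e_add, e_neg, div_eq_mul_inv]

theorem e_int_mul (a : ℤ) (x : ℂ) : e (a * x) = e x ^ a := by
  simp only [e, ← Complex.exp_int_mul]
  congr 1
  ring

theorem e_nat_mul (a : ℕ) (x : ℂ) : e (a * x) = e x ^ a := by
  have := e_int_mul a x
  simpa using this

theorem e_eq_one_iff (x : ℂ) : e x = 1 ↔ ∃ m : ℤ, x = m := by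
  rw [e, Complex.exp_eq_one_iff]
  refine exists_congr fun m => ?_
  rw [mul_comm, mul_left_inj' Complex.two_pi_I_ne_zero]

theorem e_int (a : ℤ) : e a = 1 := (e_eq_one_iff _).2 ⟨a, rfl⟩

theorem e_one : e 1 = 1 := by simpa using e_int 1

theorem e_eq_of_sub_int {x y : ℂ} (m : ℤ) (h : x = y + m) : e x = e y := by
  rw [h, e_add, e_int, mul_one]

theorem e_half : e (1 / 2) = -1 := by
  rw [e, ← Complex.exp_pi_mul_I]
  congr 1
  ring

theorem differentiable_e : Differentiable ℂ e := by
  unfold e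
  fun_prop

theorem continuous_e : Continuous e := differentiable_e.continuous

theorem norm_e (x : ℂ) : ‖e x‖ = Real.exp (-(2 * Real.pi * x.im)) := by
  rw [e, Complex.norm_exp]
  congr 1
  simp

theorem hasDerivAt_e (x : ℂ) : HasDerivAt e (e x * (2 * Real.pi * Complex.I)) x := by
  have := ((hasDerivAt_id x).const_mul (2 * Real.pi * Complex.I : ℂ)).cexp
  simp only [mul_one, id] at this
  exact this

/-! ### Quasi-periodic functions -/

section Liouville

variable (τ : UpperHalfPlane)

theorem tau_im_ne_zero : (τ : ℂ).im ≠ 0 := τ.im_pos.ne'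

theorem exists_real_coords (z : ℂ) : ∃ x y : ℝ, z = x + y * (τ : ℂ) := by
  refine ⟨z.re - z.im / (τ : ℂ).im * (τ : ℂ).re, z.im / (τ : ℂ).im, ?_⟩
  have := tau_im_ne_zero τ
  apply Complex.ext
  · simp
  · simp only [Complex.add_im, Complex.ofReal_im, Complex.mul_im, Complex.ofReal_re, zero_mul,
      add_zero, zero_add]
    field_simp

/-- Every value of the norm is taken on a compact period parallelogram. Periodicity of the norm
alone is what is available after a multiplier has been compensated only in absolute value. -/
theorem bounded_of_norm_periodic {n : ℕ} (hn : 0 < n) {h : ℂ → ℂ} (hc : Continuous h)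
    (h1 : ∀ z, ‖h (z + n)‖ = ‖h z‖) (h2 : ∀ z, ‖h (z + n * (τ : ℂ))‖ = ‖h z‖) :
    Bornology.IsBounded (Set.range h) := by
  have h1' : ∀ (a : ℤ) (z : ℂ), ‖h (z + a * n)‖ = ‖h z‖ := by
    intro a
    induction a using Int.induction_on with
    | zero => simp
    | succ i ih =>
      intro z
      rw [← ih z, ← h1 (z + (i : ℤ) * n)]
      congr 2; push_cast; ring
    | pred i ih =>
      intro z
      rw [← ih z, ← h1 (z + ((-(i : ℤ) - 1 : ℤ) : ℂ) * n)]
      congr 2; push_cast; ring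
  have h2' : ∀ (a : ℤ) (z : ℂ), ‖h (z + a * (n * (τ : ℂ)))‖ = ‖h z‖ := by
    intro a
    induction a using Int.induction_on with
    | zero => simp
    | succ i ih =>
      intro z
      rw [← ih z, ← h2 (z + (i : ℤ) * (n * (τ : ℂ)))]
      congr 2; push_cast; ring
    | pred i ih =>
      intro z
      rw [← ih z, ← h2 (z + ((-(i : ℤ) - 1 : ℤ) : ℂ) * (n * (τ : ℂ)))]
      congr 2; push_cast; ring
  have hK : IsCompact ((fun p : ℝ × ℝ => (p.1 : ℂ) * n + p.2 * (n * (τ : ℂ))) ''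
      (Set.Icc 0 1 ×ˢ Set.Icc 0 1)) :=
    (isCompact_Icc.prod isCompact_Icc).image (by fun_prop)
  obtain ⟨C, hC⟩ := (hK.exists_bound_of_continuousOn hc.continuousOn)
  refine isBounded_iff_forall_norm_le.2 ⟨C, ?_⟩
  rintro _ ⟨z, rfl⟩
  have hn' : (n : ℂ) ≠ 0 := by exact_mod_cast hn.ne'
  obtain ⟨x, y, hxy⟩ := exists_real_coords τ (z / n)
  have hz : z = (x : ℂ) * n + y * (n * (τ : ℂ)) := by
    field_simp at hxy
    rw [hxy]; ring
  have := hC ((Int.fract x : ℝ) * n + (Int.fract y : ℝ) * (n * (τ : ℂ)))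
    ⟨(Int.fract x, Int.fract y), ⟨⟨Int.fract_nonneg _, (Int.fract_lt_one _).le⟩,
      ⟨Int.fract_nonneg _, (Int.fract_lt_one _).le⟩⟩, rfl⟩
  rw [← h1' ⌊x⌋, ← h2' ⌊y⌋] at this
  have hx : ((Int.fract x : ℝ) : ℂ) = x - ⌊x⌋ := by rw [Int.fract]; push_cast; rfl
  have hy : ((Int.fract y : ℝ) : ℂ) = y - ⌊y⌋ := by rw [Int.fract]; push_cast; rfl
  have hz' : z = (Int.fract x : ℝ) * n + (Int.fract y : ℝ) * (n * (τ : ℂ)) + ⌊x⌋ * n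
      + ⌊y⌋ * (n * (τ : ℂ)) := by
    rw [hx, hy, hz]; ring
  rw [hz']
  exact this

/-- A function on `ℂ` with removable singularities and constant multipliers is an exponential. -/
theorem eq_const_mul_e_of_quasiperiodic {n : ℕ} (hn : 0 < n) (B : ℂ) {f : ℂ → ℂ}
    (hd : ∀ c, ∀ᶠ z in 𝓝[≠] c, DifferentiableAt ℂ f z)
    (h0 : ∀ c, Tendsto (fun z => (z - c) * f z) (𝓝[≠] c) (𝓝 0))
    (h1 : ∀ z, f (z + n) = f z) (h2 : ∀ z, f (z + n * (τ : ℂ)) = e (-B) * f z) :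
    ∃ (C : ℂ) (l : ℝ), l = -(B.im / (n * (τ : ℂ).im)) ∧
      (∀ z, ContinuousAt f z → f z = C * e (l * z)) ∧
      (C ≠ 0 → e (l * n) = 1 ∧ e (l * (n * (τ : ℂ))) = e (-B)) := by
  -- By Riemann's theorem `f` has a limit at every point; the function of these limits is entire.
  -- The value of `f` at a singularity is arbitrary, hence the restriction to points of continuity
  -- in the conclusion.
  set g : ℂ → ℂ := fun c => limUnder (𝓝[≠] c) f with hg
  have hlo : ∀ c, (fun z => f z - f c) =o[𝓝[≠] c] fun z => (z - c)⁻¹ := by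
    intro c
    rw [Asymptotics.isLittleO_iff_tendsto']
    · have h3 : Tendsto (fun z => (z - c) * f z - (z - c) * f c) (𝓝[≠] c) (𝓝 (0 - 0)) := by
        refine (h0 c).sub ?_
        have : Tendsto (fun z => (z - c) * f c) (𝓝 c) (𝓝 ((c - c) * f c)) := by
          apply Continuous.tendsto; fun_prop
        simpa using this.mono_left nhdsWithin_le_nhds
      rw [sub_zero] at h3
      refine h3.congr fun z => ?_
      rw [div_inv_eq_mul]; ring
    · filter_upwards [self_mem_nhdsWithin] with z hz h
      exact absurd (inv_eq_zero.1 h) (sub_ne_zero.2 hz)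
  have hlim : ∀ c, Tendsto f (𝓝[≠] c) (𝓝 (g c)) := fun c =>
    Complex.tendsto_limUnder_of_differentiable_on_punctured_nhds_of_isLittleO (hd c) (hlo c)
  have hgf : ∀ z, ContinuousAt f z → g z = f z := fun z hz =>
    tendsto_nhds_unique (hlim z) (hz.tendsto.mono_left nhdsWithin_le_nhds)
  have hgd : Differentiable ℂ g := by
    intro c
    have h3 := Complex.differentiableOn_update_limUnder_insert_of_isLittleO (f := f) (c := c)
      (s := {z | DifferentiableAt ℂ f z}) (hd c)
      (fun z hz => DifferentiableAt.differentiableWithinAt hz) (hlo c)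
    have h4 := h3.differentiableAt (insert_mem_nhds_iff.2 (hd c))
    refine h4.congr_of_eventuallyEq ?_
    have h5 := eventually_nhdsWithin_iff.1 (hd c)
    filter_upwards [h5] with z hz
    by_cases hzc : z = c
    · subst hzc; simp [hg]
    · rw [Function.update_of_ne hzc, hgf z (hz hzc).continuousAt]
  have hne : ∀ c a : ℂ, Tendsto (fun z => z + a) (𝓝[≠] c) (𝓝[≠] (c + a)) := by
    intro c a
    refine tendsto_nhdsWithin_iff.2 ⟨?_, ?_⟩
    · exact (Continuous.tendsto (by fun_prop) c).mono_left nhdsWithin_le_nhds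
    · filter_upwards [self_mem_nhdsWithin] with z hz h
      exact hz (add_right_cancel h)
  have hg1 : ∀ z, g (z + n) = g z := fun z =>
    tendsto_nhds_unique ((hlim _).comp (hne z n)) ((hlim z).congr fun x => (h1 x).symm)
  have hg2 : ∀ z, g (z + n * (τ : ℂ)) = e (-B) * g z := fun z =>
    tendsto_nhds_unique ((hlim _).comp (hne z _))
      (((hlim z).const_mul (e (-B))).congr fun x => (h2 x).symm)
  -- As `l` is real, `|e(-lz)|` has period `n`; under `z ↦ z + nτ` it acquires the factor `exp(-2π
  -- Im B)`, which cancels `|e(-B)|`. So `g(z) e(-lz)` is bounded.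
  set l : ℝ := -(B.im / (n * (τ : ℂ).im)) with hl
  have hbd := bounded_of_norm_periodic τ hn (h := fun z => g z * e (-(l * z)))
    (hgd.continuous.mul (continuous_e.comp (by fun_prop)))
    (fun z => by
      simp only [norm_mul, norm_e, hg1]
      congr 3
      simp) (fun z => by
      have hn' : (n : ℝ) ≠ 0 := by exact_mod_cast hn.ne'
      have hτ := tau_im_ne_zero τ
      simp only [norm_mul, norm_e, hg2]
      rw [mul_comm (Real.exp _), mul_assoc, ← Real.exp_add]
      congr 2
      have : ((l : ℂ) * (z + n * (τ : ℂ))).im = (l * z).im + l * (n * (τ : ℂ).im) := by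
        simp [mul_add]
      have h6 : l * (n * (τ : ℂ).im) = - B.im := by
        rw [hl]; field_simp
      rw [Complex.neg_im, Complex.neg_im, Complex.neg_im, this, h6]
      ring)
  obtain ⟨C, hC⟩ := Differentiable.exists_const_forall_eq_of_bounded
    (f := fun z => g z * e (-(l * z)))
    (hgd.mul (differentiable_e.comp (by fun_prop))) hbd
  have hgC : ∀ z, g z = C * e (l * z) := fun z => by
    rw [← hC z, mul_assoc, ← e_add, neg_add_cancel, e_zero, mul_one]
  refine ⟨C, l, rfl, fun z hz => by rw [← hgf z hz, hgC], fun hC0 => ⟨?_, ?_⟩⟩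
  · have := hg1 0
    rw [hgC, hgC, zero_add, mul_zero, e_zero] at this
    exact mul_left_cancel₀ hC0 this
  · have := hg2 0
    rw [hgC, hgC, zero_add, mul_zero, e_zero, mul_one, mul_comm (e (-B))] at this
    exact mul_left_cancel₀ hC0 this

end Liouville

/-- The lattice `ℤ + ℤτ`. -/
def lattice (τ : UpperHalfPlane) : Set ℂ := {z | ∃ p a : ℤ, z = p + a * (τ : ℂ)}

theorem zero_mem_lattice (τ : UpperHalfPlane) : (0 : ℂ) ∈ lattice τ := ⟨0, 0, by simp⟩

theorem countable_lattice (τ : UpperHalfPlane) : (lattice τ).Countable := by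
  have : lattice τ = Set.range (fun x : ℤ × ℤ => (x.1 : ℂ) + x.2 * (τ : ℂ)) := by
    ext z
    constructor
    · rintro ⟨p, a, rfl⟩
      exact ⟨(p, a), rfl⟩
    · rintro ⟨⟨p, a⟩, rfl⟩
      exact ⟨p, a, rfl⟩
  rw [this]
  exact Set.countable_range _

/-- A nonzero exponential `C e(lz)` with these multipliers has `ln = m` and `lnτ + B = p` with
integers `m`, `p`, whence `B = p - mτ` is a lattice point. -/
theorem eq_zero_of_quasiperiodic (τ : UpperHalfPlane) {n : ℕ} (hn : 0 < n) {B : ℂ}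
    (hB : B ∉ lattice τ) {f : ℂ → ℂ}
    (hd : ∀ c, ∀ᶠ z in 𝓝[≠] c, DifferentiableAt ℂ f z)
    (h0 : ∀ c, Tendsto (fun z => (z - c) * f z) (𝓝[≠] c) (𝓝 0))
    (h1 : ∀ z, f (z + n) = f z) (h2 : ∀ z, f (z + n * (τ : ℂ)) = e (-B) * f z)
    {z : ℂ} (hz : ContinuousAt f z) : f z = 0 := by
  obtain ⟨C, l, -, hf, hC⟩ := eq_const_mul_e_of_quasiperiodic τ hn B hd h0 h1 h2
  rw [hf z hz]
  by_contra hne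
  obtain ⟨h3, h4⟩ := hC (left_ne_zero_of_mul hne)
  obtain ⟨m, hm⟩ := (e_eq_one_iff _).1 h3
  have h5 : e (l * (n * (τ : ℂ)) + B) = 1 := by
    rw [e_add, h4, ← e_add, neg_add_cancel, e_zero]
  obtain ⟨p, hp⟩ := (e_eq_one_iff _).1 h5
  refine hB ⟨p, -m, ?_⟩
  rw [← hp, Int.cast_neg, ← hm]
  ring

/-! ### Quasi-periodicity and zeros of `θ` -/

theorem theta_add_one (τ : UpperHalfPlane) (z : ℂ) : theta τ (z + 1) = theta τ z := by
  rw [theta_eq_jacobiTheta₂, theta_eq_jacobiTheta₂,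
    ← jacobiTheta₂_add_left (z + 1 / 2 - (τ : ℂ) / 2)]
  congr 1
  ring

theorem theta_add_tau (τ : UpperHalfPlane) (z : ℂ) :
    theta τ (z + τ) = -e (-z) * theta τ z := by
  rw [theta_eq_jacobiTheta₂, theta_eq_jacobiTheta₂,
    show z + τ + 1 / 2 - (τ : ℂ) / 2 = z + 1 / 2 - (τ : ℂ) / 2 + τ by ring,
    jacobiTheta₂_add_left']
  congr 1
  have h : e (-z - 1 / 2) = -e (-z) := by
    rw [e_sub, e_half, div_neg, div_one]
  rw [← h, e]
  congr 1
  ring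

/-- Evenness of `jacobiTheta₂` and the shift by `(1 - τ)/2` give `θ(-z) = θ(z + τ)`. -/
theorem theta_neg (τ : UpperHalfPlane) (z : ℂ) : theta τ (-z) = -e (-z) * theta τ z := by
  rw [← theta_add_tau, theta_eq_jacobiTheta₂, theta_eq_jacobiTheta₂, ← jacobiTheta₂_neg_left,
    ← jacobiTheta₂_add_left (-(-z + 1 / 2 - (τ : ℂ) / 2))]
  congr 1
  ring

theorem theta_zero (τ : UpperHalfPlane) : theta τ 0 = 0 := by
  have := theta_neg τ 0
  simp only [neg_zero, e_zero] at this
  linear_combination this / 2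

theorem continuous_theta (τ : UpperHalfPlane) : Continuous (theta τ) :=
  (differentiable_theta τ).continuous

theorem theta_add_int (τ : UpperHalfPlane) (z : ℂ) (p : ℤ) : theta τ (z + p) = theta τ z := by
  induction p using Int.induction_on with
  | zero => simp
  | succ i ih =>
    rw [← ih, ← theta_add_one τ (z + (i : ℤ))]
    congr 1; push_cast; ring
  | pred i ih =>
    rw [← ih, ← theta_add_one]
    congr 1; push_cast; ring

theorem theta_add_int_tau (τ : UpperHalfPlane) (z : ℂ) (a : ℤ) :
    theta τ (z + a * (τ : ℂ)) = (-1) ^ a * e (-(a * z + a * (a - 1) / 2 * τ)) * theta τ z := by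
  have key : ∀ b : ℤ, theta τ (z + (b + 1 : ℤ) * (τ : ℂ))
      = -e (-(z + b * τ)) * theta τ (z + b * (τ : ℂ)) := by
    intro b
    rw [← theta_add_tau]
    congr 1; push_cast; ring
  induction a using Int.induction_on with
  | zero => simp [e_zero]
  | succ i ih =>
    rw [key, ih, zpow_add_one₀ (by norm_num : (-1 : ℂ) ≠ 0)]
    have : e (-(((i : ℤ) + 1 : ℤ) * z + ((i : ℤ) + 1 : ℤ) * (((i : ℤ) + 1 : ℤ) - 1) / 2 * (τ : ℂ)))
      = e (-(z + (i : ℤ) * τ)) * e (-((i : ℤ) * z + (i : ℤ) * ((i : ℤ) - 1) / 2 * τ)) := by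
      rw [← e_add]; congr 1; push_cast; ring
    rw [this]; ring
  | pred i ih =>
    have h := key (-(i : ℤ) - 1)
    rw [sub_add_cancel, ih] at h
    have h3 : e (-(z + (-(i : ℤ) - 1 : ℤ) * (τ : ℂ))) ≠ 0 := e_ne_zero _
    have : e (-((-(i : ℤ) : ℤ) * z + (-(i : ℤ) : ℤ) * ((-(i : ℤ) : ℤ) - 1) / 2 * (τ : ℂ)))
      = e (-(z + (-(i : ℤ) - 1 : ℤ) * (τ : ℂ))) * e (-((-(i : ℤ) - 1 : ℤ) * z +
        (-(i : ℤ) - 1 : ℤ) * ((-(i : ℤ) - 1 : ℤ) - 1) / 2 * (τ : ℂ))) := by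
      rw [← e_add]; congr 1; push_cast; ring
    rw [this] at h
    apply mul_left_cancel₀ h3
    rw [zpow_sub_one₀ (by norm_num : (-1 : ℂ) ≠ 0)]
    linear_combination h

theorem theta_add_lattice (τ : UpperHalfPlane) (z : ℂ) (p a : ℤ) :
    theta τ (z + (p + a * (τ : ℂ)))
      = (-1) ^ a * e (-(a * z + a * (a - 1) / 2 * τ)) * theta τ z := by
  rw [← theta_add_int_tau, ← theta_add_int τ (z + a * (τ : ℂ)) p]
  congr 1; ring

theorem theta_lattice {τ : UpperHalfPlane} {z : ℂ} (hz : z ∈ lattice τ) : theta τ z = 0 := by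
  obtain ⟨p, a, rfl⟩ := hz
  rw [← zero_add ((p : ℂ) + _), theta_add_lattice, theta_zero, mul_zero]

/-! ### The product formula and the zeros of `θ` -/

/-- `∏_{m ≥ 0} (1 - q^m w)`. -/
def qProd (q w : ℂ) : ℂ := ∏' m : ℕ, (1 - q ^ m * w)

section qProd

variable {q : ℂ} (hq : ‖q‖ < 1)
include hq

theorem summable_norm_pow_mul (w : ℂ) : Summable fun m : ℕ => ‖-(q ^ m * w)‖ := by
  simp only [norm_neg, norm_mul, norm_pow]
  exact (summable_geometric_of_lt_one (norm_nonneg _) hq).mul_right _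

theorem multipliable_one_sub_pow_mul (w : ℂ) : Multipliable fun m : ℕ => 1 - q ^ m * w := by
  simpa only [sub_eq_add_neg] using multipliable_one_add_of_summable (summable_norm_pow_mul hq w)

theorem differentiable_qProd : Differentiable ℂ (qProd q) := by
  have h : HasProdLocallyUniformlyOn (fun (m : ℕ) (w : ℂ) => 1 - q ^ m * w)
      (fun w => ∏' m : ℕ, (1 - q ^ m * w)) Set.univ := by
    simp_rw [sub_eq_add_neg]
    apply hasProdLocallyUniformlyOn_of_forall_compact isOpen_univ
    intro K _ hcK
    obtain ⟨R, hR⟩ := hcK.exists_bound_of_continuousOn (f := fun w : ℂ => w) continuousOn_id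
    refine ((summable_geometric_of_lt_one (norm_nonneg _) hq).mul_right R).hasProdUniformlyOn_nat_one_add
      hcK (.of_forall fun n x hx => ?_) (fun _ => by fun_prop)
    rw [norm_neg, norm_mul, norm_pow]
    exact mul_le_mul_of_nonneg_left (hR x hx) (by positivity)
  have h2 := h.differentiableOn (.of_forall fun _ => by
    simpa [Finset.prod_fn] using DifferentiableOn.finsetProd (fun _ _ => by fun_prop)) isOpen_univ
  exact differentiableOn_univ.1 h2

theorem qProd_eq_mul (w : ℂ) : qProd q w = (1 - w) * qProd q (q * w) := by
  have h : ∀ m : ℕ, 1 - q ^ (m + 1) * w = 1 - q ^ m * (q * w) := fun m => by ring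
  rw [qProd, tprod_eq_zero_mul', pow_zero, one_mul, qProd]
  · simp only [h]
  · simpa only [h] using multipliable_one_sub_pow_mul hq (q * w)

theorem exists_of_qProd_eq_zero {w : ℂ} (hw : qProd q w = 0) : ∃ m : ℕ, q ^ m * w = 1 := by
  by_contra! hcon
  refine tprod_one_add_ne_zero_of_summable (f := fun m : ℕ => -(q ^ m * w)) ?_
    (summable_norm_pow_mul hq w) ?_
  · intro i h
    exact hcon i (by linear_combination -h)
  · simpa only [qProd, sub_eq_add_neg] using hw

end qProd

section

variable (τ : UpperHalfPlane)

theorem norm_e_tau_lt_one : ‖e τ‖ < 1 := by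
  rw [norm_e, Real.exp_lt_one_iff]
  have : 0 < (τ : ℂ).im := τ.im_pos
  have := Real.pi_pos
  simp only [Left.neg_neg_iff]
  positivity

/-- The product of Jacobi's triple product formula for `θ`, up to a constant. -/
def thetaProd (z : ℂ) : ℂ := qProd (e τ) (e z) * qProd (e τ) (e τ * e (-z))

theorem differentiable_thetaProd : Differentiable ℂ (thetaProd τ) := by
  have h := differentiable_qProd (norm_e_tau_lt_one τ)
  unfold thetaProd
  refine (h.comp differentiable_e).mul (h.comp ?_)
  exact (differentiable_e.comp differentiable_neg).const_mul _

theorem thetaProd_eq (z : ℂ) : thetaProd τ z =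
    (1 - e z) * (qProd (e τ) (e τ * e z) * qProd (e τ) (e τ * e (-z))) := by
  rw [thetaProd, qProd_eq_mul (norm_e_tau_lt_one τ) (e z), mul_assoc]

theorem thetaProd_add_one (z : ℂ) : thetaProd τ (z + 1) = thetaProd τ z := by
  simp only [thetaProd, neg_add, e_add, e_neg 1, e_one, mul_one, inv_one]

theorem thetaProd_add_tau (z : ℂ) : thetaProd τ (z + τ) = -e (-z) * thetaProd τ z := by
  have h1 : e (-z) * e z = 1 := by rw [← e_add, neg_add_cancel, e_zero]
  have h2 : e τ * e (-(z + τ)) = e (-z) := by rw [← e_add]; congr 1; ring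
  rw [thetaProd_eq τ z, thetaProd, h2, qProd_eq_mul (norm_e_tau_lt_one τ) (e (-z)), e_add,
    mul_comm (e z)]
  linear_combination (-qProd (e τ) (e τ * e z) * qProd (e τ) (e τ * e (-z))) * h1

theorem mem_lattice_of_thetaProd_eq_zero {z : ℂ} (hz : thetaProd τ z = 0) : z ∈ lattice τ := by
  have hq := norm_e_tau_lt_one τ
  rcases mul_eq_zero.1 hz with h | h
  · obtain ⟨m, hm⟩ := exists_of_qProd_eq_zero hq h
    rw [← e_nat_mul, ← e_add] at hm
    obtain ⟨p, hp⟩ := (e_eq_one_iff _).1 hm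
    exact ⟨p, -m, by push_cast; linear_combination hp⟩
  · obtain ⟨m, hm⟩ := exists_of_qProd_eq_zero hq h
    rw [← e_nat_mul, ← e_add, ← e_add] at hm
    obtain ⟨p, hp⟩ := (e_eq_one_iff _).1 hm
    exact ⟨-p, m + 1, by push_cast; linear_combination -hp⟩

/-- The factor `1 - e(z)` has a simple zero at `0`; the other factors give `∏ (1 - q^{m+1})` twice,
which is nonzero since `|q| < 1`. -/
theorem exists_hasDerivAt_thetaProd_zero : ∃ c : ℂ, c ≠ 0 ∧ HasDerivAt (thetaProd τ) c 0 := by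
  have hq := norm_e_tau_lt_one τ
  set g : ℂ → ℂ := fun z => qProd (e τ) (e τ * e z) * qProd (e τ) (e τ * e (-z)) with hg
  have hgd : Differentiable ℂ g := by
    have h := differentiable_qProd (norm_e_tau_lt_one τ)
    exact (h.comp (differentiable_e.const_mul _)).mul
      (h.comp ((differentiable_e.comp differentiable_neg).const_mul _))
  have h1 : HasDerivAt (fun z => 1 - e z) (-(e 0 * (2 * Real.pi * Complex.I))) 0 :=
    (hasDerivAt_e 0).const_sub 1
  have h2 := h1.mul (hgd 0).hasDerivAt
  refine ⟨_, ?_, h2.congr_of_eventuallyEq (.of_forall fun z => thetaProd_eq τ z)⟩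
  simp only [e_zero, one_mul, sub_self, zero_mul, add_zero]
  refine mul_ne_zero (neg_ne_zero.2 Complex.two_pi_I_ne_zero) ?_
  have h3 : qProd (e τ) (e τ) ≠ 0 := by
    intro h
    obtain ⟨m, hm⟩ := exists_of_qProd_eq_zero hq h
    have h5 : ‖e τ‖ ^ (m + 1) = 1 := by
      rw [← norm_pow, pow_succ, hm, norm_one]
    exact absurd h5 (pow_lt_one₀ (norm_nonneg _) hq (by omega)).ne
  simpa [hg, e_zero] using h3

/-- A simple zero is carried along the lattice, since the multiplier never vanishes and its
derivative is multiplied by the value `0` of the function. The statement is for a general `f`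
because it serves first for `thetaProd` and then, once the two are proportional, for `theta`. -/
theorem exists_hasDerivAt_lattice {f : ℂ → ℂ} (h1 : ∀ z, f (z + 1) = f z)
    (h2 : ∀ z, f (z + τ) = -e (-z) * f z) (h0 : f 0 = 0)
    {c : ℂ} (hc : c ≠ 0) (hf : HasDerivAt f c 0) {s : ℂ} (hs : s ∈ lattice τ) :
    f s = 0 ∧ ∃ c', c' ≠ 0 ∧ HasDerivAt f c' s := by
  have key1 : ∀ s, (∃ c', c' ≠ 0 ∧ HasDerivAt f c' s) ↔ ∃ c', c' ≠ 0 ∧ HasDerivAt f c' (s + 1) := by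
    intro s
    constructor
    · rintro ⟨c, hc, h⟩
      refine ⟨c, hc, ?_⟩
      have h3 : HasDerivAt f c (s + 1 - 1) := by simpa using h
      refine (h3.comp_sub_const (s + 1) 1).congr_of_eventuallyEq (.of_forall fun z => ?_)
      change f z = f (z - 1)
      rw [← h1 (z - 1), sub_add_cancel]
    · rintro ⟨c, hc, h⟩
      exact ⟨c, hc, (h.comp_add_const s 1).congr_of_eventuallyEq
        (.of_forall fun z => (h1 z).symm)⟩
  have hz : ∀ p a : ℤ, f (p + a * (τ : ℂ)) = 0 := by
    have hz1 : ∀ p : ℤ, f p = 0 := by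
      intro p
      induction p using Int.induction_on with
      | zero => simpa using h0
      | succ i ih => rw [← ih, ← h1 (i : ℤ)]; congr 1; push_cast; ring
      | pred i ih => rw [← ih, ← h1]; congr 1; push_cast; ring
    intro p a
    induction a using Int.induction_on with
    | zero => simpa using hz1 p
    | succ i ih =>
      have := h2 (p + ((i : ℤ) : ℂ) * (τ : ℂ))
      rw [ih, mul_zero] at this
      rw [← this]; congr 1; push_cast; ring
    | pred i ih =>
      have := h2 (p + ((-(i : ℤ) - 1 : ℤ) : ℂ) * (τ : ℂ))
      rw [show (p + ((-(i : ℤ) - 1 : ℤ) : ℂ) * (τ : ℂ)) + τ = p + ((-(i : ℤ) : ℤ) : ℂ) * (τ : ℂ) by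
        push_cast; ring, ih] at this
      exact (mul_eq_zero.1 this.symm).resolve_left (neg_ne_zero.2 (e_ne_zero _))
  have key2 : ∀ s, f s = 0 → ((∃ c', c' ≠ 0 ∧ HasDerivAt f c' s) ↔
      ∃ c', c' ≠ 0 ∧ HasDerivAt f c' (s + τ)) := by
    intro s hs
    constructor
    · rintro ⟨c, hc, h⟩
      have h3 : HasDerivAt f c (s + τ - τ) := by simpa using h
      have hE : HasDerivAt (fun z => -e (-(z - τ))) _ (s + τ) :=
        ((differentiable_e.comp (differentiable_id.sub_const (τ : ℂ)).neg).neg (s + τ)).hasDerivAt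
      refine ⟨_, ?_, (hE.mul (h3.comp_sub_const (s + τ) τ)).congr_of_eventuallyEq
        (.of_forall fun z => ?_)⟩
      · simp only [add_sub_cancel_right, hs, mul_zero, zero_add]
        exact mul_ne_zero (neg_ne_zero.2 (e_ne_zero _)) hc
      · have := h2 (z - τ)
        rw [sub_add_cancel] at this
        exact this
    · rintro ⟨c, hc, h⟩
      have hE : HasDerivAt (fun z => -e z) _ s := (differentiable_e.neg s).hasDerivAt
      have hs' : f (s + τ) = 0 := by rw [h2, hs, mul_zero]
      refine ⟨_, ?_, (hE.mul (h.comp_add_const s τ)).congr_of_eventuallyEq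
        (.of_forall fun z => ?_)⟩
      · simp only [hs', mul_zero, zero_add]
        exact mul_ne_zero (neg_ne_zero.2 (e_ne_zero _)) hc
      · change f z = -e z * f (z + τ)
        rw [h2, ← mul_assoc, neg_mul_neg, ← e_add, add_neg_cancel, e_zero, one_mul]
  obtain ⟨p, a, rfl⟩ := hs
  refine ⟨hz p a, ?_⟩
  have hp : ∃ c', c' ≠ 0 ∧ HasDerivAt f c' (p : ℂ) := by
    induction p using Int.induction_on with
    | zero => exact ⟨c, hc, by simpa using hf⟩
    | succ i ih =>
      have := (key1 _).1 ih
      push_cast at this ⊢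
      exact this
    | pred i ih =>
      refine (key1 _).2 ?_
      convert ih using 4
      push_cast; ring
  induction a using Int.induction_on with
  | zero => simpa using hp
  | succ i ih =>
    have := (key2 _ (hz _ _)).1 ih
    convert this using 4
    push_cast; ring
  | pred i ih =>
    refine (key2 _ (hz _ _)).2 ?_
    convert ih using 4
    push_cast; ring

/-- The constant Fourier coefficient of `θ` on the interval `[0, 1]` is `1`. -/
theorem exists_theta_ne_zero : ∃ z, theta τ z ≠ 0 := by
  by_contra! hcon
  set t : ℤ → C(ℝ, ℂ) := fun a => ⟨fun x : ℝ =>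
    (-1 : ℂ) ^ a * e (a * x + (a * (a - 1) : ℂ) / 2 * (τ : ℂ)),
    continuous_const.mul (continuous_e.comp (by fun_prop))⟩ with ht
  have hnorm : ∀ (a : ℤ) (x : ℝ), ‖t a x‖ = ‖t a 0‖ := by
    intro a x
    simp only [ht, ContinuousMap.coe_mk, norm_mul, norm_e]
    congr 4
    simp
  have hsum : Summable fun a : ℤ => ‖t a 0‖ := by
    have h := (summable_jacobiTheta₂_term_iff ((0 : ℂ) + 1 / 2 - (τ : ℂ) / 2) (τ : ℂ)).2 τ.im_pos
    refine h.norm.congr fun a => ?_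
    simp only [ht, ContinuousMap.coe_mk, jacobiTheta₂_term, Complex.norm_exp, norm_mul, norm_zpow,
      norm_neg, norm_one, one_zpow, one_mul, e]
    congr 1
    simp [pow_two]
    ring
  -- For real arguments the norm of each term is constant, so the series converges normally and may
  -- be integrated term by term.
  have h := intervalIntegral.hasSum_intervalIntegral_of_summable_norm (a := 0) (b := 1) (f := t) (by
    refine hsum.of_nonneg_of_le (fun _ => norm_nonneg _) fun a => ?_
    refine (ContinuousMap.norm_le _ (norm_nonneg _)).2 fun x => ?_
    exact (hnorm a x).le)
  have h1 : (fun x : ℝ => ∑' a : ℤ, t a x) = fun _ => 0 := by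
    funext x
    exact hcon x
  rw [h1, intervalIntegral.integral_zero] at h
  have h2 : ∀ a : ℤ, a ≠ 0 → ∫ x in (0 : ℝ)..1, t a x = 0 := by
    intro a ha
    have ha' : (2 * Real.pi * Complex.I * a : ℂ) ≠ 0 :=
      mul_ne_zero Complex.two_pi_I_ne_zero (by exact_mod_cast ha)
    have : ∀ x : ℝ, t a x = (-1 : ℂ) ^ a * e ((a * (a - 1) : ℂ) / 2 * (τ : ℂ)) *
        Complex.exp (2 * Real.pi * Complex.I * a * x) := by
      intro x
      simp only [ht, ContinuousMap.coe_mk]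
      rw [add_comm, e_add, ← mul_assoc]
      congr 1
      rw [e]; congr 1; ring
    simp only [this]
    rw [intervalIntegral.integral_const_mul, integral_exp_mul_complex ha']
    have h3 : Complex.exp (2 * Real.pi * Complex.I * a * (1 : ℝ)) = 1 := by
      rw [← e_int a, e]; congr 1; push_cast; ring
    rw [h3]
    simp
  have h4 := h.unique (hasSum_single (0 : ℤ) h2)
  simp [ht, e_zero] at h4

/-- The quotient is doubly periodic. Its singularities are removable, because the zeros of the
product are simple and lie in the lattice, where `θ` vanishes. Hence it is constant. This is how the
zeros of `θ` are located. -/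
theorem exists_theta_eq : ∃ C : ℂ, C ≠ 0 ∧ ∀ z, theta τ z = C * thetaProd τ z := by
  obtain ⟨c0, hc0, hd0⟩ := exists_hasDerivAt_thetaProd_zero τ
  have hP0 : thetaProd τ 0 = 0 := by rw [thetaProd_eq, e_zero, sub_self, zero_mul]
  have hP : ∀ s ∈ lattice τ, thetaProd τ s = 0 ∧ ∃ c, c ≠ 0 ∧ HasDerivAt (thetaProd τ) c s :=
    fun s hs =>
    exists_hasDerivAt_lattice τ (thetaProd_add_one τ) (thetaProd_add_tau τ) hP0 hc0 hd0 hs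
  have hT : Differentiable ℂ (theta τ) := differentiable_theta τ
  set f : ℂ → ℂ := fun z => theta τ z / thetaProd τ z with hf
  have hfd : ∀ c, thetaProd τ c ≠ 0 → DifferentiableAt ℂ f c := fun c hc =>
    (hT c).div (differentiable_thetaProd τ c) hc
  have hev : ∀ c, ∀ᶠ z in 𝓝[≠] c, thetaProd τ z ≠ 0 := by
    intro c
    by_cases hc : thetaProd τ c = 0
    · obtain ⟨h0, c', hc', h⟩ := hP c (mem_lattice_of_thetaProd_eq_zero τ hc)
      exact h.eventually_ne hc'
    · exact ((differentiable_thetaProd τ).continuous.continuousAt.eventually_ne hc).filter_mono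
        nhdsWithin_le_nhds
  obtain ⟨C, l, hl, hC, -⟩ := eq_const_mul_e_of_quasiperiodic τ (n := 1) one_pos 0 (f := f)
    (fun c => (hev c).mono hfd) (fun c => by
      by_cases hc : thetaProd τ c = 0
      · obtain ⟨h0, c', hc', h⟩ := hP c (mem_lattice_of_thetaProd_eq_zero τ hc)
        have h1 := (hasDerivAt_iff_tendsto_slope.1 h).inv₀ hc'
        have h2 : Tendsto (theta τ) (𝓝[≠] c) (𝓝 0) := by
          rw [← theta_lattice (mem_lattice_of_thetaProd_eq_zero τ hc)]
          exact hT.continuous.continuousAt.mono_left nhdsWithin_le_nhds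
        have h3 := h2.mul h1
        rw [zero_mul] at h3
        refine h3.congr fun z => ?_
        rw [slope_def_field, hc, sub_zero, inv_div, hf]
        ring
      · have h1 : Tendsto (fun z => (z - c) * f z) (𝓝 c) (𝓝 ((c - c) * f c)) :=
          (Continuous.tendsto (by fun_prop) c).mul (hfd c hc).continuousAt
        rw [sub_self, zero_mul] at h1
        exact h1.mono_left nhdsWithin_le_nhds)
    (fun z => by rw [hf]; simp only [Nat.cast_one, theta_add_one, thetaProd_add_one])
    (fun z => by
      rw [hf]
      simp only [Nat.cast_one, one_mul, theta_add_tau, thetaProd_add_tau, neg_zero, e_zero]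
      rw [mul_div_mul_left _ _ (neg_ne_zero.2 (e_ne_zero _))])
  have hl0 : l = 0 := by simp [hl]
  have key : ∀ z, theta τ z = C * thetaProd τ z := by
    intro z
    by_cases hz : thetaProd τ z = 0
    · rw [hz, mul_zero, theta_lattice (mem_lattice_of_thetaProd_eq_zero τ hz)]
    · have := hC z (hfd z hz).continuousAt
      rw [hl0, Complex.ofReal_zero, zero_mul, e_zero, mul_one, hf] at this
      exact (div_eq_iff hz).1 this
  refine ⟨C, ?_, key⟩
  rintro rfl
  obtain ⟨z, hz⟩ := exists_theta_ne_zero τ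
  exact hz (by rw [key, zero_mul])

theorem theta_eq_zero_iff {τ : UpperHalfPlane} {z : ℂ} : theta τ z = 0 ↔ z ∈ lattice τ := by
  refine ⟨fun h => ?_, theta_lattice⟩
  obtain ⟨C, hC, hz⟩ := exists_theta_eq τ
  rw [hz] at h
  exact mem_lattice_of_thetaProd_eq_zero τ ((mul_eq_zero.1 h).resolve_left hC)

theorem exists_hasDerivAt_theta {s : ℂ} (hs : s ∈ lattice τ) :
    ∃ c, c ≠ 0 ∧ HasDerivAt (theta τ) c s := by
  obtain ⟨C, hC, hz⟩ := exists_theta_eq τ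
  obtain ⟨c0, hc0, hd0⟩ := exists_hasDerivAt_thetaProd_zero τ
  have h1 : HasDerivAt (theta τ) (C * c0) 0 :=
    (hd0.const_mul C).congr_of_eventuallyEq (.of_forall hz)
  exact (exists_hasDerivAt_lattice τ (theta_add_one τ) (theta_add_tau τ) (theta_zero τ)
    (mul_ne_zero hC hc0) h1 hs).2

theorem eventually_theta_ne_zero (c : ℂ) : ∀ᶠ z in 𝓝[≠] c, theta τ z ≠ 0 := by
  by_cases hc : c ∈ lattice τ
  · obtain ⟨c', hc', h⟩ := exists_hasDerivAt_theta τ hc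
    exact h.eventually_ne hc'
  · exact ((continuous_theta τ).continuousAt.eventually_ne
      (mt theta_eq_zero_iff.1 hc)).filter_mono nhdsWithin_le_nhds

/-- The inverse of `θ'(0)`. -/
def thetaRes : ℂ := (deriv (theta τ) 0)⁻¹

theorem thetaRes_ne_zero : thetaRes τ ≠ 0 := by
  obtain ⟨c', hc', h⟩ := exists_hasDerivAt_theta τ (zero_mem_lattice τ)
  rw [thetaRes, h.deriv]
  exact inv_ne_zero hc'

end

/-! ### The Kronecker function -/

theorem neg_mem_lattice {τ : UpperHalfPlane} {x : ℂ} (hx : x ∈ lattice τ) :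
    -x ∈ lattice τ := by
  obtain ⟨p, a, rfl⟩ := hx
  exact ⟨-p, -a, by push_cast; ring⟩

theorem neg_mem_lattice_iff {τ : UpperHalfPlane} {x : ℂ} : -x ∈ lattice τ ↔ x ∈ lattice τ :=
  ⟨fun h => by simpa using neg_mem_lattice h, neg_mem_lattice⟩

/-- The Kronecker function `θ(x + y) / (θ(x) θ(y))`. -/
def kron (τ : UpperHalfPlane) (x y : ℂ) : ℂ := theta τ (x + y) / (theta τ x * theta τ y)

theorem kron_comm (τ : UpperHalfPlane) (x y : ℂ) : kron τ x y = kron τ y x := by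
  rw [kron, kron, add_comm, mul_comm (theta τ x)]

/-- The signs and the quadratic exponents of the three theta factors cancel except for the bilinear
cross terms. -/
theorem kron_add_lattice (τ : UpperHalfPlane) (x y : ℂ) (p a p' b : ℤ) :
    kron τ (x + (p + a * (τ : ℂ))) (y + (p' + b * (τ : ℂ)))
      = e (-(a * y + b * x + a * b * τ)) * kron τ x y := by
  rw [kron, kron, show x + (p + a * (τ : ℂ)) + (y + (p' + b * (τ : ℂ)))
    = x + y + ((p + p' : ℤ) + (a + b : ℤ) * (τ : ℂ)) by push_cast; ring, theta_add_lattice,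
    theta_add_lattice, theta_add_lattice, zpow_add₀ (by norm_num)]
  have h1 : (-1 : ℂ) ^ a ≠ 0 := zpow_ne_zero _ (by norm_num)
  have h2 : (-1 : ℂ) ^ b ≠ 0 := zpow_ne_zero _ (by norm_num)
  have h3 : e (-((a + b : ℤ) * (x + y) + (a + b : ℤ) * ((a + b : ℤ) - 1) / 2 * (τ : ℂ)))
      = e (-(a * y + b * x + a * b * τ)) * (e (-(a * x + a * (a - 1) / 2 * τ)) *
        e (-(b * y + b * (b - 1) / 2 * τ))) := by
    rw [← e_add, ← e_add]; congr 1; push_cast; ring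
  rw [h3]
  have h4 := e_ne_zero (-(a * x + a * (a - 1) / 2 * τ))
  have h5 := e_ne_zero (-(b * y + b * (b - 1) / 2 * τ))
  rw [show (-1 : ℂ) ^ a * (-1) ^ b * (e (-(a * y + b * x + a * b * τ)) *
      (e (-(a * x + a * (a - 1) / 2 * τ)) * e (-(b * y + b * (b - 1) / 2 * τ)))) * theta τ (x + y)
    = ((-1 : ℂ) ^ a * (-1) ^ b * e (-(a * x + a * (a - 1) / 2 * τ)) *
        e (-(b * y + b * (b - 1) / 2 * τ))) * (e (-(a * y + b * x + a * b * τ)) *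
        theta τ (x + y)) by ring,
    show (-1 : ℂ) ^ a * e (-(a * x + a * (a - 1) / 2 * τ)) * theta τ x *
      ((-1) ^ b * e (-(b * y + b * (b - 1) / 2 * τ)) * theta τ y)
    = ((-1 : ℂ) ^ a * (-1) ^ b * e (-(a * x + a * (a - 1) / 2 * τ)) *
        e (-(b * y + b * (b - 1) / 2 * τ))) * (theta τ x * theta τ y) by ring,
    mul_div_mul_left _ _ (by positivity), mul_div_assoc]

theorem differentiableAt_kron {τ : UpperHalfPlane} {f g : ℂ → ℂ} {s : ℂ}
    (hf : DifferentiableAt ℂ f s) (hg : DifferentiableAt ℂ g s) (hfs : theta τ (f s) ≠ 0)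
    (hgs : theta τ (g s) ≠ 0) : DifferentiableAt ℂ (fun x => kron τ (f x) (g x)) s := by
  have h := differentiable_theta τ
  exact ((h _).comp s (hf.add hg)).div (((h _).comp s hf).mul ((h _).comp s hg))
    (mul_ne_zero hfs hgs)

theorem continuousAt_kron {X : Type*} [TopologicalSpace X] {τ : UpperHalfPlane} {f g : X → ℂ} {s : X}
    (hf : ContinuousAt f s) (hg : ContinuousAt g s) (hfs : theta τ (f s) ≠ 0)
    (hgs : theta τ (g s) ≠ 0) : ContinuousAt (fun x => kron τ (f x) (g x)) s := by
  have h := continuous_theta τ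
  exact (h.continuousAt.comp (hf.add hg)).div
    ((h.continuousAt.comp hf).mul (h.continuousAt.comp hg)) (mul_ne_zero hfs hgs)

theorem tendsto_sub_mul_kron {τ : UpperHalfPlane} {f g : ℂ → ℂ} {s c : ℂ} {p m : ℤ}
    (hf : HasDerivAt f c s) (hc : c ≠ 0) (hfs : f s = p + m * (τ : ℂ)) (hg : ContinuousAt g s)
    (hgs : theta τ (g s) ≠ 0) :
    Tendsto (fun x => (x - s) * kron τ (f x) (g x)) (𝓝[≠] s)
      (𝓝 (c⁻¹ * thetaRes τ * e (-(m * g s)))) := by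
  have hT := continuous_theta τ
  set F : ℂ → ℂ := fun x => f x - (p + m * (τ : ℂ)) with hF
  have hFs : F s = 0 := by rw [hF]; simp [hfs]
  have hFd : HasDerivAt F c s := hf.sub_const _
  obtain ⟨δ, hδ, hd⟩ := exists_hasDerivAt_theta τ (zero_mem_lattice τ)
  have h1 : HasDerivAt (fun x => theta τ (F x)) (δ * c) s := by
    have : HasDerivAt (theta τ) δ (F s) := by rw [hFs]; exact hd
    exact this.comp s hFd
  have h2 := (hasDerivAt_iff_tendsto_slope.1 h1).inv₀ (mul_ne_zero hδ hc)
  have hE : ∀ᶠ x in 𝓝[≠] s, theta τ (g x) ≠ 0 :=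
    ((hT.continuousAt.comp hg).eventually_ne hgs).filter_mono nhdsWithin_le_nhds
  have h3 : Tendsto (fun x => e (-(m * g x)) * (theta τ (F x + g x) / theta τ (g x))) (𝓝[≠] s)
      (𝓝 (e (-(m * g s)) * (theta τ (F s + g s) / theta τ (g s)))) := by
    refine Tendsto.mono_left ?_ nhdsWithin_le_nhds
    exact (continuous_e.continuousAt.comp ((continuousAt_const.mul hg).neg)).mul
      ((hT.continuousAt.comp (hFd.continuousAt.add hg)).div (hT.continuousAt.comp hg) hgs)
  have h4 := h2.mul h3
  rw [hFs, zero_add, div_self hgs, mul_one, mul_inv, mul_comm δ⁻¹] at h4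
  rw [thetaRes, hd.deriv]
  refine h4.congr fun x => ?_
  rw [slope_def_field, hFs, theta_zero, sub_zero, inv_div]
  -- Translation moves the pole to the zero of `F`, where it is the pole of `1/θ` at `0`; the
  -- multiplier is the source of the factor `e(-m g)`.
  have h5 := kron_add_lattice τ (F x) (g x) p m 0 0
  rw [show F x + (p + m * (τ : ℂ)) = f x by rw [hF]; ring] at h5
  simp only [Int.cast_zero, zero_mul, add_zero, mul_zero] at h5
  rw [h5, kron]
  simp only [div_eq_mul_inv, mul_inv]
  ring

/-! ### The characters of `ℤ/nℤ` and the functions `θ_α` -/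

section Level

variable (n : ℕ) [NeZero n]

/-- The character `α ↦ e(α/n)` of `ℤ/nℤ`. -/
def chi (α : ZMod n) : ℂ := e ((α.val : ℂ) / n)

theorem natCast_ne_zero' : (n : ℂ) ≠ 0 := by exact_mod_cast NeZero.ne n

theorem chi_intCast (a : ℤ) : chi n (a : ZMod n) = e (a / n) := by
  have hn := natCast_ne_zero' n
  have h : ((a : ZMod n).val : ℤ) = a % n := ZMod.val_intCast a
  refine e_eq_of_sub_int (-(a / n)) ?_
  have h2 : ((a : ZMod n).val : ℂ) = ((a % n : ℤ) : ℂ) := by rw [← h]; push_cast; rfl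
  have h3 : ((a % n : ℤ) : ℂ) + n * ((a / n : ℤ) : ℂ) = a := by
    exact_mod_cast Int.emod_add_mul_ediv a n
  rw [h2, ← h3]
  push_cast
  field_simp
  ring

theorem exists_intCast_eq (α : ZMod n) : ∃ a : ℤ, (a : ZMod n) = α :=
  ⟨α.val, by simp⟩

theorem chi_add (α β : ZMod n) : chi n (α + β) = chi n α * chi n β := by
  obtain ⟨a, rfl⟩ := exists_intCast_eq n α
  obtain ⟨b, rfl⟩ := exists_intCast_eq n β
  rw [← Int.cast_add, chi_intCast, chi_intCast, chi_intCast, ← e_add]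
  congr 1; push_cast; ring

theorem chi_zero : chi n 0 = 1 := by simp [chi, e_zero]

theorem chi_ne_zero (α : ZMod n) : chi n α ≠ 0 := e_ne_zero _

theorem chi_intCast_mul (p : ℤ) (α : ZMod n) : chi n (p * α) = chi n α ^ p := by
  obtain ⟨a, rfl⟩ := exists_intCast_eq n α
  rw [← Int.cast_mul, chi_intCast, chi_intCast, ← e_int_mul]
  congr 1; push_cast; ring

variable (τ : UpperHalfPlane)

/-- The formula for `θ_α` with an arbitrary representative of `α`. -/
def thetaRaw (a : ℤ) (z : ℂ) : ℂ :=
  (∏ s ∈ Finset.range n, theta τ (z + (s : ℂ) / n + (a : ℂ) / n * (τ : ℂ))) *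
    e ((a : ℂ) * z + (a : ℂ) * ((a : ℂ) - n) / (2 * n) * (τ : ℂ) + (a : ℂ) / (2 * n))

theorem prod_range_shift {g : ℕ → ℂ} (h : g n = g 0) :
    ∏ s ∈ Finset.range n, g (s + 1) = ∏ s ∈ Finset.range n, g s := by
  obtain ⟨m, rfl⟩ := Nat.exists_eq_succ_of_ne_zero (NeZero.ne n)
  rw [Finset.prod_range_succ, Finset.prod_range_succ', h]

theorem thetaRaw_add_inv (a : ℤ) (z : ℂ) :
    thetaRaw n τ a (z + 1 / n) = e (a / n) * thetaRaw n τ a z := by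
  have hn := natCast_ne_zero' n
  have h := prod_range_shift n (g := fun s => theta τ (z + (s : ℂ) / n + (a : ℂ) / n * (τ : ℂ))) (by
    rw [div_self hn, Nat.cast_zero, zero_div, add_zero, ← theta_add_one τ (z + _)]
    congr 1; ring)
  rw [thetaRaw, thetaRaw, ← h, mul_left_comm, ← e_add]
  congr 1
  · refine Finset.prod_congr rfl fun s _ => ?_
    congr 1; push_cast; ring
  · congr 1; field_simp; ring

/-- The constant of `θ_α(z + τ/n) = c e(-z) θ_{α+1}(z)`. -/
def tauConst : ℂ := e (-((1 - n) / (2 * n) * τ + 1 / (2 * n)))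

theorem tauConst_ne_zero : tauConst n τ ≠ 0 := e_ne_zero _

theorem thetaRaw_add_tau (a : ℤ) (z : ℂ) :
    thetaRaw n τ a (z + τ / n) = tauConst n τ * e (-z) * thetaRaw n τ (a + 1) z := by
  have hn := natCast_ne_zero' n
  rw [thetaRaw, thetaRaw, tauConst, ← e_add, mul_left_comm, ← e_add]
  congr 1
  · refine Finset.prod_congr rfl fun s _ => ?_
    congr 1; push_cast; ring
  · congr 1; push_cast; field_simp; ring

theorem sum_range_cast_div : ∑ s ∈ Finset.range n, (s : ℂ) / n = (n - 1) / 2 := by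
  have hn := natCast_ne_zero' n
  have h : ∀ m : ℕ, ∑ s ∈ Finset.range m, (s : ℂ) = m * (m - 1) / 2 := by
    intro m
    induction m with
    | zero => simp
    | succ m ih => rw [Finset.sum_range_succ, ih]; push_cast; ring
  rw [← Finset.sum_div, h]
  field_simp

theorem prod_e {ι : Type*} (S : Finset ι) (f : ι → ℂ) : ∏ s ∈ S, e (f s) = e (∑ s ∈ S, f s) := by
  classical
  induction S using Finset.induction_on with
  | empty => simp [e_zero]
  | insert a S ha ih => rw [Finset.prod_insert ha, Finset.sum_insert ha, e_add, ih]

theorem neg_one_pow_eq_e (m : ℕ) : (-1 : ℂ) ^ m = e (m / 2) := by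
  rw [← e_half, ← e_nat_mul]; congr 1; ring

theorem thetaRaw_add_period (a : ℤ) (z : ℂ) : thetaRaw n τ (a + n) z = thetaRaw n τ a z := by
  have hn := natCast_ne_zero' n
  have h : ∀ s : ℕ, theta τ (z + (s : ℂ) / n + ((a + n : ℤ) : ℂ) / n * (τ : ℂ))
      = -1 * e (-(z + (s : ℂ) / n + (a : ℂ) / n * (τ : ℂ))) *
        theta τ (z + (s : ℂ) / n + (a : ℂ) / n * (τ : ℂ)) := by
    intro s
    rw [neg_one_mul, ← theta_add_tau]
    congr 1; push_cast; field_simp; ring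
  rw [thetaRaw, thetaRaw, Finset.prod_congr rfl fun s _ => h s, Finset.prod_mul_distrib,
    Finset.prod_mul_distrib, prod_e, Finset.prod_const, Finset.card_range, neg_one_pow_eq_e,
    ← e_add, mul_comm (e _) (∏ s ∈ Finset.range n, _), mul_assoc, ← e_add]
  congr 1
  -- The constant terms are `n/2` from the signs, `-(n-1)/2` from the sum of the `s/n`, and `1/2`
  -- from `e(α/(2n))`; together they make `1`.
  refine e_eq_of_sub_int 1 ?_
  rw [Finset.sum_neg_distrib, Finset.sum_add_distrib, Finset.sum_add_distrib, sum_range_cast_div,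
    Finset.sum_const, Finset.sum_const, Finset.card_range, nsmul_eq_mul, nsmul_eq_mul]
  push_cast
  field_simp
  ring

theorem thetaN_intCast (a : ℤ) (z : ℂ) : thetaN n τ (a : ZMod n) z = thetaRaw n τ a z := by
  have h : ∀ (b : ℤ) (j : ℤ), thetaRaw n τ (b + j * n) z = thetaRaw n τ b z := by
    intro b j
    induction j using Int.induction_on with
    | zero => simp
    | succ i ih => rw [← ih, ← thetaRaw_add_period n τ (b + i * n)]; congr 1; ring
    | pred i ih => rw [← ih, ← thetaRaw_add_period]; congr 1; ring
  have h1 : ((a : ZMod n).val : ℤ) = a % n := ZMod.val_intCast a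
  have h2 : ((a : ZMod n).val : ℂ) = ((a % n : ℤ) : ℂ) := by rw [← h1]; push_cast; rfl
  have h3 := h (a % n) (a / n)
  rw [Int.emod_add_ediv_mul] at h3
  rw [h3, thetaN, thetaRaw, h2]

theorem differentiable_thetaN (α : ZMod n) : Differentiable ℂ (thetaN n τ α) := by
  have h := differentiable_theta τ
  unfold thetaN
  refine Differentiable.mul ?_ (differentiable_e.comp (by fun_prop))
  exact Differentiable.fun_finsetProd fun s _ => h.comp (by fun_prop)

theorem thetaN_add_int_div (α : ZMod n) (z : ℂ) (p : ℤ) :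
    thetaN n τ α (z + p / n) = chi n α ^ p * thetaN n τ α z := by
  obtain ⟨a, rfl⟩ := exists_intCast_eq n α
  have h : ∀ z, thetaRaw n τ a (z + 1 / n) = chi n a * thetaRaw n τ a z := fun z => by
    rw [chi_intCast, thetaRaw_add_inv]
  have hc := chi_ne_zero n a
  rw [thetaN_intCast, thetaN_intCast]
  induction p using Int.induction_on with
  | zero => simp
  | succ i ih =>
    rw [zpow_add_one₀ hc, mul_comm _ (chi n _), mul_assoc, ← ih, ← h]
    congr 1; push_cast; ring
  | pred i ih =>
    apply mul_left_cancel₀ hc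
    rw [zpow_sub_one₀ hc, ← h, mul_comm _ (chi n _)⁻¹, mul_assoc, mul_inv_cancel_left₀ hc, ← ih]
    congr 1; push_cast; ring

theorem thetaN_add_int_tau_div (α : ZMod n) (z : ℂ) (s : ℤ) :
    thetaN n τ α (z + s * τ / n) =
      tauConst n τ ^ s * e (-(s * z + s * (s - 1) / 2 * τ / n)) * thetaN n τ (α + s) z := by
  obtain ⟨a, rfl⟩ := exists_intCast_eq n α
  have hn := natCast_ne_zero' n
  have hc := tauConst_ne_zero n τ
  rw [← Int.cast_add, thetaN_intCast, thetaN_intCast]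
  induction s using Int.induction_on generalizing z with
  | zero => simp [e_zero]
  | succ i ih =>
    rw [show z + ((i + 1 : ℤ) : ℂ) * τ / n = (z + τ / n) + (i : ℤ) * τ / n by push_cast; ring, ih,
      thetaRaw_add_tau, zpow_add_one₀ hc, ← add_assoc, ← mul_assoc]
    congr 1
    rw [show tauConst n τ ^ (i : ℤ) * e (-(((i : ℤ) : ℂ) * (z + τ / n) + ((i : ℤ) : ℂ) * (((i : ℤ) : ℂ) - 1) / 2 * τ / n)) *
      (tauConst n τ * e (-z)) = tauConst n τ ^ (i : ℤ) * tauConst n τ *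
        (e (-(((i : ℤ) : ℂ) * (z + τ / n) + ((i : ℤ) : ℂ) * (((i : ℤ) : ℂ) - 1) / 2 * τ / n)) * e (-z)) by ring,
      ← e_add]
    congr 2
    push_cast; ring
  | pred i ih =>
    have h1 := ih (z - τ / n + τ / n)
    have h2 := thetaRaw_add_tau n τ (a + (-i - 1)) (z - τ / n)
    have h3 := ih (z - τ / n)
    rw [show z + ((-i - 1 : ℤ) : ℂ) * τ / n = z - τ / n + ((-i : ℤ) : ℂ) * τ / n by push_cast; ring, h3]
    rw [sub_add_cancel, show a + (-(i : ℤ) - 1) + 1 = a + -i by ring] at h2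
    rw [h2, zpow_sub_one₀ hc]
    rw [show tauConst n τ ^ (-(i : ℤ)) * (tauConst n τ)⁻¹ * e (-(((-(i : ℤ) - 1 : ℤ) : ℂ) * z
      + ((-(i : ℤ) - 1 : ℤ) : ℂ) * (((-(i : ℤ) - 1 : ℤ) : ℂ) - 1) / 2 * τ / n)) *
      (tauConst n τ * e (-(z - τ / n)) * thetaRaw n τ (a + -i) (z - τ / n)) =
      tauConst n τ ^ (-(i : ℤ)) * ((tauConst n τ)⁻¹ * tauConst n τ) *
       (e (-(((-(i : ℤ) - 1 : ℤ) : ℂ) * z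
      + ((-(i : ℤ) - 1 : ℤ) : ℂ) * (((-(i : ℤ) - 1 : ℤ) : ℂ) - 1) / 2 * τ / n)) * e (-(z - τ / n))) *
       thetaRaw n τ (a + -i) (z - τ / n) by ring, inv_mul_cancel₀ hc, ← e_add, mul_one]
    congr 3
    push_cast; ring

theorem thetaN_eq_zero {a : ℤ} {z : ℂ} (h : thetaN n τ (a : ZMod n) z = 0) :
    ∃ p b : ℤ, n * z = p + (n * b - a) * (τ : ℂ) := by
  have hn := natCast_ne_zero' n
  rw [thetaN_intCast, thetaRaw] at h
  obtain ⟨s, -, hs⟩ := Finset.prod_eq_zero_iff.1 ((mul_eq_zero.1 h).resolve_right (e_ne_zero _))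
  obtain ⟨p, b, hp⟩ := theta_eq_zero_iff.1 hs
  refine ⟨n * p - s, b, ?_⟩
  field_simp at hp
  push_cast
  linear_combination hp

/-- Only the factor `θ(z)` vanishes at `0`, simply; the others take the values `θ(s/n)` with `0 < s
< n`, and these `s/n` are not lattice points. -/
theorem exists_hasDerivAt_thetaN_zero : ∃ c, c ≠ 0 ∧ HasDerivAt (thetaN n τ 0) c 0 := by
  have hn := natCast_ne_zero' n
  obtain ⟨m, hm⟩ := Nat.exists_eq_succ_of_ne_zero (NeZero.ne n)
  obtain ⟨δ, hδ, hd⟩ := exists_hasDerivAt_theta τ (zero_mem_lattice τ)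
  set g : ℂ → ℂ := fun z => ∏ s ∈ Finset.range m, theta τ (z + ((s + 1 : ℕ) : ℂ) / n) with hg
  have h : ∀ z, thetaN n τ 0 z = theta τ z * g z := by
    intro z
    have h0 := thetaN_intCast n τ 0 z
    rw [Int.cast_zero] at h0
    rw [h0, thetaRaw]
    simp only [Int.cast_zero, zero_mul, zero_div, add_zero, e_zero, mul_one]
    conv_lhs => rw [show Finset.range n = Finset.range (m + 1) by rw [hm]]
    rw [Finset.prod_range_succ', mul_comm]
    simp [hg]
  have hgd : Differentiable ℂ g :=
    Differentiable.fun_finsetProd fun s _ => (differentiable_theta τ).comp (by fun_prop)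
  refine ⟨_, ?_, (hd.mul (hgd 0).hasDerivAt).congr_of_eventuallyEq (.of_forall h)⟩
  rw [theta_zero, zero_mul, add_zero]
  refine mul_ne_zero hδ (Finset.prod_ne_zero_iff.2 fun s hs h0 => ?_)
  obtain ⟨p, b, hp⟩ := theta_eq_zero_iff.1 h0
  rw [zero_add] at hp
  have hb : b = 0 := by
    have := congrArg Complex.im hp
    have hτ := tau_im_ne_zero τ
    have h3 : (((s + 1 : ℕ) : ℂ) / n).im = 0 := by
      rw [show (((s + 1 : ℕ) : ℂ) / n) = (((s + 1 : ℕ) / n : ℝ) : ℂ) by push_cast; rfl,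
        Complex.ofReal_im]
    rw [h3] at this
    simp only [Complex.add_im, Complex.intCast_im, Complex.mul_im, Complex.intCast_re, zero_mul,
      add_zero, zero_add] at this
    rcases mul_eq_zero.1 this.symm with h | h
    · exact_mod_cast h
    · exact absurd h hτ
  rw [hb, Int.cast_zero, zero_mul, add_zero, div_eq_iff hn] at hp
  have hp' : ((s + 1 : ℕ) : ℤ) = p * n := by exact_mod_cast hp
  have hs' := Finset.mem_range.1 hs
  have hp0 : 0 < p := by
    by_contra hcon
    have : p * n ≤ 0 := mul_nonpos_of_nonpos_of_nonneg (by omega) (by positivity)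
    omega
  have : (n : ℤ) ≤ p * n := le_mul_of_one_le_left (by positivity) hp0
  omega

/-- The limit of `x / θ₀(x/n)` at `0`. -/
def thetaNRes : ℂ := n / deriv (thetaN n τ 0) 0

theorem tendsto_div_thetaN :
    Tendsto (fun x : ℂ => x / thetaN n τ 0 (x / n)) (𝓝[≠] 0) (𝓝 (thetaNRes n τ)) := by
  have hn := natCast_ne_zero' n
  obtain ⟨c, hc, h⟩ := exists_hasDerivAt_thetaN_zero n τ
  have h1 : HasDerivAt (fun x : ℂ => thetaN n τ 0 (x / n)) (c * (1 / n)) 0 := by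
    have h2 : HasDerivAt (thetaN n τ 0) c ((0 : ℂ) / n) := by rwa [zero_div]
    exact h2.comp 0 ((hasDerivAt_id (0 : ℂ)).div_const (n : ℂ))
  have h0 : thetaN n τ 0 (0 / n) = 0 := by
    have h0 := thetaN_intCast n τ 0 (0 / n)
    rw [Int.cast_zero] at h0
    rw [h0, thetaRaw]
    refine mul_eq_zero_of_left (Finset.prod_eq_zero (i := 0) ?_ ?_) _
    · simp [Nat.pos_of_ne_zero (NeZero.ne n)]
    · simp [theta_zero]
  have h3 := (hasDerivAt_iff_tendsto_slope.1 h1).inv₀ (mul_ne_zero hc (one_div_ne_zero hn))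
  rw [thetaNRes, h.deriv]
  have h4 : (c * (1 / (n : ℂ)))⁻¹ = n / c := by field_simp
  rw [h4] at h3
  refine h3.congr fun z => ?_
  rw [slope_def_field, h0, sub_zero, sub_zero, inv_div]

theorem thetaN_neg (α : ZMod n) (z : ℂ) :
    thetaN n τ (-α) (-z) = -(e (-(n * z)) * chi n (-α) * thetaN n τ α z) := by
  obtain ⟨a, rfl⟩ := exists_intCast_eq n α
  have hn := natCast_ne_zero' n
  rw [← Int.cast_neg, thetaN_intCast, thetaN_intCast, chi_intCast, thetaRaw, thetaRaw]
  have h : ∀ s : ℕ, theta τ (-z + (s : ℂ) / n + ((-a : ℤ) : ℂ) / n * (τ : ℂ))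
      = -1 * e (-(z + (a : ℂ) / n * (τ : ℂ)) + (s : ℂ) / n) *
        theta τ (z - (s : ℂ) / n + (a : ℂ) / n * (τ : ℂ)) := by
    intro s
    rw [neg_one_mul, show -(z + (a : ℂ) / n * (τ : ℂ)) + (s : ℂ) / n
      = -(z - (s : ℂ) / n + (a : ℂ) / n * (τ : ℂ)) by ring, ← theta_neg]
    congr 1; push_cast; ring
  -- By periodicity `-s/n` may be replaced by `(n - s)/n`, which runs through the same residues as
  -- `s/n` in reverse order.
  have h2 : ∏ s ∈ Finset.range n, theta τ (z - (s : ℂ) / n + (a : ℂ) / n * (τ : ℂ))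
      = ∏ s ∈ Finset.range n, theta τ (z + (s : ℂ) / n + (a : ℂ) / n * (τ : ℂ)) := by
    rw [← Finset.prod_range_reflect,
      ← prod_range_shift n (g := fun s => theta τ (z + (s : ℂ) / n + (a : ℂ) / n * (τ : ℂ)))]
    · refine Finset.prod_congr rfl fun s hs => ?_
      have hs' := Finset.mem_range.1 hs
      rw [← theta_add_one]
      congr 1
      have : ((n - 1 - s : ℕ) : ℂ) = n - 1 - s := by
        rw [Nat.cast_sub (by omega), Nat.cast_sub (by omega)]; simp
      rw [this]; push_cast; field_simp; ring
    · rw [div_self hn, Nat.cast_zero, zero_div, add_zero, ← theta_add_one τ (z + _)]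
      congr 1; ring
  rw [Finset.prod_congr rfl fun s _ => h s, Finset.prod_mul_distrib, Finset.prod_mul_distrib,
    prod_e, Finset.prod_const, Finset.card_range, neg_one_pow_eq_e, h2, Finset.sum_add_distrib,
    sum_range_cast_div, Finset.sum_const, Finset.card_range, nsmul_eq_mul]
  set P := ∏ s ∈ Finset.range n, theta τ (z + (s : ℂ) / n + (a : ℂ) / n * (τ : ℂ))
  have hneg : ∀ u : ℂ, -u = e (1 / 2) * u := fun u => by rw [e_half]; ring
  refine Eq.trans ?_ (hneg _).symm
  -- With the sign written as `e(1/2)`, the constant exponents are `n/2 + (n-1)/2` on one side and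
  -- `1/2` on the other; they differ by `n - 1`.
  have : ∀ x1 x2 x3 y1 y2 y3 y4 : ℂ, x1 + x2 + x3 = y1 + y2 + y3 + y4 + (n - 1 : ℤ) →
      e x1 * e x2 * P * e x3 = e y1 * (e y2 * e y3 * (P * e y4)) := by
    intro x1 x2 x3 y1 y2 y3 y4 hxy
    have h5 := e_eq_of_sub_int _ hxy
    rw [e_add, e_add, e_add, e_add, e_add] at h5
    linear_combination P * h5
  apply this
  push_cast
  field_simp
  ring

/-! ### The Kronecker function of level `n` -/

/-- The function `θ_{α+β}(x + y) / (θ_α(x) θ_β(y))`. -/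
def kronN (α β : ZMod n) (x y : ℂ) : ℂ :=
  thetaN n τ (α + β) (x + y) / (thetaN n τ α x * thetaN n τ β y)

/-- The translation multiplies `θ_{α+β}(x + y)` and `θ_β(y)` by factors that differ only in their
dependence on `x` and `α`; the index `β - s` compensates the raising of the index by `sτ/n`. -/
theorem kronN_add (α β : ZMod n) (x y : ℂ) (p s : ℤ) :
    kronN n τ α (β - s) x (y + p / n + s * τ / n)
      = e (-(s * x)) * chi n α ^ p * kronN n τ α β x y := by
  rw [kronN, kronN, show x + (y + p / n + s * τ / n) = x + y + p / n + s * τ / n by ring,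
    thetaN_add_int_tau_div, thetaN_add_int_tau_div, sub_add_cancel, thetaN_add_int_div,
    thetaN_add_int_div, ← add_sub_assoc, sub_add_cancel, chi_add, mul_zpow]
  have h1 := zpow_ne_zero s (tauConst_ne_zero n τ)
  have h2 := zpow_ne_zero p (chi_ne_zero n β)
  have h3 := e_ne_zero (-(s * (y + p / n) + s * (s - 1) / 2 * τ / n))
  have h4 : e (-(s * (x + y + p / n) + s * (s - 1) / 2 * τ / n)) =
      e (-(s * x)) * e (-(s * (y + p / n) + s * (s - 1) / 2 * τ / n)) := by
    rw [← e_add]; congr 1; ring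
  rw [h4]
  set E := e (-(s * (y + p / n) + s * (s - 1) / 2 * τ / n))
  rw [show tauConst n τ ^ s * (e (-(s * x)) * E) *
      (chi n α ^ p * chi n β ^ p * thetaN n τ (α + β) (x + y))
    = (tauConst n τ ^ s * E * chi n β ^ p) *
      (e (-(s * x)) * chi n α ^ p * thetaN n τ (α + β) (x + y)) by ring,
    show thetaN n τ α x * (tauConst n τ ^ s * E * (chi n β ^ p * thetaN n τ β y))
    = (tauConst n τ ^ s * E * chi n β ^ p) * (thetaN n τ α x * thetaN n τ β y) by ring,
    mul_div_mul_left _ _ (mul_ne_zero (mul_ne_zero h1 h3) h2), mul_div_assoc]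

theorem chi_zpow_self (α : ZMod n) : chi n α ^ (n : ℤ) = 1 := by
  rw [← chi_intCast_mul]; simp [chi_zero]

theorem kronN_add_one (α β : ZMod n) (x y : ℂ) :
    kronN n τ α β x (y + 1) = kronN n τ α β x y := by
  have hn := natCast_ne_zero' n
  have h := kronN_add n τ α β x y n 0
  rw [chi_zpow_self] at h
  simpa [div_self hn, e_zero] using h

theorem kronN_add_tau (α β : ZMod n) (x y : ℂ) :
    kronN n τ α β x (y + τ) = e (-(n * x)) * kronN n τ α β x y := by
  have hn := natCast_ne_zero' n
  have h := kronN_add n τ α β x y 0 n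
  rw [Int.cast_natCast, Int.cast_natCast, ZMod.natCast_self, sub_zero, Int.cast_zero, zero_div,
    add_zero, zpow_zero, mul_one, mul_div_cancel_left₀ _ hn] at h
  exact h

theorem differentiableAt_kronN {α β : ZMod n} {x y : ℂ} (hx : thetaN n τ α x ≠ 0)
    (hy : thetaN n τ β y ≠ 0) : DifferentiableAt ℂ (fun y => kronN n τ α β x y) y := by
  have h := differentiable_thetaN n τ
  exact ((h _ _).comp y (by fun_prop)).div ((h _ _).const_mul _) (mul_ne_zero hx hy)

/-- The poles of `y ↦ θ_{α+β}(x + y/n) / (θ_α(x) θ_β(y/n))`. -/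
theorem tendsto_sub_mul_kronN {α β : ZMod n} {x : ℂ} (hx : thetaN n τ α x ≠ 0) (p s : ℤ) :
    Tendsto (fun A : ℂ => (A - (p + s * (τ : ℂ))) * kronN n τ α β x (A / n))
      (𝓝[≠] (p + s * (τ : ℂ)))
      (𝓝 (if β = -(s : ZMod n) then thetaNRes n τ * (e (-(s * x)) * chi n α ^ p) else 0)) := by
  have hn := natCast_ne_zero' n
  split_ifs with hβ
  · subst hβ
    have h1 : Tendsto (fun A : ℂ => A - (p + s * (τ : ℂ))) (𝓝[≠] (p + s * (τ : ℂ))) (𝓝[≠] 0) := by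
      refine tendsto_nhdsWithin_iff.2 ⟨?_, ?_⟩
      · have : Tendsto (fun A : ℂ => A - (p + s * (τ : ℂ))) (𝓝 (p + s * (τ : ℂ)))
            (𝓝 ((p + s * (τ : ℂ)) - (p + s * (τ : ℂ)))) := Continuous.tendsto (by fun_prop) _
        rw [sub_self] at this
        exact this.mono_left nhdsWithin_le_nhds
      · filter_upwards [self_mem_nhdsWithin] with A hA
        exact sub_ne_zero.2 hA
    have h2 := (tendsto_div_thetaN n τ).comp h1
    have h3 : Tendsto (fun A : ℂ => thetaN n τ α (x + (A - (p + s * (τ : ℂ))) / n) / thetaN n τ α x)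
        (𝓝[≠] (p + s * (τ : ℂ))) (𝓝 1) := by
      have h4 := (differentiable_thetaN n τ α).continuous
      have : Tendsto (fun A : ℂ => thetaN n τ α (x + (A - (p + s * (τ : ℂ))) / n) / thetaN n τ α x)
        (𝓝 (p + s * (τ : ℂ))) (𝓝 (thetaN n τ α (x + ((p + s * (τ : ℂ)) - (p + s * (τ : ℂ))) / n) /
          thetaN n τ α x)) :=
        Continuous.tendsto ((h4.comp (by fun_prop)).div_const _) _
      rw [sub_self, zero_div, add_zero, div_self hx] at this
      exact this.mono_left nhdsWithin_le_nhds
    have h5 := h2.mul (h3.mul_const (e (-(s * x)) * chi n α ^ p))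
    rw [one_mul] at h5
    refine h5.congr fun A => ?_
    -- The pole at `p + sτ` is translated to the pole of `1/θ₀` at `0`.
    have h6 := kronN_add n τ α 0 x ((A - (p + s * (τ : ℂ))) / n) p s
    rw [zero_sub, show (A - (p + s * (τ : ℂ))) / n + p / n + s * τ / n = A / n by
      field_simp; ring] at h6
    rw [h6, kronN, add_zero, Function.comp]
    simp only [div_eq_mul_inv, mul_inv]
    ring
  · have h1 : thetaN n τ β ((p + s * (τ : ℂ)) / n) ≠ 0 := by
      intro h0
      obtain ⟨b, rfl⟩ := exists_intCast_eq n β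
      obtain ⟨p', c, h⟩ := thetaN_eq_zero n τ h0
      rw [mul_div_cancel₀ _ hn] at h
      have h2 := congrArg Complex.im h
      have hτ := tau_im_ne_zero τ
      have h3 : ((n : ℂ) * c - b) = (((n * c - b : ℤ) : ℝ) : ℂ) := by push_cast; ring
      rw [h3] at h2
      simp only [Complex.add_im, Complex.intCast_im, Complex.mul_im, Complex.intCast_re, zero_mul,
        add_zero, zero_add, Complex.ofReal_re, Complex.ofReal_im] at h2
      have h4 : ((s : ℤ) : ℝ) = ((n * c - b : ℤ) : ℝ) := mul_right_cancel₀ hτ h2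
      have h5 : s = n * c - b := by exact_mod_cast h4
      apply hβ
      rw [h5]; push_cast; simp
    have h2 := ((differentiableAt_kronN n τ hx h1).continuousAt.comp
      (f := fun A : ℂ => A / n) (by fun_prop))
    have h3 : Tendsto (fun A : ℂ => (A - (p + s * (τ : ℂ))) * kronN n τ α β x (A / n))
        (𝓝 (p + s * (τ : ℂ))) (𝓝 (((p + s * (τ : ℂ)) - (p + s * (τ : ℂ))) *
          kronN n τ α β x ((p + s * (τ : ℂ)) / n))) :=
      (Continuous.tendsto (by fun_prop) _).mul h2
    rw [sub_self, zero_mul] at h3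
    exact h3.mono_left nhdsWithin_le_nhds

theorem thetaN_ne_zero_of_notMem {β : ZMod n} {x : ℂ} (hx : n * x ∉ lattice τ) :
    thetaN n τ β x ≠ 0 := by
  intro h
  obtain ⟨b, rfl⟩ := exists_intCast_eq n β
  obtain ⟨p, c, hp⟩ := thetaN_eq_zero n τ h
  exact hx ⟨p, n * c - b, by rw [hp]; push_cast; ring⟩

end Level

/-! ### Continuants -/

theorem d_nil : d [] = 1 := by simp [d]

theorem d_singleton (a : ℕ) : d [a] = a := by simp [d]

/-- Expansion of the determinant along the first row, and of the second minor along its first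
column. -/
theorem d_cons_cons (a b : ℕ) (l : List ℕ) : d (a :: b :: l) = a * d (b :: l) - d l := by
  have key : ∀ (M : Matrix (Fin (l.length + 1 + 1)) (Fin (l.length + 1 + 1)) ℤ),
      (∀ j : Fin l.length, M 0 j.succ.succ = 0) → (∀ j : Fin l.length, M j.succ.succ 0 = 0) →
      M.det = M 0 0 * (M.submatrix Fin.succ Fin.succ).det - M 0 1 * (M 1 0 *
        (M.submatrix (fun i : Fin l.length => i.succ.succ) (fun i => i.succ.succ)).det) := by
    intro M h1 h2
    rw [Matrix.det_succ_row_zero, Fin.sum_univ_succ, Fin.sum_univ_succ, Finset.sum_eq_zero]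
    · have h3 : (M.submatrix Fin.succ (Fin.succ (0 : Fin (l.length + 1))).succAbove).det
          = M 1 0 * (M.submatrix (fun i : Fin l.length => i.succ.succ) (fun i => i.succ.succ)).det := by
        rw [Matrix.det_succ_column_zero, Fin.sum_univ_succ, Finset.sum_eq_zero]
        · simp only [Fin.val_zero, pow_zero, one_mul, add_zero, Matrix.submatrix_apply,
            Matrix.submatrix_submatrix]
          congr 1
        · intro i _
          have : (Fin.succ (0 : Fin (l.length + 1))).succAbove 0 = 0 := by simp
          rw [Matrix.submatrix_apply, this, h2 i, mul_zero, zero_mul]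
      rw [h3]
      simp only [Fin.val_zero, pow_zero, one_mul, add_zero, Fin.succ_zero_eq_one]
      rw [show (Fin.succAbove (0 : Fin (l.length + 1 + 1))) = Fin.succ from by
        funext i; simp, Fin.val_one, pow_one]
      ring
    · intro j _
      rw [h1, mul_zero, zero_mul]
  have h := key (Matrix.of fun i j : Fin (a :: b :: l).length =>
    if i = j then ((a :: b :: l).get i : ℤ)
    else if i.val + 1 = j.val ∨ j.val + 1 = i.val then -1 else 0) (by
      intro j
      simp [Fin.ext_iff]) (by
      intro j
      simp [Fin.ext_iff])
  rw [d, h]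
  have h00 : ((0 : Fin (l.length + 1 + 1)) = 1) = False := by simp
  congr 1
  · simp only [Matrix.of_apply, if_true]
    congr 1
    rw [d]
    congr 1
    ext i j
    simp [Matrix.submatrix_apply, Fin.ext_iff]
  · rw [d]
    simp only [Matrix.of_apply]
    rw [if_neg (by simp), if_pos (by simp), if_neg (by simp), if_pos (by simp)]
    rw [show ∀ x : ℤ, -1 * (-1 * x) = x from fun x => by ring]
    congr 1
    ext i j
    simp [Matrix.submatrix_apply, Fin.ext_iff]

/-- Both sides obey the recursion at the front of the list, so two initial cases suffice and no
second determinant expansion is needed. -/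
theorem d_append_pair (a b : ℕ) : ∀ l : List ℕ, d (l ++ [a, b]) = b * d (l ++ [a]) - d l
  | [] => by
    simp only [List.nil_append, d_cons_cons, d_singleton, d_nil]
    ring
  | [x] => by
    simp only [List.cons_append, List.nil_append, d_cons_cons, d_singleton, d_nil]
    ring
  | x :: y :: l => by
    have h1 := d_append_pair a b (y :: l)
    have h2 := d_append_pair a b l
    simp only [List.cons_append] at h1
    simp only [List.cons_append, d_cons_cons, h1, h2]
    ring

/-- Positivity alone does not pass through the recursion; with strict growth, `a d(b, l) - d(l) ≥ 2
d(b, l) - d(l) > d(b, l)`. -/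
theorem d_pos_and_lt : ∀ (a : ℕ) (l : List ℕ), (∀ x ∈ a :: l, 2 ≤ x) → 0 < d l ∧ d l < d (a :: l)
  | a, [], h => by
    have : 2 ≤ a := h a (by simp)
    rw [d_nil, d_singleton]
    omega
  | a, b :: l, h => by
    have ha : (2 : ℤ) ≤ a := by exact_mod_cast h a (by simp)
    obtain ⟨h1, h2⟩ := d_pos_and_lt b l fun x hx => h x (List.mem_cons_of_mem _ hx)
    refine ⟨h1.trans h2, ?_⟩
    rw [d_cons_cons]
    nlinarith

theorem d_pos (l : List ℕ) (h : ∀ x ∈ l, 2 ≤ x) : 0 < d l := by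
  cases l with
  | nil => rw [d_nil]; norm_num
  | cons a l =>
    obtain ⟨h1, h2⟩ := d_pos_and_lt a l h
    exact h1.trans h2

theorem negContFrac_eq : ∀ (a : ℕ) (l : List ℕ), (∀ x ∈ a :: l, 2 ≤ x) →
    negContFrac (a :: l) = d (a :: l) / d l
  | a, [], _ => by simp [negContFrac, d_singleton, d_nil]
  | a, b :: l, h => by
    have hl : ∀ x ∈ b :: l, 2 ≤ x := fun x hx => h x (List.mem_cons_of_mem _ hx)
    have h1 : (d (b :: l) : ℚ) ≠ 0 := by exact_mod_cast (d_pos _ hl).ne'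
    rw [negContFrac, negContFrac_eq b l hl, d_cons_cons]
    push_cast
    field_simp

theorem isCoprime_d : ∀ (a : ℕ) (l : List ℕ), IsCoprime (d (a :: l)) (d l)
  | a, [] => by rw [d_nil]; exact isCoprime_one_right
  | a, b :: l => by
    rw [d_cons_cons, sub_eq_neg_add]
    refine IsCoprime.add_mul_right_left ?_ _
    exact (isCoprime_d b l).symm.neg_left

/-- The continued fraction determines `n` and `k`. -/
theorem d_eq_of_negContFrac {n k : ℕ} (hk : 1 ≤ k) (hcop : Nat.Coprime n k)
    {a : ℕ} {l : List ℕ} (hns : ∀ x ∈ a :: l, 2 ≤ x) (hcf : (n : ℚ) / k = negContFrac (a :: l)) :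
    d (a :: l) = n ∧ d l = k := by
  have h1 := d_pos l fun x hx => hns x (List.mem_cons_of_mem _ hx)
  have h2 := d_pos _ hns
  have hk' : (k : ℚ) ≠ 0 := by exact_mod_cast (by omega : k ≠ 0)
  have h1' : (d l : ℚ) ≠ 0 := by exact_mod_cast h1.ne'
  rw [negContFrac_eq a l hns, div_eq_div_iff hk' h1'] at hcf
  have h3 : (n : ℤ) * d l = d (a :: l) * k := by exact_mod_cast hcf
  have hc1 : IsCoprime (n : ℤ) k := Nat.isCoprime_iff_coprime.2 hcop
  have hc2 := isCoprime_d a l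
  have h4 : (k : ℤ) ∣ d l := hc1.symm.dvd_of_dvd_mul_left ⟨d (a :: l), by rw [h3]; ring⟩
  have h5 : d l ∣ k := hc2.symm.dvd_of_dvd_mul_left ⟨n, by rw [← h3]; ring⟩
  have h6 : d l = k := Int.dvd_antisymm h1.le (by positivity) h5 h4
  refine ⟨?_, h6⟩
  rw [h6] at h3
  exact (mul_right_cancel₀ (by positivity) h3).symm

/-- `d(n_{j+1}, …, n_q)` for `j ≤ q`, and `0` for `j > q`. -/
def dR (ns : List ℕ) (j : ℕ) : ℤ := if j ≤ ns.length then d (ns.drop j) else 0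

/-- `d(n₁, …, n_{j-1})` for `j ≥ 1`, and `0` for `j = 0`. -/
def dL (ns : List ℕ) (j : ℕ) : ℤ := if j = 0 then 0 else d (ns.take (j - 1))

variable (ns : List ℕ)

theorem dR_zero : dR ns 0 = d ns := by simp [dR]

theorem dR_length_add_one : dR ns (ns.length + 1) = 0 := by simp [dR]

theorem dL_zero : dL ns 0 = 0 := by simp [dL]

theorem dL_one : dL ns 1 = 1 := by simp [dL, d_nil]

theorem dL_length_add_one : dL ns (ns.length + 1) = d ns := by simp [dL]

/-- Here `ns[j]` is `n_{j+1}`. The value `0` of `dR` at `q + 1`, and that of `dL` at `0`, make the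
two recursions hold up to the boundary places. -/
theorem dR_rec {j : ℕ} (hj : j < ns.length) :
    dR ns j = ns[j] * dR ns (j + 1) - dR ns (j + 2) := by
  rw [dR, dR, if_pos hj.le, if_pos (by omega), List.drop_eq_getElem_cons hj]
  by_cases h : j + 1 < ns.length
  · rw [dR, if_pos (by omega), List.drop_eq_getElem_cons h, d_cons_cons]
  · have h1 : ns.drop (j + 1) = [] := by simp; omega
    rw [dR, if_neg (by omega), h1, d_singleton, d_nil]
    ring

theorem dL_rec {j : ℕ} (hj : j < ns.length) :
    dL ns (j + 2) = ns[j] * dL ns (j + 1) - dL ns j := by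
  simp only [dL, Nat.add_eq_zero_iff, if_false, one_ne_zero, OfNat.ofNat_ne_zero, and_false,
    show j + 2 - 1 = j + 1 by omega, show j + 1 - 1 = j by omega]
  rw [List.take_succ_eq_append_getElem hj]
  rcases j with _ | j
  · simp [d_singleton, d_nil]
  · rw [if_neg (by omega), List.take_succ_eq_append_getElem (by omega : j < ns.length),
      List.append_assoc, List.singleton_append, d_append_pair,
      show j + 1 - 1 = j by omega]

/-- The discrete Wronskian of two solutions of the same three-term recursion is constant; it is
evaluated at `t = 0`. -/
theorem dR_mul_dL_sub {t : ℕ} (ht : t ≤ ns.length) :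
    dR ns t * dL ns (t + 1) - dR ns (t + 1) * dL ns t = d ns := by
  induction t with
  | zero => simp [dR_zero, dL_one, dL_zero]
  | succ t ih =>
    rw [← ih (by omega), dL_rec ns ht, dR_rec ns ht]
    ring

theorem dR_pos (hns : ∀ x ∈ ns, 2 ≤ x) {j : ℕ} (hj : j ≤ ns.length) : 0 < dR ns j := by
  rw [dR, if_pos hj]
  exact d_pos _ fun x hx => hns x (List.mem_of_mem_drop hx)

theorem dRight_eq (ν : Fin ns.length) : dRight ns ν = dR ns (ν.val + 1) := by
  rw [dRight, dR, if_pos (by omega)]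

theorem dLeft_eq (ν : Fin ns.length) : dLeft ns ν = dL ns (ν.val + 1) := by
  rw [dLeft, dL, if_neg (by omega), Nat.add_sub_cancel]

/-! ### Multipliers of the functions in `Θ_{n/k}(Γ)` -/

section Multipliers

variable {ns : List ℕ} {τ : UpperHalfPlane}

/-- The value of a function of `z₁, …, z_q` at a sequence `Z`. -/
def ev (f : Entire (Fin ns.length)) (Z : ℕ → ℂ) : ℂ := f.1 fun ν => Z (ν.val + 1)

theorem ev_congr (f : Entire (Fin ns.length)) {Z Z' : ℕ → ℂ}
    (h : ∀ j < ns.length, Z (j + 1) = Z' (j + 1)) : ev f Z = ev f Z' :=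
  congrArg f.1 (funext fun ν => h ν ν.2)

theorem differentiable_ev (f : Entire (Fin ns.length)) {Z : ℂ → ℕ → ℂ}
    (h : ∀ j, Differentiable ℂ fun A => Z A j) : Differentiable ℂ fun A => ev f (Z A) :=
  Differentiable.comp (g := f.1) f.2 (differentiable_pi.2 fun ν => h (ν.val + 1))

theorem apply_add_int {f : Entire (Fin ns.length)} (hf : f ∈ ThetaSpace ns τ)
    (N : Fin ns.length → ℤ) (z : Fin ns.length → ℂ) :
    f.1 (z + fun ν => (N ν : ℂ)) = f.1 z := by
  have h1 : ∀ (ν : Fin ns.length) (m : ℤ) (z : Fin ns.length → ℂ),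
      f.1 (z + Pi.single ν (m : ℂ)) = f.1 z := by
    intro ν m
    induction m using Int.induction_on with
    | zero => simp
    | succ i ih =>
      intro z
      rw [← ih z, ← (hf ν (z + (Pi.single ν ((i : ℤ) : ℂ) : Fin ns.length → ℂ))).1, add_assoc, ← Pi.single_add]
      push_cast; rfl
    | pred i ih =>
      intro z
      rw [← ih z, ← (hf ν (z + _)).1, add_assoc, ← Pi.single_add,
        show ((-i - 1 : ℤ) : ℂ) + 1 = (-i : ℤ) by push_cast; ring]
  have h2 : ∀ S : Finset (Fin ns.length),
      f.1 (z + ∑ ν ∈ S, Pi.single ν (N ν : ℂ)) = f.1 z := by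
    classical
    intro S
    induction S using Finset.induction_on with
    | empty => simp
    | insert a S ha ih =>
      rw [Finset.sum_insert ha, add_comm (Pi.single a _), ← add_assoc, h1, ih]
  have h3 := h2 Finset.univ
  rwa [Finset.univ_sum_single] at h3

theorem ev_add_int {f : Entire (Fin ns.length)} (hf : f ∈ ThetaSpace ns τ) (N : ℕ → ℤ)
    (Z : ℕ → ℂ) : ev f (fun j => Z j + N j) = ev f Z :=
  apply_add_int hf (fun ν => N (ν.val + 1)) fun ν => Z (ν.val + 1)

/-- The linear part of the exponent of the multiplier of `z_{j+1} ↦ z_{j+1} + τ`. -/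
def mulLin (ns : List ℕ) (τ : UpperHalfPlane) (j : ℕ) : ℂ :=
  (ns.getD j 0 : ℂ) / 2 + (ns.getD j 0 : ℂ) * τ / 2 + ((if j = 0 then 1 else 0) - 1) * (τ : ℂ)

/-- The term `-n_{j+1} τ/2` is split off, and compensated in `mulLin`, so that iteration gives an
exponent with the pure square `m²` and a part linear in `m`. The value of `mulLin` never matters
later: it cancels between two functions translated in opposite directions. -/
theorem ev_add_single_tau {f : Entire (Fin ns.length)} (hf : f ∈ ThetaSpace ns τ)
    {Z : ℕ → ℂ} (h0 : Z 0 = 0) (hq : Z (ns.length + 1) = 0) {j : ℕ} (hj : j < ns.length) :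
    ev f (Z + Pi.single (j + 1) (τ : ℂ)) =
      e (-(ns[j] * Z (j + 1) - Z j - Z (j + 2)) - ns[j] * τ / 2 + mulLin ns τ j) * ev f Z := by
  have h := (hf ⟨j, hj⟩ fun ν => Z (ν.val + 1)).2
  have hz : (fun ν : Fin ns.length => Z (ν.val + 1)) + Pi.single ⟨j, hj⟩ (τ : ℂ)
      = fun ν => (Z + Pi.single (j + 1) (τ : ℂ) : ℕ → ℂ) (ν.val + 1) := by
    funext ν
    simp only [Pi.add_apply, Pi.single_apply, Fin.ext_iff, Nat.add_right_cancel_iff]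
  rw [hz] at h
  rw [ev, h, ev]
  congr 1
  have h1 : zAt (fun ν : Fin ns.length => Z (ν.val + 1)) j = Z j := by
    rw [zAt]
    split_ifs with h2
    · dsimp only
      congr 1; omega
    · have : j = 0 := by omega
      rw [this, h0]
  have h2 : zAt (fun ν : Fin ns.length => Z (ν.val + 1)) (j + 2) = Z (j + 2) := by
    rw [zAt]
    split_ifs with h2
    · congr 1
    · have : j + 2 = ns.length + 1 := by omega
      rw [this, hq]
  have h3 : ns.getD j 0 = ns[j] := List.getD_eq_getElem ns 0 hj
  simp only [h1, h2, List.get_eq_getElem, neg_one_pow_eq_e]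
  rw [← e_add, mulLin, h3]
  congr 1
  ring

theorem ev_add_single_lattice {f : Entire (Fin ns.length)} (hf : f ∈ ThetaSpace ns τ)
    {Z : ℕ → ℂ} (h0 : Z 0 = 0) (hq : Z (ns.length + 1) = 0) {j : ℕ} (hj : j < ns.length)
    (p m : ℤ) :
    ev f (Z + Pi.single (j + 1) (p + m * (τ : ℂ))) =
      e (-m * (ns[j] * Z (j + 1) - Z j - Z (j + 2)) - ns[j] * m ^ 2 * τ / 2 + m * mulLin ns τ j)
        * ev f Z := by
  have hp : ev f (Z + Pi.single (j + 1) (p + m * (τ : ℂ)))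
      = ev f (Z + Pi.single (j + 1) (m * (τ : ℂ))) := by
    rw [← ev_add_int hf (Pi.single (j + 1) p)
      (Z + (Pi.single (j + 1) (m * (τ : ℂ)) : ℕ → ℂ))]
    refine ev_congr f fun i _ => ?_
    simp only [Pi.add_apply, Pi.single_apply]
    split_ifs <;> push_cast <;> ring
  rw [hp]
  clear hp
  have key : ∀ m : ℤ, ev f (Z + Pi.single (j + 1) ((m + 1 : ℤ) * (τ : ℂ))) =
      e (-(ns[j] * (Z (j + 1) + m * τ) - Z j - Z (j + 2)) - ns[j] * τ / 2 + mulLin ns τ j)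
        * ev f (Z + Pi.single (j + 1) (m * (τ : ℂ))) := by
    intro m
    have h := ev_add_single_tau hf (Z := Z + Pi.single (j + 1) (m * (τ : ℂ)))
      (by simp [h0]) (by
        rw [Pi.add_apply, hq, Pi.single_eq_of_ne (by omega), add_zero]) hj
    rw [add_assoc, ← Pi.single_add] at h
    rw [show ((m + 1 : ℤ) : ℂ) * (τ : ℂ) = m * τ + τ by push_cast; ring, h]
    simp only [Pi.add_apply, Pi.single_eq_same, Pi.single_eq_of_ne (show j ≠ j + 1 by omega),
      Pi.single_eq_of_ne (show j + 2 ≠ j + 1 by omega), add_zero]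
  induction m using Int.induction_on with
  | zero => simp [e_zero]
  | succ i ih =>
    rw [key, ih, ← mul_assoc, ← e_add]
    congr 2; push_cast; ring
  | pred i ih =>
    have h := key (-i - 1)
    rw [sub_add_cancel, ih] at h
    apply mul_left_cancel₀ (e_ne_zero _)
    rw [← h, ← mul_assoc, ← e_add]
    congr 2; push_cast; ring

/-- The vector with entries `d(n_{j+1}, …, n_q)` at the places `j > t`, and `0` elsewhere. -/
def tailVec (ns : List ℕ) (t j : ℕ) : ℤ := if t < j then dR ns j else 0

/-- The entries of `tailVec` solve the recursion of the continuants, so the variables at places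
beyond `t + 1` drop out of the exponent; only the cut at `t` leaves a contribution. Since `Z` is `0`
at `q + 1`, the induction descends from `t = q`. -/
theorem ev_add_tailVec {f : Entire (Fin ns.length)} (hf : f ∈ ThetaSpace ns τ)
    {Z : ℕ → ℂ} (h0 : Z 0 = 0) (hq : Z (ns.length + 1) = 0) {t : ℕ} (ht : t ≤ ns.length) :
    ev f (fun j => Z j + tailVec ns t j * (τ : ℂ)) =
      e (-(dR ns t * Z (t + 1) - dR ns (t + 1) * Z t) - dR ns t * dR ns (t + 1) * τ / 2
        + ∑ j ∈ Finset.Ico t ns.length, dR ns (j + 1) * mulLin ns τ j) * ev f Z := by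
  induction ht using Nat.decreasingInduction with
  | self =>
    rw [dR_length_add_one, hq]
    simp only [Int.cast_zero, zero_mul, mul_zero, sub_zero, neg_zero, Finset.Ico_self,
      Finset.sum_empty, zero_div, add_zero, e_zero, one_mul]
    refine ev_congr f fun j hj => ?_
    rw [tailVec, if_neg (by omega)]
    simp
  | of_succ t ht ih =>
    have h1 := ev_add_single_lattice hf (Z := fun j => Z j + tailVec ns (t + 1) j * (τ : ℂ))
      (by simp [h0, tailVec]) (by
        simp [hq, tailVec, dR_length_add_one]) ht 0 (dR ns (t + 1))
    rw [ih] at h1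
    have h2 : ev f (fun j => Z j + tailVec ns t j * (τ : ℂ)) =
        ev f ((fun j => Z j + tailVec ns (t + 1) j * (τ : ℂ)) +
          Pi.single (t + 1) (((0 : ℤ) : ℂ) + dR ns (t + 1) * (τ : ℂ))) := by
      refine ev_congr f fun j _ => ?_
      simp only [Pi.add_apply, Pi.single_apply, tailVec]
      rcases lt_trichotomy j t with h | h | h
      · rw [if_neg (by omega), if_neg (by omega), if_neg (by omega)]; simp
      · subst h
        rw [if_pos (by omega), if_neg (by omega), if_pos rfl]; simp
      · rw [if_pos (by omega), if_pos (by omega), if_neg (by omega)]; simp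
    rw [h2, h1, ← mul_assoc, ← e_add, Finset.sum_eq_sum_Ico_succ_bot ht, dR_rec ns ht]
    congr 2
    simp only [tailVec, if_neg (show ¬ t + 1 < t + 1 by omega), if_neg (show ¬ t + 1 < t by omega),
      if_pos (show t + 1 < t + 2 by omega)]
    push_cast
    ring

end Multipliers

/-! ### Translations of the theta basis -/

section Basis

variable {n k : ℕ} [NeZero n] {ns : List ℕ} {τ : UpperHalfPlane}
  {w : ZMod n → Entire (Fin ns.length)}

/-- `r_j = d(n_{j+1}, …, n_q) / d(n₁, …, n_q)`. -/
def rho (ns : List ℕ) (j : ℕ) : ℂ := dR ns j / d ns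

/-- `d(n₁, …, n_{j-1}) / d(n₁, …, n_q)`. -/
def lam (ns : List ℕ) (j : ℕ) : ℂ := dL ns j / d ns

theorem IsThetaBasis.mem (hw : IsThetaBasis n k ns τ w) (α : ZMod n) : w α ∈ ThetaSpace ns τ := by
  rw [← hw.span_eq]
  exact Submodule.subset_span ⟨α, rfl⟩

theorem IsThetaBasis.ev_add_int_mul_rho (hw : IsThetaBasis n k ns τ w) (α : ZMod n) (Z : ℕ → ℂ)
    (p : ℤ) : ev (w α) (fun j => Z j + p * rho ns j) = chi n (k * α) ^ p * ev (w α) Z := by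
  have hc := chi_ne_zero n (k * α)
  have h : ∀ Z : ℕ → ℂ, ev (w α) (fun j => Z j + rho ns j) = chi n (k * α) * ev (w α) Z := by
    intro Z
    have h1 := hw.shift_one α fun ν => Z (ν.val + 1)
    have h2 : (fun ν : Fin ns.length => Z (ν.val + 1)) + rVec ns
        = fun ν => (fun j => Z j + rho ns j) (ν.val + 1) := by
      funext ν
      simp only [Pi.add_apply, rVec, rho, dRight_eq]
    rw [h2] at h1
    rw [ev, h1, ev]
    congr 1
    have h3 : (k * α : ZMod n) = ((k * α.val : ℤ) : ZMod n) := by simp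
    rw [h3, chi_intCast]
    push_cast; rfl
  induction p using Int.induction_on generalizing Z with
  | zero => simp
  | succ i ih =>
    rw [zpow_add_one₀ hc, mul_assoc, ← h, ← ih]
    congr 1; funext j; push_cast; ring
  | pred i ih =>
    apply mul_left_cancel₀ hc
    rw [zpow_sub_one₀ hc, ← h, mul_comm (_ ^ _), mul_assoc, mul_inv_cancel_left₀ hc, ← ih]
    congr 1; funext j; push_cast; ring

theorem IsThetaBasis.exists_ev_add_int_mul_tau (hw : IsThetaBasis n k ns τ w)
    (hq : 0 < ns.length) : ∃ φ : ℂ, ∀ (α : ZMod n) (Z : ℕ → ℂ) (s : ℤ),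
      ev (w α) (fun j => Z j + s * τ * rho ns j) =
        e (-(s * Z 1 + s * φ + s * (s - 1) / 2 * rho ns 1 * τ)) * ev (w (α + s)) Z := by
  obtain ⟨φ, hφ⟩ := hw.shift_tau
  refine ⟨φ, ?_⟩
  have h : ∀ (α : ZMod n) (Z : ℕ → ℂ), e (Z 1 + φ) * ev (w α) (fun j => Z j + τ * rho ns j)
      = ev (w (α + 1)) Z := by
    intro α Z
    have h1 := hφ α fun ν => Z (ν.val + 1)
    have h2 : (fun ν : Fin ns.length => Z (ν.val + 1)) + (τ : ℂ) • rVec ns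
        = fun ν => (fun j => Z j + τ * rho ns j) (ν.val + 1) := by
      funext ν
      simp only [Pi.add_apply, Pi.smul_apply, smul_eq_mul, rVec, rho, dRight_eq]
    have h3 : zAt (fun ν : Fin ns.length => Z (ν.val + 1)) 1 = Z 1 := by
      rw [zAt, dif_pos ⟨le_rfl, hq⟩]
    rw [h2, h3] at h1
    exact h1
  have h' : ∀ (α : ZMod n) (Z : ℕ → ℂ), ev (w α) (fun j => Z j + τ * rho ns j)
      = e (-(Z 1 + φ)) * ev (w (α + 1)) Z := by
    intro α Z
    rw [← h, ← mul_assoc, ← e_add, neg_add_cancel, e_zero, one_mul]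
  intro α Z s
  induction s using Int.induction_on generalizing α Z with
  | zero => simp [e_zero]
  | succ i ih =>
    have h1 := ih α (fun j => Z j + τ * rho ns j)
    rw [h'] at h1
    have h2 : (fun j => Z j + ((i + 1 : ℤ) : ℂ) * τ * rho ns j)
        = fun j => Z j + τ * rho ns j + ((i : ℤ) : ℂ) * τ * rho ns j := by
      funext j; push_cast; ring
    rw [h2, h1, ← mul_assoc, ← e_add, show α + ((i + 1 : ℤ) : ZMod n) = α + (i : ℤ) + 1 by
      push_cast; ring]
    congr 2
    push_cast; ring
  | pred i ih =>
    have h1 := ih α (fun j => Z j - τ * rho ns j)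
    have h2 : (fun j => Z j + ((-i - 1 : ℤ) : ℂ) * τ * rho ns j)
        = fun j => Z j - τ * rho ns j + ((-i : ℤ) : ℂ) * τ * rho ns j := by
      funext j; push_cast; ring
    have h3 := h' (α + (-i - 1 : ℤ)) (fun j => Z j - τ * rho ns j)
    simp only [sub_add_cancel] at h3
    have h4 : α + ((-i - 1 : ℤ) : ZMod n) + 1 = α + ((-i : ℤ) : ZMod n) := by push_cast; ring
    rw [h4] at h3
    have h5 : ev (w (α + (-i - 1 : ℤ))) Z = e (-(Z 1 - τ * rho ns 1 + φ)) *
      ev (w (α + (-i : ℤ))) (fun j => Z j - τ * rho ns j) := h3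
    rw [h2, h1, h5, ← mul_assoc, ← e_add]
    congr 2
    push_cast; ring

/-- Translations of the theta basis by `(ℤ + ℤτ) r`. -/
theorem IsThetaBasis.exists_ev_add_lattice (hw : IsThetaBasis n k ns τ w)
    (hq : 0 < ns.length) : ∃ φ : ℂ, ∀ (α : ZMod n) (Z : ℕ → ℂ) (p s : ℤ),
      ev (w α) (fun j => Z j + (p + s * τ) * rho ns j) =
        e (-(s * (Z 1 + p * rho ns 1) + s * φ + s * (s - 1) / 2 * rho ns 1 * τ)) *
          chi n (k * (α + s)) ^ p * ev (w (α + s)) Z := by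
  obtain ⟨φ, hφ⟩ := hw.exists_ev_add_int_mul_tau hq
  refine ⟨φ, fun α Z p s => ?_⟩
  have h := hφ α (fun j => Z j + p * rho ns j) s
  rw [hw.ev_add_int_mul_rho, ← mul_assoc] at h
  rw [← h]
  congr 1
  funext j
  ring

end Basis

/-! ### The exchange identity for products of theta functions -/

section Points

variable (ns : List ℕ) (z v : ℕ → ℂ) (B A : ℂ)

/-- The differences `u_j` of the two sets of variables `v_j + B l_j` and `z_j + A r_j`. -/
def uPt (j : ℕ) : ℂ := v j - z j + B * lam ns j - A * rho ns j

/-- The first set of variables, with the places `1, …, t` exchanged. -/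
def xPt (t j : ℕ) : ℂ := if j ≤ t then v j + B * lam ns j else z j + A * rho ns j

/-- The second set of variables, translated by `-A r - B l`, with the places `1, …, t` exchanged. -/
def yPt (t j : ℕ) : ℂ := if j ≤ t then z j - B * lam ns j else v j - A * rho ns j

variable {ns z v B A}

theorem rho_zero (hd : d ns ≠ 0) : rho ns 0 = 1 := by
  rw [rho, dR_zero, div_self (by exact_mod_cast hd)]

theorem rho_length_add_one : rho ns (ns.length + 1) = 0 := by
  rw [rho, dR_length_add_one, Int.cast_zero, zero_div]

theorem lam_zero : lam ns 0 = 0 := by rw [lam, dL_zero, Int.cast_zero, zero_div]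

theorem lam_length_add_one (hd : d ns ≠ 0) : lam ns (ns.length + 1) = 1 := by
  rw [lam, dL_length_add_one, div_self (by exact_mod_cast hd)]

theorem uPt_zero (hd : d ns ≠ 0) (hz0 : z 0 = 0) (hv0 : v 0 = 0) : uPt ns z v B A 0 = -A := by
  rw [uPt, rho_zero hd, lam_zero, hz0, hv0]; ring

theorem uPt_length_add_one (hd : d ns ≠ 0) (hzq : z (ns.length + 1) = 0)
    (hvq : v (ns.length + 1) = 0) : uPt ns z v B A (ns.length + 1) = B := by
  rw [uPt, rho_length_add_one, lam_length_add_one hd, hzq, hvq]; ring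

theorem xPt_zero (hv0 : v 0 = 0) (t : ℕ) : xPt ns z v B A t 0 = 0 := by
  rw [xPt, if_pos (Nat.zero_le _), lam_zero, hv0]; ring

theorem yPt_zero (hz0 : z 0 = 0) (t : ℕ) : yPt ns z v B A t 0 = 0 := by
  rw [yPt, if_pos (Nat.zero_le _), lam_zero, hz0]; ring

theorem xPt_length_add_one (hzq : z (ns.length + 1) = 0) {t : ℕ} (ht : t ≤ ns.length) :
    xPt ns z v B A t (ns.length + 1) = 0 := by
  rw [xPt, if_neg (by omega), rho_length_add_one, hzq]; ring

theorem yPt_length_add_one (hvq : v (ns.length + 1) = 0) {t : ℕ} (ht : t ≤ ns.length) :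
    yPt ns z v B A t (ns.length + 1) = 0 := by
  rw [yPt, if_neg (by omega), rho_length_add_one, hvq]; ring

end Points

/-! ### Quasi-periods and residues of the summands -/

section Identity

variable {n k : ℕ} [NeZero n] {ns : List ℕ} {τ : UpperHalfPlane}

/-- The summand with the places `1, …, t` exchanged. -/
def exchTerm (τ : UpperHalfPlane) (f g : Entire (Fin ns.length)) (z v : ℕ → ℂ) (B A : ℂ)
    (t : ℕ) : ℂ :=
  kron τ (-uPt ns z v B A t) (uPt ns z v B A (t + 1)) *
    (ev f (xPt ns z v B A t) * ev g (yPt ns z v B A t))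

variable {f g : Entire (Fin ns.length)} {z v : ℕ → ℂ} {B : ℂ}

theorem uPt_sub (A c : ℂ) (j : ℕ) :
    uPt ns z v B (A + c) j = uPt ns z v B A j - c * rho ns j := by
  simp only [uPt]; ring

theorem d_mul_rho (hd : d ns ≠ 0) (j : ℕ) : (d ns : ℂ) * rho ns j = dR ns j := by
  rw [rho, mul_div_cancel₀]
  exact_mod_cast hd

/-- Since `d r_j` is the integer `dR ns j`, all arguments change by integers. -/
theorem exchTerm_add_d (hd : d ns ≠ 0) (hf : f ∈ ThetaSpace ns τ) (hg : g ∈ ThetaSpace ns τ)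
    (A : ℂ) (t : ℕ) :
    exchTerm τ f g z v B (A + d ns) t = exchTerm τ f g z v B A t := by
  have h1 : ∀ j, (d ns : ℂ) * rho ns j = dR ns j := d_mul_rho hd
  have h2 := kron_add_lattice τ (-uPt ns z v B A t) (uPt ns z v B A (t + 1))
    (dR ns t) 0 (-dR ns (t + 1)) 0
  simp only [Int.cast_zero, zero_mul, add_zero, neg_zero, e_zero, one_mul] at h2
  have hx : xPt ns z v B (A + d ns) t
      = fun j => xPt ns z v B A t j + ((if j ≤ t then 0 else dR ns j : ℤ) : ℂ) := by
    funext j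
    simp only [xPt]
    split_ifs
    · simp
    · rw [add_mul, h1, add_assoc]
  have hy : yPt ns z v B (A + d ns) t
      = fun j => yPt ns z v B A t j + ((if j ≤ t then 0 else -dR ns j : ℤ) : ℂ) := by
    funext j
    simp only [yPt]
    split_ifs
    · simp
    · rw [add_mul, h1]; push_cast; ring
  rw [exchTerm, exchTerm, hx, hy, ev_add_int hf, ev_add_int hg, uPt_sub, uPt_sub, h1, h1, ← h2]
  congr 2
  · ring
  · push_cast; ring

/-- The places after `t` of the two sets of variables move by opposite multiples of `τ`, so the
constants of the multipliers cancel. What remains is linear in the variables at `t` and `t + 1`, and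
the Kronecker factor cancels all of it but `-B`. -/
theorem exchTerm_add_d_tau (hd : d ns ≠ 0) (hf : f ∈ ThetaSpace ns τ) (hg : g ∈ ThetaSpace ns τ)
    (hz0 : z 0 = 0) (hv0 : v 0 = 0) (hzq : z (ns.length + 1) = 0) (hvq : v (ns.length + 1) = 0)
    (A : ℂ) {t : ℕ} (ht : t ≤ ns.length) :
    exchTerm τ f g z v B (A + d ns * τ) t = e (-B) * exchTerm τ f g z v B A t := by
  have hd' : (d ns : ℂ) ≠ 0 := by exact_mod_cast hd
  have h1 : ∀ j, (d ns : ℂ) * τ * rho ns j = dR ns j * τ := fun j => by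
    rw [← d_mul_rho hd]; ring
  have h2 := kron_add_lattice τ (-uPt ns z v B A t) (uPt ns z v B A (t + 1))
    0 (dR ns t) 0 (-dR ns (t + 1))
  simp only [Int.cast_zero, zero_add] at h2
  have hx : xPt ns z v B (A + d ns * τ) t
      = fun j => xPt ns z v B A t j + tailVec ns t j * (τ : ℂ) := by
    funext j
    simp only [xPt, tailVec]
    split_ifs
    · omega
    · simp
    · rw [add_mul, h1]; ring
    · omega
  -- The second set moves backwards, so it is the old point that is a translate of the new one.
  have hy : yPt ns z v B A t
      = fun j => yPt ns z v B (A + d ns * τ) t j + tailVec ns t j * (τ : ℂ) := by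
    funext j
    simp only [yPt, tailVec]
    split_ifs
    · omega
    · simp
    · rw [add_mul, h1]; ring
    · omega
  have h3 := ev_add_tailVec hf (Z := xPt ns z v B A t) (xPt_zero hv0 t)
    (xPt_length_add_one hzq ht) ht
  rw [← hx] at h3
  have h4 := ev_add_tailVec hg (Z := yPt ns z v B (A + d ns * τ) t) (yPt_zero hz0 t)
    (yPt_length_add_one hvq ht) ht
  rw [← hy] at h4
  have h5 : uPt ns z v B (A + d ns * τ) (t + 1)
      = uPt ns z v B A (t + 1) + ((-dR ns (t + 1) : ℤ) : ℂ) * τ := by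
    rw [uPt_sub, h1]; push_cast; ring
  have h6 : -uPt ns z v B (A + d ns * τ) t = -uPt ns z v B A t + (dR ns t : ℂ) * τ := by
    rw [uPt_sub, h1]; ring
  rw [exchTerm, exchTerm, h5, h6, h2, h3, h4]
  set M := ∑ j ∈ Finset.Ico t ns.length, (dR ns (j + 1) : ℂ) * mulLin ns τ j
  -- The Wronskian is the coefficient of `-B`; this makes the multiplier `e(-B)` the same for all
  -- `t`.
  have hW : (dR ns t : ℂ) * lam ns (t + 1) - dR ns (t + 1) * lam ns t = 1 := by
    have := dR_mul_dL_sub ns ht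
    rw [lam, lam, ← mul_div_assoc, ← mul_div_assoc, ← sub_div, div_eq_one_iff_eq hd']
    exact_mod_cast this
  have hW' : (dR ns t : ℂ) * rho ns (t + 1) - dR ns (t + 1) * rho ns t = 0 := by
    rw [rho, rho]; ring
  have hxt : xPt ns z v B A t (t + 1) = z (t + 1) + A * rho ns (t + 1) := by
    rw [xPt, if_neg (by omega)]
  have hxt' : xPt ns z v B A t t = v t + B * lam ns t := by rw [xPt, if_pos le_rfl]
  have hyt : yPt ns z v B (A + d ns * τ) t (t + 1)
      = v (t + 1) - A * rho ns (t + 1) - dR ns (t + 1) * τ := by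
    rw [yPt, if_neg (by omega), add_mul, h1]; ring
  have hyt' : yPt ns z v B (A + d ns * τ) t t = z t - B * lam ns t := by rw [yPt, if_pos le_rfl]
  rw [hxt, hxt', hyt, hyt']
  have key : ∀ x1 x2 y1 y2 K F G : ℂ, x1 + x2 = y1 + y2 →
      e x1 * K * ((e x2 * F) * G) = e y1 * (K * (F * (e y2 * G))) := by
    intro x1 x2 y1 y2 K F G h
    have h7 := congrArg e h
    rw [e_add, e_add] at h7
    linear_combination K * F * G * h7
  apply key
  simp only [uPt]
  push_cast
  linear_combination (-B) * hW - A * hW'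

theorem differentiable_uPt (j : ℕ) : Differentiable ℂ fun A => uPt ns z v B A j := by
  unfold uPt; fun_prop

theorem hasDerivAt_uPt (j : ℕ) (A : ℂ) : HasDerivAt (fun A => uPt ns z v B A j) (-rho ns j) A := by
  have := ((hasDerivAt_id A).mul_const (rho ns j)).const_sub (v j - z j + B * lam ns j)
  rw [one_mul] at this
  exact this

theorem differentiable_ev_xPt (t : ℕ) : Differentiable ℂ fun A => ev f (xPt ns z v B A t) := by
  refine differentiable_ev f fun j => ?_
  unfold xPt
  split_ifs <;> fun_prop

theorem differentiable_ev_yPt (t : ℕ) : Differentiable ℂ fun A => ev g (yPt ns z v B A t) := by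
  refine differentiable_ev g fun j => ?_
  unfold yPt
  split_ifs <;> fun_prop

theorem differentiableAt_exchTerm {t : ℕ} {A : ℂ} (h1 : uPt ns z v B A t ∉ lattice τ)
    (h2 : uPt ns z v B A (t + 1) ∉ lattice τ) :
    DifferentiableAt ℂ (fun A => exchTerm τ f g z v B A t) A := by
  refine DifferentiableAt.mul (differentiableAt_kron (differentiable_uPt t).neg.differentiableAt
    (differentiable_uPt (t + 1)).differentiableAt ?_ ?_)
    ((differentiable_ev_xPt t).mul (differentiable_ev_yPt t)).differentiableAt
  · exact mt theta_eq_zero_iff.1 (mt neg_mem_lattice_iff.1 h1)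
  · exact mt theta_eq_zero_iff.1 h2

theorem tendsto_sub_mul_zero {F : ℂ → ℂ} {s : ℂ} (hF : ContinuousAt F s) :
    Tendsto (fun A => (A - s) * F A) (𝓝[≠] s) (𝓝 0) := by
  have h : Tendsto (fun A => (A - s) * F A) (𝓝 s) (𝓝 ((s - s) * F s)) :=
    (Continuous.tendsto (by fun_prop) s).mul hF
  rw [sub_self, zero_mul] at h
  exact h.mono_left nhdsWithin_le_nhds

/-- The residue of the summand `t` at a zero of `θ(u_{t+1})`. -/
theorem tendsto_exchTerm_left {t : ℕ} {A : ℂ} {p m : ℤ} (hr : rho ns (t + 1) ≠ 0)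
    (h1 : uPt ns z v B A t ∉ lattice τ) (h2 : uPt ns z v B A (t + 1) = p + m * (τ : ℂ)) :
    Tendsto (fun x => (x - A) * exchTerm τ f g z v B x t) (𝓝[≠] A)
      (𝓝 (-((rho ns (t + 1))⁻¹ * thetaRes τ) * (e (m * uPt ns z v B A t) *
        (ev f (xPt ns z v B A t) * ev g (yPt ns z v B A t))))) := by
  have h3 := tendsto_sub_mul_kron (τ := τ) (hasDerivAt_uPt (ns := ns) (z := z) (v := v) (B := B)
    (t + 1) A) (neg_ne_zero.2 hr) h2
    ((differentiable_uPt (ns := ns) (z := z) (v := v) (B := B) t).neg A).continuousAt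
    (mt theta_eq_zero_iff.1 (mt neg_mem_lattice_iff.1 h1))
  have h4 : Tendsto (fun x => ev f (xPt ns z v B x t) * ev g (yPt ns z v B x t)) (𝓝[≠] A)
      (𝓝 (ev f (xPt ns z v B A t) * ev g (yPt ns z v B A t))) :=
    ((differentiable_ev_xPt t).mul (differentiable_ev_yPt t)).continuous.continuousAt.mono_left
      nhdsWithin_le_nhds
  have h5 := h3.mul h4
  convert h5 using 1
  · funext x
    rw [exchTerm, kron_comm, mul_assoc]
    rfl
  · congr 1
    simp only [Pi.neg_apply, inv_neg, mul_neg, neg_neg]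
    ring

/-- The residue of the summand `t` at a zero of `θ(u_t)`. -/
theorem tendsto_exchTerm_right {t : ℕ} {A : ℂ} {p m : ℤ} (hr : rho ns t ≠ 0)
    (h1 : uPt ns z v B A (t + 1) ∉ lattice τ) (h2 : uPt ns z v B A t = p + m * (τ : ℂ)) :
    Tendsto (fun x => (x - A) * exchTerm τ f g z v B x t) (𝓝[≠] A)
      (𝓝 ((rho ns t)⁻¹ * thetaRes τ * (e (m * uPt ns z v B A (t + 1)) *
        (ev f (xPt ns z v B A t) * ev g (yPt ns z v B A t))))) := by
  have h0 : HasDerivAt (fun A => -uPt ns z v B A t) (rho ns t) A := by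
    have := (hasDerivAt_uPt (ns := ns) (z := z) (v := v) (B := B) t A).neg
    rw [neg_neg] at this
    exact this
  have h3 := tendsto_sub_mul_kron (τ := τ) (p := -p) (m := -m) h0 hr
    (by rw [h2]; push_cast; ring)
    ((differentiable_uPt (ns := ns) (z := z) (v := v) (B := B) (t + 1)) A).continuousAt
    (mt theta_eq_zero_iff.1 h1)
  have h4 : Tendsto (fun x => ev f (xPt ns z v B x t) * ev g (yPt ns z v B x t)) (𝓝[≠] A)
      (𝓝 (ev f (xPt ns z v B A t) * ev g (yPt ns z v B A t))) :=
    ((differentiable_ev_xPt t).mul (differentiable_ev_yPt t)).continuous.continuousAt.mono_left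
      nhdsWithin_le_nhds
  have h5 := h3.mul h4
  convert h5 using 1
  · funext x
    rw [exchTerm, mul_assoc]
  · congr 1
    rw [Int.cast_neg, neg_mul, neg_neg]
    ring

/-- At a zero of `θ(u_{j+1})` the residues of two consecutive summands cancel. -/
theorem exch_residue_cancel (hd : d ns ≠ 0) (hf : f ∈ ThetaSpace ns τ) (hg : g ∈ ThetaSpace ns τ)
    (hz0 : z 0 = 0) (hv0 : v 0 = 0) (hzq : z (ns.length + 1) = 0) (hvq : v (ns.length + 1) = 0)
    {A : ℂ} {j : ℕ} (hj : j < ns.length) {p m : ℤ}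
    (h : uPt ns z v B A (j + 1) = p + m * (τ : ℂ)) :
    e (m * uPt ns z v B A j) * (ev f (xPt ns z v B A j) * ev g (yPt ns z v B A j)) =
      e (m * uPt ns z v B A (j + 2)) *
        (ev f (xPt ns z v B A (j + 1)) * ev g (yPt ns z v B A (j + 1))) := by
  have hd' : (d ns : ℂ) ≠ 0 := by exact_mod_cast hd
  -- Exchanging the place `j + 1` moves that variable by `u_{j+1}`, here a lattice point, so both
  -- products differ only by multipliers.
  have hx : xPt ns z v B A (j + 1)
      = xPt ns z v B A j + Pi.single (j + 1) (p + m * (τ : ℂ)) := by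
    funext i
    rw [← h]
    simp only [Pi.add_apply, Pi.single_apply, xPt, uPt]
    rcases lt_trichotomy i (j + 1) with h | h | h
    · rw [if_pos (by omega), if_pos (by omega), if_neg (by omega), add_zero]
    · subst h
      rw [if_pos le_rfl, if_neg (by omega), if_pos rfl]; ring
    · rw [if_neg (by omega), if_neg (by omega), if_neg (by omega), add_zero]
  have hy : yPt ns z v B A j
      = yPt ns z v B A (j + 1) + Pi.single (j + 1) (p + m * (τ : ℂ)) := by
    funext i
    rw [← h]
    simp only [Pi.add_apply, Pi.single_apply, yPt, uPt]
    rcases lt_trichotomy i (j + 1) with h | h | h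
    · rw [if_pos (by omega), if_pos (by omega), if_neg (by omega), add_zero]
    · subst h
      rw [if_pos le_rfl, if_neg (by omega), if_pos rfl]; ring
    · rw [if_neg (by omega), if_neg (by omega), if_neg (by omega), add_zero]
  have h1 := ev_add_single_lattice hf (Z := xPt ns z v B A j) (xPt_zero hv0 _)
    (xPt_length_add_one hzq hj.le) hj p m
  rw [← hx] at h1
  have h2 := ev_add_single_lattice hg (Z := yPt ns z v B A (j + 1)) (yPt_zero hz0 _)
    (yPt_length_add_one hvq hj) hj p m
  rw [← hy] at h2
  rw [h1, h2]
  have key : ∀ x1 x2 y1 y2 F G : ℂ, x1 + x2 = y1 + y2 →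
      e x1 * (F * (e x2 * G)) = e y1 * ((e y2 * F) * G) := by
    intro x1 x2 y1 y2 F G h
    have h7 := congrArg e h
    rw [e_add, e_add] at h7
    linear_combination F * G * h7
  apply key
  -- The recursions for `r` and `l` eliminate `A` and `B` from the comparison of the exponents.
  have hr : (ns[j] : ℂ) * rho ns (j + 1) - rho ns j - rho ns (j + 2) = 0 := by
    rw [rho, rho, rho, dR_rec ns hj]; push_cast; ring
  have hl : (ns[j] : ℂ) * lam ns (j + 1) - lam ns j - lam ns (j + 2) = 0 := by
    rw [lam, lam, lam, dL_rec ns hj]; push_cast; ring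
  have e1 : xPt ns z v B A j (j + 1) = z (j + 1) + A * rho ns (j + 1) := by
    rw [xPt, if_neg (by omega)]
  have e2 : xPt ns z v B A j j = v j + B * lam ns j := by rw [xPt, if_pos le_rfl]
  have e3 : xPt ns z v B A j (j + 2) = z (j + 2) + A * rho ns (j + 2) := by
    rw [xPt, if_neg (by omega)]
  have e4 : yPt ns z v B A (j + 1) (j + 1) = z (j + 1) - B * lam ns (j + 1) := by
    rw [yPt, if_pos le_rfl]
  have e5 : yPt ns z v B A (j + 1) j = z j - B * lam ns j := by rw [yPt, if_pos (by omega)]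
  have e6 : yPt ns z v B A (j + 1) (j + 2) = v (j + 2) - A * rho ns (j + 2) := by
    rw [yPt, if_neg (by omega)]
  rw [e1, e2, e3, e4, e5, e6]
  simp only [uPt]
  linear_combination (m * A) * hr + (m * B) * hl

end Identity

/-! ### Proof of the exchange identity by comparison of residues -/

section Main

variable {n k : ℕ} [NeZero n] {ns : List ℕ} {τ : UpperHalfPlane}
  {w : ZMod n → Entire (Fin ns.length)} {z v : ℕ → ℂ} {B : ℂ}

/-- The difference of the two sides of the exchange identity. -/
def exchDiff (τ : UpperHalfPlane) (k : ℕ) (w : ZMod n → Entire (Fin ns.length)) (z v : ℕ → ℂ)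
    (B : ℂ) (a b : ZMod n) (A : ℂ) : ℂ :=
  thetaNRes n τ * ∑ t ∈ Finset.range (ns.length + 1), exchTerm τ (w a) (w b) z v B A t -
    thetaRes τ * ∑ r : ZMod n, kronN n τ (k * (a - b + r)) (-r) (B / n) (A / n) *
      (ev (w (a + r)) z * ev (w (b - r)) v)

/-- The residues of the two sides of the exchange identity at a lattice point agree. -/
theorem exch_residue_lattice (hw : IsThetaBasis n k ns τ w) (hd : d ns = n) (hk : dR ns 1 = k)
    (hq : 0 < ns.length) (a b : ZMod n) (p s : ℤ) :
    e (-(s * uPt ns z v B (p + s * (τ : ℂ)) 1)) *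
      (ev (w a) (xPt ns z v B (p + s * (τ : ℂ)) 0) * ev (w b) (yPt ns z v B (p + s * (τ : ℂ)) 0))
    = e (-(s * (B / n))) * chi n (k * (a - b + s)) ^ p * (ev (w (a + s)) z * ev (w (b - s)) v) := by
  have hn := natCast_ne_zero' n
  obtain ⟨φ, hφ⟩ := hw.exists_ev_add_lattice hq
  -- At `t = 0` the arguments are `z + A r` and `v - A r`. For `A = p + sτ` these are translations
  -- of the theta basis, which move the indices to `a + s` and `b - s`.
  have h1 := hφ a z p s
  have h2 := hφ b v (-p) (-s)
  have hx : ev (w a) (xPt ns z v B (p + s * (τ : ℂ)) 0)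
      = ev (w a) (fun j => z j + (p + s * τ) * rho ns j) :=
    ev_congr _ fun j _ => by rw [xPt, if_neg (by omega)]
  have hy : ev (w b) (yPt ns z v B (p + s * (τ : ℂ)) 0)
      = ev (w b) (fun j => v j + ((-p : ℤ) + (-s : ℤ) * τ) * rho ns j) :=
    ev_congr _ fun j _ => by rw [yPt, if_neg (by omega)]; push_cast; ring
  rw [hx, hy, h1, h2]
  have hr : rho ns 1 = k / n := by rw [rho, hk, hd]; push_cast; rfl
  have hl : lam ns 1 = 1 / n := by rw [lam, dL_one, hd]; push_cast; rfl
  -- The quotient of the characters belongs to `k(a - b + 2s)`. One `ks` is split off as `e(spk/n)`,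
  -- to be cancelled against `p r₁ = pk/n` in the exponents.
  have hc : chi n (k * (a + s)) ^ p * chi n (k * (b + (-s : ℤ))) ^ (-p)
      = e (s * p * k / n) * chi n (k * (a - b + s)) ^ p := by
    rw [zpow_neg, ← div_eq_mul_inv, div_eq_iff (zpow_ne_zero _ (chi_ne_zero _ _)), mul_assoc,
      ← mul_zpow, ← chi_add, show (k * (a - b + s) + k * (b + (-s : ℤ)) : ZMod n)
        = k * (a + s) + ((-(k * s) : ℤ) : ZMod n) by push_cast; ring, chi_add, mul_zpow,
      chi_intCast, ← e_int_mul, mul_left_comm, ← e_add,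
      show (s * p * k / n + p * ((-(k * s) : ℤ) / n) : ℂ) = 0 by push_cast; ring, e_zero, mul_one]
  have hE : e (-(s * uPt ns z v B (p + s * (τ : ℂ)) 1)) *
      (e (-(s * (z 1 + p * rho ns 1) + s * φ + s * (s - 1) / 2 * rho ns 1 * τ)) *
        e (-((-s : ℤ) * (v 1 + (-p : ℤ) * rho ns 1) + (-s : ℤ) * φ +
          (-s : ℤ) * ((-s : ℤ) - 1) / 2 * rho ns 1 * τ))) * e (s * p * k / n)
      = e (-(s * (B / n))) := by
    rw [← e_add, ← e_add, ← e_add]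
    congr 1
    rw [uPt, hr, hl]
    push_cast
    field_simp
    ring
  have h3 : b + ((-s : ℤ) : ZMod n) = b - s := by push_cast; ring
  rw [h3] at hc ⊢
  linear_combination (e (-(s * uPt ns z v B (p + s * (τ : ℂ)) 1)) *
      (e (-(s * (z 1 + p * rho ns 1) + s * φ + s * (s - 1) / 2 * rho ns 1 * τ)) *
        e (-((-s : ℤ) * (v 1 + (-p : ℤ) * rho ns 1) + (-s : ℤ) * φ +
          (-s : ℤ) * ((-s : ℤ) - 1) / 2 * rho ns 1 * τ)))) * (ev (w (a + s)) z * ev (w (b - s)) v) * hc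
      + chi n (k * (a - b + s)) ^ p * (ev (w (a + s)) z * ev (w (b - s)) v) * hE

theorem differentiableAt_exchDiff {a b : ZMod n} (hd : d ns ≠ 0)
    (hz0 : z 0 = 0) (hv0 : v 0 = 0) (hzq : z (ns.length + 1) = 0) (hvq : v (ns.length + 1) = 0)
    (hB : B ∉ lattice τ) {A : ℂ} (hA : A ∉ lattice τ)
    (hU : ∀ j < ns.length, uPt ns z v B A (j + 1) ∉ lattice τ) :
    DifferentiableAt ℂ (exchDiff τ k w z v B a b) A := by
  have hn := natCast_ne_zero' n
  have hU' : ∀ j ≤ ns.length + 1, uPt ns z v B A j ∉ lattice τ := by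
    intro j hj
    rcases j with _ | j
    · rw [uPt_zero hd hz0 hv0]; exact mt neg_mem_lattice_iff.1 hA
    · rcases (Nat.lt_or_ge j ns.length) with h | h
      · exact hU j h
      · have : j = ns.length := by omega
        rw [this, uPt_length_add_one hd hzq hvq]; exact hB
  refine DifferentiableAt.sub (DifferentiableAt.const_mul ?_ _) (DifferentiableAt.const_mul ?_ _)
  · refine DifferentiableAt.fun_sum fun t ht => ?_
    have := Finset.mem_range.1 ht
    exact differentiableAt_exchTerm (hU' t (by omega)) (hU' (t + 1) (by omega))
  · refine DifferentiableAt.fun_sum fun r _ => DifferentiableAt.mul_const ?_ _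
    refine DifferentiableAt.comp (g := fun y => kronN n τ (k * (a - b + r)) (-r) (B / n) y)
      (f := fun A : ℂ => A / n) A (differentiableAt_kronN n τ ?_ ?_) (by fun_prop)
    · exact thetaN_ne_zero_of_notMem n τ (by rwa [mul_div_cancel₀ _ hn])
    · exact thetaN_ne_zero_of_notMem n τ (by rwa [mul_div_cancel₀ _ hn])

theorem eventually_notMem_lattice {h : ℂ → ℂ} {c s : ℂ} (hh : HasDerivAt h c s) (hc : c ≠ 0) :
    ∀ᶠ x in 𝓝[≠] s, h x ∉ lattice τ := by
  have h1 := (hh.tendsto_nhdsNE hc).eventually (eventually_theta_ne_zero τ (h s))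
  exact h1.mono fun x hx => mt theta_eq_zero_iff.2 hx

/-- Since `u_0 = -A`, the genericity assumptions say that at most one of `u_0, …, u_q` is a lattice
point for any `A`, and `u_{q+1} = B` never is. So all poles are simple, and it remains to see that
the residues cancel. -/
theorem exchDiff_eq_zero_of_generic (hw : IsThetaBasis n k ns τ w) (hd : d ns = n)
    (hk : dR ns 1 = k) (hns : ∀ x ∈ ns, 2 ≤ x) (hq : 0 < ns.length)
    (hz0 : z 0 = 0) (hv0 : v 0 = 0) (hzq : z (ns.length + 1) = 0) (hvq : v (ns.length + 1) = 0)
    (hB : B ∉ lattice τ)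
    (hG1 : ∀ A ∈ lattice τ, ∀ j < ns.length, uPt ns z v B A (j + 1) ∉ lattice τ)
    (hG2 : ∀ A, ∀ i < ns.length, ∀ j < ns.length, i ≠ j → uPt ns z v B A (i + 1) ∈ lattice τ →
      uPt ns z v B A (j + 1) ∉ lattice τ)
    (a b : ZMod n) {A : ℂ} (hA : A ∉ lattice τ)
    (hU : ∀ j < ns.length, uPt ns z v B A (j + 1) ∉ lattice τ) :
    exchDiff τ k w z v B a b A = 0 := by
  have hn := natCast_ne_zero' n
  have hd0 : d ns ≠ 0 := by rw [hd]; exact_mod_cast NeZero.ne n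
  have hdn : (d ns : ℂ) = n := by rw [hd]; push_cast; rfl
  have hrho : ∀ j ≤ ns.length, rho ns j ≠ 0 := fun j hj => by
    rw [rho]
    exact div_ne_zero (by exact_mod_cast (dR_pos ns hns hj).ne') (by exact_mod_cast hd0)
  have hbn : n * (B / n) ∉ lattice τ := by rwa [mul_div_cancel₀ _ hn]
  refine eq_zero_of_quasiperiodic τ (Nat.pos_of_ne_zero (NeZero.ne n)) hB ?_ ?_ ?_ ?_
    (differentiableAt_exchDiff hd0 hz0 hv0 hzq hvq hB hA hU).continuousAt
  · intro c
    have h1 : ∀ᶠ x in 𝓝[≠] c, ∀ j ∈ Finset.range ns.length, uPt ns z v B x (j + 1) ∉ lattice τ := by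
      rw [Finset.eventually_all]
      intro j hj
      exact eventually_notMem_lattice (hasDerivAt_uPt (j + 1) c)
        (neg_ne_zero.2 (hrho _ (Finset.mem_range.1 hj)))
    filter_upwards [h1, eventually_notMem_lattice (hasDerivAt_id c) one_ne_zero] with x hx1 hx2
    exact differentiableAt_exchDiff hd0 hz0 hv0 hzq hvq hB hx2
      fun j hj => hx1 j (Finset.mem_range.2 hj)
  · intro c
    -- it suffices to compute the limits of the summands
    have key : ∀ (l : ℕ → ℂ) (m : ZMod n → ℂ),
        (∀ t ≤ ns.length, Tendsto (fun x => (x - c) * exchTerm τ (w a) (w b) z v B x t) (𝓝[≠] c)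
          (𝓝 (l t))) →
        (∀ r, Tendsto (fun x : ℂ => (x - c) * kronN n τ (k * (a - b + r)) (-r) (B / n) (x / n))
          (𝓝[≠] c) (𝓝 (m r))) →
        thetaNRes n τ * ∑ t ∈ Finset.range (ns.length + 1), l t = thetaRes τ * ∑ r : ZMod n,
          m r * (ev (w (a + r)) z * ev (w (b - r)) v) →
        Tendsto (fun x => (x - c) * exchDiff τ k w z v B a b x) (𝓝[≠] c) (𝓝 0) := by
      intro l m hl hm h
      have h1 := ((tendsto_finsetSum (Finset.range (ns.length + 1)) fun t ht =>
        hl t (by have := Finset.mem_range.1 ht; omega)).const_mul (thetaNRes n τ)).sub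
        ((tendsto_finsetSum Finset.univ fun r _ => (hm r).mul_const
          (ev (w (a + r)) z * ev (w (b - r)) v)).const_mul (thetaRes τ))
      rw [h, sub_self] at h1
      refine h1.congr fun x => ?_
      rw [exchDiff, mul_sub, mul_left_comm, Finset.mul_sum (a := x - c), mul_left_comm (x - c),
        Finset.mul_sum (a := x - c)]
      simp only [mul_assoc]
    have hreg : ∀ t ≤ ns.length, uPt ns z v B c t ∉ lattice τ → uPt ns z v B c (t + 1) ∉ lattice τ →
        Tendsto (fun x => (x - c) * exchTerm τ (w a) (w b) z v B x t) (𝓝[≠] c) (𝓝 0) :=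
      fun t _ h1 h2 => tendsto_sub_mul_zero (differentiableAt_exchTerm h1 h2).continuousAt
    have hBU : uPt ns z v B c (ns.length + 1) ∉ lattice τ := by
      rw [uPt_length_add_one hd0 hzq hvq]; exact hB
    by_cases hc : c ∈ lattice τ
    · have hUc : ∀ j, 1 ≤ j → j ≤ ns.length + 1 → uPt ns z v B c j ∉ lattice τ := by
        intro j h1 h2
        obtain ⟨i, rfl⟩ := Nat.exists_eq_add_of_le' h1
        rcases Nat.lt_or_ge i ns.length with h | h
        · exact hG1 c hc i h
        · rwa [show i = ns.length by omega]
      obtain ⟨p, s, rfl⟩ := hc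
      -- At a lattice point `p + sτ` only `t = 0` and `r = s` are singular. Their residues carry the
      -- factors `1/θ'(0)` and `n/θ₀'(0)`, which the cross-multiplication in `exchDiff` balances.
      refine key (fun t => if t = 0 then thetaRes τ * (e (-(s * uPt ns z v B (p + s * (τ : ℂ)) 1)) *
          (ev (w a) (xPt ns z v B (p + s * (τ : ℂ)) 0) *
            ev (w b) (yPt ns z v B (p + s * (τ : ℂ)) 0))) else 0)
        (fun r => if -r = -(s : ZMod n) then thetaNRes n τ *
          (e (-(s * (B / n))) * chi n (k * (a - b + r)) ^ p) else 0) ?_ ?_ ?_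
      · intro t ht
        split_ifs with h0
        · subst h0
          have h1 := tendsto_exchTerm_right (f := w a) (g := w b) (p := -p) (m := -s) (hrho 0 ht)
            (hUc 1 le_rfl (by omega)) (by
              rw [uPt_zero hd0 hz0 hv0 (A := p + s * (τ : ℂ))]; push_cast; ring)
          rw [rho_zero hd0, inv_one, one_mul, Int.cast_neg, neg_mul] at h1
          exact h1
        · exact hreg t ht (hUc t (by omega) (by omega)) (hUc _ (by omega) (by omega))
      · intro r
        exact tendsto_sub_mul_kronN n τ (thetaN_ne_zero_of_notMem n τ hbn) p s
      · rw [Finset.sum_ite_eq' (Finset.range (ns.length + 1)) 0, if_pos (by simp),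
          exch_residue_lattice hw hd hk hq]
        simp only [neg_inj, ite_mul, zero_mul]
        rw [Finset.sum_ite_eq' Finset.univ, if_pos (Finset.mem_univ _)]
        ring
    · have hm : ∀ r : ZMod n, Tendsto (fun x : ℂ => (x - c) *
          kronN n τ (k * (a - b + r)) (-r) (B / n) (x / n)) (𝓝[≠] c) (𝓝 0) := by
        intro r
        refine tendsto_sub_mul_zero ?_
        refine ContinuousAt.comp (g := fun y => kronN n τ (k * (a - b + r)) (-r) (B / n) y)
          (f := fun A : ℂ => A / n) (differentiableAt_kronN n τ ?_ ?_).continuousAt (by fun_prop)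
        · exact thetaN_ne_zero_of_notMem n τ hbn
        · exact thetaN_ne_zero_of_notMem n τ (by rwa [mul_div_cancel₀ _ hn])
      have hU0 : uPt ns z v B c 0 ∉ lattice τ := by
        rw [uPt_zero hd0 hz0 hv0]; exact mt neg_mem_lattice_iff.1 hc
      by_cases hj : ∃ j < ns.length, uPt ns z v B c (j + 1) ∈ lattice τ
      · obtain ⟨j, hj, hjm⟩ := hj
        have hUc : ∀ i ≤ ns.length + 1, i ≠ j + 1 → uPt ns z v B c i ∉ lattice τ := by
          intro i h1 h2
          rcases i with _ | i
          · exact hU0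
          rcases Nat.lt_or_ge i ns.length with h | h
          · exact hG2 c j hj i h (by omega) hjm
          · rwa [show i = ns.length by omega]
        obtain ⟨p, m, hpm⟩ := hjm
        set R := (rho ns (j + 1))⁻¹ * thetaRes τ * (e (m * uPt ns z v B c (j + 2)) *
          (ev (w a) (xPt ns z v B c (j + 1)) * ev (w b) (yPt ns z v B c (j + 1)))) with hR
        -- Only the two summands that contain `u_{j+1}` are singular here; the sum over `r` is
        -- regular away from the lattice.
        refine key (fun t => if t = j then -R else if t = j + 1 then R else 0) (fun _ => 0)
          ?_ hm ?_
        · intro t ht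
          split_ifs with h1 h2
          · subst h1
            have h3 := tendsto_exchTerm_left (f := w a) (g := w b) (hrho (t + 1) (by omega))
              (hUc t (by omega) (by omega)) hpm
            rw [exch_residue_cancel hd0 (hw.mem a) (hw.mem b) hz0 hv0 hzq hvq hj hpm] at h3
            rw [hR, ← neg_mul]
            exact h3
          · subst h2
            exact tendsto_exchTerm_right (f := w a) (g := w b) (hrho (j + 1) (by omega))
              (hUc (j + 2) (by omega) (by omega)) hpm
          · exact hreg t ht (hUc t (by omega) h2) (hUc _ (by omega) (by omega))
        · have hs : ∀ t, (if t = j then -R else if t = j + 1 then R else 0)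
              = (if t = j then -R else 0) + (if t = j + 1 then R else 0) := by
            intro t
            by_cases h1 : t = j
            · rw [if_pos h1, if_pos h1, if_neg (by omega), add_zero]
            · rw [if_neg h1, if_neg h1, zero_add]
          simp only [hs, Finset.sum_add_distrib, zero_mul, Finset.sum_const_zero, mul_zero]
          rw [Finset.sum_ite_eq', Finset.sum_ite_eq', if_pos (by simp; omega),
            if_pos (by simp; omega), neg_add_cancel, mul_zero]
      · push Not at hj
        refine key (fun _ => 0) (fun _ => 0) (fun t ht => ?_) hm (by simp)
        refine hreg t ht ?_ ?_
        · rcases t with _ | t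
          · exact hU0
          · exact hj t (by omega)
        · rcases Nat.lt_or_ge t ns.length with h | h
          · exact hj t h
          · rwa [show t = ns.length by omega]
  · intro A
    rw [exchDiff, exchDiff]
    congr 2
    · refine Finset.sum_congr rfl fun t _ => ?_
      rw [← hdn]
      exact exchTerm_add_d hd0 (hw.mem a) (hw.mem b) A t
    · refine Finset.sum_congr rfl fun r _ => ?_
      rw [add_div, div_self hn, kronN_add_one]
  · intro A
    rw [exchDiff, exchDiff, mul_sub, mul_left_comm, mul_left_comm (e (-B)) (thetaRes τ),
      Finset.mul_sum (a := e (-B)), Finset.mul_sum (a := e (-B))]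
    congr 2
    · refine Finset.sum_congr rfl fun t ht => ?_
      rw [← hdn]
      exact exchTerm_add_d_tau hd0 (hw.mem a) (hw.mem b) hz0 hv0 hzq hvq A
        (by have := Finset.mem_range.1 ht; omega)
    · refine Finset.sum_congr rfl fun r _ => ?_
      rw [add_div, mul_div_cancel_left₀ _ hn, kronN_add_tau, mul_div_cancel₀ _ hn, mul_assoc]

/-- The exchange identity. -/
theorem exchDiff_eq_zero (hw : IsThetaBasis n k ns τ w) (hd : d ns = n)
    (hk : dR ns 1 = k) (hns : ∀ x ∈ ns, 2 ≤ x) (hq : 0 < ns.length)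
    (hz0 : z 0 = 0) (hv0 : v 0 = 0) (hzq : z (ns.length + 1) = 0) (hvq : v (ns.length + 1) = 0)
    (hB : B ∉ lattice τ) (a b : ZMod n) {A : ℂ} (hA : A ∉ lattice τ)
    (hU : ∀ j < ns.length, uPt ns z v B A (j + 1) ∉ lattice τ) :
    exchDiff τ k w z v B a b A = 0 := by
  have hd0 : d ns ≠ 0 := by rw [hd]; exact_mod_cast NeZero.ne n
  have hrho : ∀ j ≤ ns.length, rho ns j ≠ 0 := fun j hj => by
    rw [rho]
    exact div_ne_zero (by exact_mod_cast (dR_pos ns hns hj).ne') (by exact_mod_cast hd0)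
  -- The perturbation adds `x j` to `u_j / r_j`, at a rate different for each place, so it separates
  -- coinciding zeros. It keeps the boundary values, because `j r_j` is `0` at `j = 0` and at `j = q
  -- + 1`.
  set V : ℂ → ℕ → ℂ := fun x j => v j + x * (j * rho ns j) with hV
  have hV0 : V 0 = v := by funext j; simp [hV]
  have hVU : ∀ x A j, uPt ns z (V x) B A j = uPt ns z v B A j + x * (j * rho ns j) := by
    intro x A j; simp only [uPt, hV]; ring
  -- The first union contains the `x` for which some `u_{j+1}` meets the lattice at a lattice point
  -- `A`; the second, after elimination of `A`, those for which two of the `u_j` meet it at the same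
  -- `A`. Values from vanishing denominators are harmless, since only countability is used.
  set bad : Set ℂ := (⋃ j : ℕ, Set.image2 (fun γ c => (γ - uPt ns z v B c (j + 1)) /
      ((j + 1 : ℕ) * rho ns (j + 1))) (lattice τ) (lattice τ)) ∪
    ⋃ p : ℕ × ℕ, Set.image2 (fun γ γ' => ((γ - uPt ns z v B 0 (p.1 + 1)) / rho ns (p.1 + 1) -
      (γ' - uPt ns z v B 0 (p.2 + 1)) / rho ns (p.2 + 1)) / ((p.1 + 1 : ℕ) - (p.2 + 1 : ℕ) : ℂ))
        (lattice τ) (lattice τ) with hbad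
  have hcount : bad.Countable := by
    have h := countable_lattice τ
    exact (Set.countable_iUnion fun j => h.image2 h _).union
      (Set.countable_iUnion fun p => h.image2 h _)
  have hgen : ∀ x ∉ bad, (∀ j < ns.length, uPt ns z (V x) B A (j + 1) ∉ lattice τ) →
      exchDiff τ k w z (V x) B a b A = 0 := by
    intro x hx hxU
    refine exchDiff_eq_zero_of_generic hw hd hk hns hq hz0 (by simp [hV, hv0]) hzq
      (by simp [hV, hvq, rho_length_add_one]) hB ?_ ?_ a b hA hxU
    · intro c hc j hj hmem
      refine hx (Or.inl (Set.mem_iUnion.2 ⟨j, _, hmem, c, hc, ?_⟩))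
      have h1 : (((j + 1 : ℕ) : ℂ) * rho ns (j + 1)) ≠ 0 :=
        mul_ne_zero (by exact_mod_cast Nat.succ_ne_zero j) (hrho _ hj)
      simp only [hVU]
      rw [add_sub_cancel_left, mul_div_cancel_right₀ _ h1]
    · intro c i hi j hj hij h1 h2
      refine hx (Or.inr (Set.mem_iUnion.2 ⟨(i, j), _, h1, _, h2, ?_⟩))
      have h3 : ((i + 1 : ℕ) - (j + 1 : ℕ) : ℂ) ≠ 0 := by
        rw [sub_ne_zero]
        intro h
        have : i + 1 = j + 1 := by exact_mod_cast h
        omega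
      have h4 := hrho _ hi
      have h5 := hrho _ hj
      have h6 : ∀ j, uPt ns z v B c j = uPt ns z v B 0 j - c * rho ns j := by
        intro j; simp only [uPt]; ring
      rw [div_eq_iff h3]
      simp only [hVU, h6]
      field_simp
      ring
  have hUc : ∀ j, Continuous fun x => uPt ns z (V x) B A j := fun j => by
    simp only [hVU]; fun_prop
  have hev : ∀ᶠ x in 𝓝 (0 : ℂ), ∀ j ∈ Finset.range ns.length,
      uPt ns z (V x) B A (j + 1) ∉ lattice τ := by
    rw [Finset.eventually_all]
    intro j hj
    have h1 : theta τ (uPt ns z (V 0) B A (j + 1)) ≠ 0 := by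
      rw [hV0]; exact mt theta_eq_zero_iff.1 (hU j (Finset.mem_range.1 hj))
    have h2 := ((continuous_theta τ).comp (hUc (j + 1))).continuousAt.eventually_ne h1
    exact h2.mono fun x hx => mt theta_eq_zero_iff.2 hx
  have hfreq : ∃ᶠ x in 𝓝 (0 : ℂ), exchDiff τ k w z (V x) B a b A = 0 := by
    have h1 : ∃ᶠ x in 𝓝 (0 : ℂ), x ∈ badᶜ :=
      mem_closure_iff_frequently.1 ((hcount.dense_compl ℂ) 0)
    refine (h1.and_eventually hev).mono fun x hx => ?_
    exact hgen x hx.1 fun j hj => hx.2 j (Finset.mem_range.2 hj)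
  have hcont : ContinuousAt (fun x => exchDiff τ k w z (V x) B a b A) 0 := by
    have hVd : ∀ j, Differentiable ℂ fun x => V x j := fun j => by simp only [hV]; fun_prop
    have hU' : ∀ j ≤ ns.length + 1, theta τ (uPt ns z (V 0) B A j) ≠ 0 := by
      intro j hj
      rw [hV0]
      refine mt theta_eq_zero_iff.1 ?_
      rcases j with _ | j
      · rw [uPt_zero hd0 hz0 hv0]; exact mt neg_mem_lattice_iff.1 hA
      · rcases (Nat.lt_or_ge j ns.length) with h | h
        · exact hU j h
        · have : j = ns.length := by omega
          rw [this, uPt_length_add_one hd0 hzq hvq]; exact hB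
    unfold exchDiff
    refine ContinuousAt.sub (continuousAt_const.mul ?_) (continuousAt_const.mul ?_)
    · refine tendsto_finsetSum _ fun t ht => ?_
      have ht' := Finset.mem_range.1 ht
      refine ContinuousAt.mul (continuousAt_kron (hUc t).neg.continuousAt
        (hUc (t + 1)).continuousAt ?_ (hU' _ (by omega))) ?_
      · rw [theta_neg]
        exact mul_ne_zero (neg_ne_zero.2 (e_ne_zero _)) (hU' _ (by omega))
      · refine ((differentiable_ev _ fun j => ?_).mul
          (differentiable_ev _ fun j => ?_)).continuous.continuousAt
        · unfold xPt; split_ifs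
          · exact (hVd j).add_const _
          · fun_prop
        · unfold yPt; split_ifs
          · fun_prop
          · exact (hVd j).sub_const _
    · refine tendsto_finsetSum _ fun r _ => ?_
      refine continuousAt_const.mul (continuousAt_const.mul ?_)
      exact (differentiable_ev _ hVd).continuous.continuousAt
  -- The complement of a countable set is dense, and the difference is continuous at `x = 0`.
  have h9 : exchDiff τ k w z (V 0) B a b A = 0 :=
    tendsto_nhds_unique_of_frequently_eq hcont (tendsto_const_nhds (x := (0 : ℂ))) hfreq
  rwa [hV0] at h9

end Main

/-! ### Specialisation to `A = -nη`, `B = nη`, and the limit in `η` -/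

section Limit

variable {n k : ℕ} [NeZero n] {ns : List ℕ} {τ : UpperHalfPlane}
  {w : ZMod n → Entire (Fin ns.length)}

/-- The numerator of `θ(c) K(-u_t, u_{t+1})`, where `u_j` is to be replaced by `c` at the places
`j` with `E j`. -/
def kapNum (τ : UpperHalfPlane) (c : ℂ) (E : ℕ → Prop) [DecidablePred E] (u : ℕ → ℂ) (t : ℕ) : ℂ :=
  if E t then if E (t + 1) then 0 else -e c * theta τ (u (t + 1) - c)
  else if E (t + 1) then theta τ (c - u t) else theta τ c * theta τ (u (t + 1) - u t)

/-- The denominator of `θ(c) K(-u_t, u_{t+1})`, where `u_j` is to be replaced by `c` at the places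
`j` with `E j`. -/
def kapDen (τ : UpperHalfPlane) (E : ℕ → Prop) [DecidablePred E] (u : ℕ → ℂ) (t : ℕ) : ℂ :=
  (if E t then 1 else theta τ (-u t)) * if E (t + 1) then 1 else theta τ (u (t + 1))

variable {E : ℕ → Prop} [DecidablePred E] {u : ℕ → ℂ}

/-- The factor `θ(c)` cancels the denominators `θ(c)` and `θ(-c) = -e(-c) θ(c)`; if both arguments
are replaced, the numerator is `θ(0) = 0`. The right-hand side makes sense for every `c`, which
permits the limit. -/
theorem theta_mul_kron_eq {c : ℂ} (hc : c ∉ lattice τ) (t : ℕ) :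
    theta τ c * kron τ (-if E t then c else u t) (if E (t + 1) then c else u (t + 1)) =
      kapNum τ c E u t / kapDen τ E u t := by
  have h1 : theta τ c ≠ 0 := mt theta_eq_zero_iff.1 hc
  have h2 := e_ne_zero c
  rw [kron, kapNum, kapDen]
  by_cases hE : E t <;> by_cases hE' : E (t + 1) <;>
    simp only [hE, hE', if_true, if_false, one_mul, mul_one]
  · rw [neg_add_cancel, theta_zero]; simp
  · rw [theta_neg, e_neg, neg_add_eq_sub]
    by_cases h3 : theta τ (u (t + 1)) = 0
    · simp [h3]
    · field_simp
  · rw [neg_add_eq_sub]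
    by_cases h3 : theta τ (-u t) = 0
    · simp [h3]
    · field_simp
  · rw [neg_add_eq_sub, mul_div_assoc]

/-- The exchanged first set of variables. -/
def xLim (ns : List ℕ) (c η : ℂ) (E : ℕ → Prop) [DecidablePred E] (z u : ℕ → ℂ) (t j : ℕ) : ℂ :=
  z j + (if j ≤ t then if E j then c else u j else 0) - dR ns j * η

/-- The exchanged second set of variables. -/
def yLim (ns : List ℕ) (c η : ℂ) (E : ℕ → Prop) [DecidablePred E] (z u : ℕ → ℂ) (t j : ℕ) : ℂ :=
  z j + (if j ≤ t then 0 else if E j then c else u j) - dL ns j * η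

/-- The translated second set of variables. -/
def vLim (ns : List ℕ) (c η : ℂ) (E : ℕ → Prop) [DecidablePred E] (z u : ℕ → ℂ) (j : ℕ) : ℂ :=
  z j + (if E j then c else u j) - (dL ns j + dR ns j) * η

/-- With `A = -nη` and `B = nη` the translations `A r_j` and `B l_j` become `-dR ns j * η` and `dL
ns j * η`. The places `0` and `q + 1` belong to `E`, in accordance with `u_0 = -A` and `u_{q+1} =
B`. -/
theorem exchange_generic (hw : IsThetaBasis n k ns τ w) (hd : d ns = n)
    (hk : dR ns 1 = k) (hns : ∀ x ∈ ns, 2 ≤ x) (hq : 0 < ns.length)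
    {z : ℕ → ℂ} (hz0 : z 0 = 0) (hzq : z (ns.length + 1) = 0)
    (hE0 : E 0) (hEq : E (ns.length + 1)) (hu : ∀ j, ¬ E j → u j ∉ lattice τ)
    (i j : ZMod n) {η : ℂ} (hη : n * η ∉ lattice τ) :
    thetaRes τ * ∑ r : ZMod n, theta τ (n * η) *
        (thetaN n τ (j - i + r * ((k : ZMod n) - 1)) 0 /
          (thetaN n τ ((k : ZMod n) * r) η * thetaN n τ (j - i - r) (-η))) *
        (ev (w (-(j - r))) z * ev (w (-(i + r))) (vLim ns (n * η) η E z u)) =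
    thetaNRes n τ * ∑ t ∈ Finset.range (ns.length + 1),
      kapNum τ (n * η) E u t / kapDen τ E u t *
        (ev (w (-i)) (xLim ns (n * η) η E z u t) * ev (w (-j)) (yLim ns (n * η) η E z u t)) := by
  have hn := natCast_ne_zero' n
  have hd0 : d ns ≠ 0 := by rw [hd]; exact_mod_cast NeZero.ne n
  have hdn : (d ns : ℂ) = n := by rw [hd]; push_cast; rfl
  have hr : ∀ j, n * η * rho ns j = dR ns j * η := fun j => by
    rw [rho, hdn]; field_simp
  have hl : ∀ j, n * η * lam ns j = dL ns j * η := fun j => by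
    rw [lam, hdn]; field_simp
  have hv0 : vLim ns (n * η) η E z u 0 = 0 := by
    rw [vLim, if_pos hE0, hz0, dR_zero, dL_zero, hdn]; push_cast; ring
  have hvq : vLim ns (n * η) η E z u (ns.length + 1) = 0 := by
    rw [vLim, if_pos hEq, hzq, dR_length_add_one, dL_length_add_one, hdn]; push_cast; ring
  have hU : ∀ j, uPt ns z (vLim ns (n * η) η E z u) (n * η) (-(n * η)) j
      = if E j then n * η else u j := fun j => by
    rw [uPt, vLim, neg_mul, hr, hl]; ring
  have h := exchDiff_eq_zero hw hd hk hns hq hz0 hv0 hzq hvq hη (-i) (-j)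
    (mt neg_mem_lattice_iff.1 hη) (fun j _ => by
      rw [hU]; split_ifs with h
      · exact hη
      · exact hu _ h)
  rw [exchDiff, sub_eq_zero] at h
  have hX : ∀ t, xPt ns z (vLim ns (n * η) η E z u) (n * η) (-(n * η)) t
      = xLim ns (n * η) η E z u t := fun t => by
    funext j
    rw [xPt, xLim, vLim, neg_mul, hr, hl]
    by_cases h : j ≤ t
    · rw [if_pos h, if_pos h]; ring
    · rw [if_neg h, if_neg h]; ring
  have hY : ∀ t, yPt ns z (vLim ns (n * η) η E z u) (n * η) (-(n * η)) t
      = yLim ns (n * η) η E z u t := fun t => by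
    funext j
    rw [yPt, yLim, vLim, neg_mul, hr, hl]
    by_cases h : j ≤ t
    · rw [if_pos h, if_pos h]; ring
    · rw [if_neg h, if_neg h]; ring
  have hL : ∑ t ∈ Finset.range (ns.length + 1),
      kapNum τ (n * η) E u t / kapDen τ E u t *
        (ev (w (-i)) (xLim ns (n * η) η E z u t) * ev (w (-j)) (yLim ns (n * η) η E z u t))
      = theta τ (n * η) * ∑ t ∈ Finset.range (ns.length + 1), exchTerm τ (w (-i)) (w (-j)) z
        (vLim ns (n * η) η E z u) (n * η) (-(n * η)) t := by
    rw [Finset.mul_sum]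
    refine Finset.sum_congr rfl fun t _ => ?_
    rw [exchTerm, hX, hY, hU, hU, ← theta_mul_kron_eq hη, mul_assoc]
  rw [hL, mul_left_comm, h, mul_left_comm]
  congr 1
  -- The substitution `r ↦ r + (j - i)` matches the summation index of the relation with that of the
  -- exchange identity.
  rw [← Equiv.sum_comp (Equiv.addRight (j - i)), Finset.mul_sum]
  refine Finset.sum_congr rfl fun r _ => ?_
  simp only [Equiv.coe_addRight]
  rw [mul_assoc, kronN, mul_div_cancel_left₀ _ hn, neg_div, mul_div_cancel_left₀ _ hn,
    add_neg_cancel]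
  ring_nf

/-- The excluded values `nη ∈ Γ` are isolated and the right-hand side is continuous in `η`, so the
identity passes to the limit. -/
theorem exchange_limit (hw : IsThetaBasis n k ns τ w) (hd : d ns = n)
    (hk : dR ns 1 = k) (hns : ∀ x ∈ ns, 2 ≤ x) (hq : 0 < ns.length)
    {z : ℕ → ℂ} (hz0 : z 0 = 0) (hzq : z (ns.length + 1) = 0)
    (hE0 : E 0) (hEq : E (ns.length + 1)) (hu : ∀ j, ¬ E j → u j ∉ lattice τ)
    (i j : ZMod n) {η : ℂ} {c : ZMod n → ℂ}
    (hc : ∀ r : ZMod n, Tendsto (fun t : ℂ => theta τ (n * t) *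
        (thetaN n τ (j - i + r * ((k : ZMod n) - 1)) 0 /
          (thetaN n τ ((k : ZMod n) * r) t * thetaN n τ (j - i - r) (-t)))) (𝓝[≠] η) (𝓝 (c r))) :
    thetaRes τ * ∑ r : ZMod n, c r *
        (ev (w (-(j - r))) z * ev (w (-(i + r))) (vLim ns (n * η) η E z u)) =
    thetaNRes n τ * ∑ t ∈ Finset.range (ns.length + 1),
      kapNum τ (n * η) E u t / kapDen τ E u t *
        (ev (w (-i)) (xLim ns (n * η) η E z u t) * ev (w (-j)) (yLim ns (n * η) η E z u t)) := by
  have hn := natCast_ne_zero' n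
  have hv : ∀ j, Differentiable ℂ fun x : ℂ => vLim ns (n * x) x E z u j := fun j => by
    unfold vLim; split_ifs <;> fun_prop
  have hX : ∀ t j, Differentiable ℂ fun x : ℂ => xLim ns (n * x) x E z u t j := fun t j => by
    unfold xLim; split_ifs <;> fun_prop
  have hY : ∀ t j, Differentiable ℂ fun x : ℂ => yLim ns (n * x) x E z u t j := fun t j => by
    unfold yLim; split_ifs <;> fun_prop
  have hK : ∀ t, Continuous fun x : ℂ => kapNum τ (n * x) E u t := fun t => by
    have h1 := continuous_theta τ
    have h2 := continuous_e
    unfold kapNum; split_ifs <;> fun_prop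
  have hne : ∀ᶠ x : ℂ in 𝓝[≠] η, n * x ∉ lattice τ := by
    have h1 : Tendsto (fun x : ℂ => n * x) (𝓝[≠] η) (𝓝[≠] (n * η)) := by
      refine tendsto_nhdsWithin_of_tendsto_nhds_of_eventually_within _ ?_ ?_
      · exact (Continuous.tendsto (by fun_prop) η).mono_left nhdsWithin_le_nhds
      · filter_upwards [self_mem_nhdsWithin] with x hx h
        exact hx (mul_left_cancel₀ hn h)
    filter_upwards [h1.eventually (eventually_theta_ne_zero τ (n * η))] with x hx h
    exact hx (theta_lattice h)
  have hL := tendsto_const_nhds (x := thetaRes τ) |>.mul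
    (tendsto_finsetSum Finset.univ fun r _ => (hc r).mul
      ((tendsto_const_nhds (x := ev (w (-(j - r))) z)).mul
        (((differentiable_ev (w (-(i + r))) hv).continuous.tendsto η).mono_left
          (nhdsWithin_le_nhds (s := {η}ᶜ)))))
  have hR : Continuous fun x : ℂ => thetaNRes n τ * ∑ t ∈ Finset.range (ns.length + 1),
      kapNum τ (n * x) E u t / kapDen τ E u t *
        (ev (w (-i)) (xLim ns (n * x) x E z u t) * ev (w (-j)) (yLim ns (n * x) x E z u t)) :=
    continuous_const.mul (continuous_finsetSum _ fun t _ => ((hK t).div_const _).mul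
      ((differentiable_ev _ (hX t)).continuous.mul (differentiable_ev _ (hY t)).continuous))
  refine tendsto_nhds_unique hL
    (((hR.tendsto η).mono_left (nhdsWithin_le_nhds (s := {η}ᶜ))).congr' ?_)
  filter_upwards [hne] with x hx
  exact (exchange_generic hw hd hk hns hq hz0 hzq hE0 hEq hu i j hx).symm

end Limit

/-! ### Identities of meromorphic functions -/

section Mero

variable {ι : Type} [Fintype ι]

theorem toMero_mul (f g : Entire ι) : toMero (f * g) = toMero f * toMero g := map_mul _ f g

theorem toMero_neg (f : Entire ι) : toMero (-f) = -toMero f := map_neg (algebraMap _ _) f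

theorem toMero_sum {κ : Type*} (S : Finset κ) (f : κ → Entire ι) :
    toMero (∑ t ∈ S, f t) = ∑ t ∈ S, toMero (f t) := map_sum (algebraMap _ _) f S

theorem toMero_ne_zero {f : Entire ι} (hf : f ≠ 0) : toMero f ≠ 0 :=
  (map_ne_zero_iff _ (IsFractionRing.injective (Entire ι) (Mero ι))).2 hf

theorem translateMero_toMero (s : ι → ℂ) (f : Entire ι) :
    translateMero s (toMero f) = toMero (translate s f) :=
  IsFractionRing.ringEquivOfRingEquiv_algebraMap _ _

theorem entire_prod_apply {κ : Type*} (S : Finset κ) (f : κ → Entire ι) (y : ι → ℂ) :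
    (∏ t ∈ S, f t).1 y = ∏ t ∈ S, (f t).1 y := by
  have h := map_prod ((Pi.evalRingHom (fun _ : ι → ℂ => ℂ) y).comp (Entire ι).subtype) f S
  exact h

theorem entire_sum_apply {κ : Type*} (S : Finset κ) (f : κ → Entire ι) (y : ι → ℂ) :
    (∑ t ∈ S, f t).1 y = ∑ t ∈ S, (f t).1 y := by
  have h := map_sum ((Pi.evalRingHom (fun _ : ι → ℂ => ℂ) y).comp (Entire ι).subtype) f S
  exact h

/-- An identity between quotients of entire functions holds in the field of meromorphic functions if
it holds at all points at which the denominators do not vanish. -/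
theorem toMero_eq_sum_div {κ : Type*} (S : Finset κ) (G : Entire ι) (N D H : κ → Entire ι)
    (hD : ∀ t ∈ S, D t ≠ 0)
    (h : ∀ y, (∀ t ∈ S, (D t).1 y ≠ 0) → G.1 y = ∑ t ∈ S, (N t).1 y / (D t).1 y * (H t).1 y) :
    toMero G = ∑ t ∈ S, toMero (N t) / toMero (D t) * toMero (H t) := by
  classical
  have hP : ∏ t ∈ S, D t ≠ 0 := Finset.prod_ne_zero_iff.2 hD
  have h1 : ∀ t ∈ S, toMero (∏ t ∈ S, D t) * (toMero (N t) / toMero (D t) * toMero (H t))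
      = toMero ((∏ s ∈ S.erase t, D s) * (N t * H t)) := by
    intro t ht
    have h2 := toMero_ne_zero (hD t ht)
    rw [← Finset.mul_prod_erase S D ht, toMero_mul, toMero_mul, toMero_mul]
    field_simp
  apply mul_left_cancel₀ (toMero_ne_zero hP)
  rw [Finset.mul_sum, Finset.sum_congr rfl h1, ← toMero_sum, ← toMero_mul]
  congr 1
  -- A second factor `∏ D` makes both sides vanish where a denominator does, so the pointwise
  -- hypothesis is needed only elsewhere.
  apply mul_left_cancel₀ hP
  refine Subtype.ext (funext fun y => ?_)
  change (∏ t ∈ S, D t).1 y * ((∏ t ∈ S, D t).1 y * G.1 y) = (∏ t ∈ S, D t).1 y *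
    (∑ t ∈ S, (∏ s ∈ S.erase t, D s) * (N t * H t)).1 y
  by_cases hy : (∏ t ∈ S, D t).1 y = 0
  · rw [hy, zero_mul, zero_mul]
  · rw [entire_prod_apply] at hy
    have hy' := Finset.prod_ne_zero_iff.1 hy
    rw [h y hy', entire_sum_apply, Finset.mul_sum]
    congr 1
    refine Finset.sum_congr rfl fun t ht => ?_
    change _ = (∏ s ∈ S.erase t, D s).1 y * ((N t).1 y * (H t).1 y)
    rw [entire_prod_apply, entire_prod_apply, ← Finset.mul_prod_erase S _ ht]
    have := hy' t ht
    field_simp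

end Mero

/-! ### The exchange identity for meromorphic functions of the dynamical variables -/

section Dynamical

variable {q : ℕ} {m : Fin q → ℕ}

/-- The multi-indices agree at the place `j`; this includes the places `0` and `q + 1`. -/
def eqAt (α β : EIdx m) (j : ℕ) : Prop := ∀ ν : Fin q, ν.val + 1 = j → α ν = β ν

instance (α β : EIdx m) : DecidablePred (eqAt α β) := fun _ =>
  inferInstanceAs (Decidable (∀ _ : Fin q, _ → _))

theorem eqAt_zero (α β : EIdx m) : eqAt α β 0 := fun _ h => by omega

theorem eqAt_add_one (α β : EIdx m) : eqAt α β (q + 1) := fun _ h => by omega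

theorem eqAt_iff (α β : EIdx m) (ν : Fin q) : eqAt α β (ν.val + 1) ↔ α ν = β ν :=
  ⟨fun h => h ν rfl, fun h μ hμ => by
    have : μ = ν := Fin.ext (by omega)
    rwa [this]⟩

theorem exists_of_not_eqAt {α β : EIdx m} {j : ℕ} (h : ¬ eqAt α β j) :
    ∃ ν : Fin q, ν.val + 1 = j ∧ α ν ≠ β ν := by
  unfold eqAt at h
  push Not at h
  exact h

/-- `y_{α_j, j}`, and `0` for `j = 0` and `j = q + 1`. -/
def yAt (α : EIdx m) (y : YIdx m → ℂ) (j : ℕ) : ℂ := zAt (fun ν => y ⟨ν, α ν⟩) j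

theorem yAt_add_one (α : EIdx m) (y : YIdx m → ℂ) (ν : Fin q) :
    yAt α y (ν.val + 1) = y ⟨ν, α ν⟩ := by
  rw [yAt, zAt, dif_pos ⟨by omega, ν.2⟩]
  rfl

theorem yAt_zero (α : EIdx m) (y : YIdx m → ℂ) : yAt α y 0 = 0 := by
  rw [yAt, zAt, dif_neg (by omega)]

theorem yAt_length_add_one (α : EIdx m) (y : YIdx m → ℂ) : yAt α y (q + 1) = 0 := by
  rw [yAt, zAt, dif_neg (by omega)]

theorem differentiable_yAt (α : EIdx m) (j : ℕ) : Differentiable ℂ fun y => yAt α y j := by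
  unfold yAt zAt
  split_ifs <;> fun_prop

/-- The differences of the dynamical variables. -/
def uAt (α β : EIdx m) (y : YIdx m → ℂ) (j : ℕ) : ℂ := yAt β y j - yAt α y j

theorem uAt_add_one (α β : EIdx m) (y : YIdx m → ℂ) (ν : Fin q) :
    uAt α β y (ν.val + 1) = y ⟨ν, β ν⟩ - y ⟨ν, α ν⟩ := by
  rw [uAt, yAt_add_one, yAt_add_one]

theorem differentiable_uAt (α β : EIdx m) (j : ℕ) : Differentiable ℂ fun y => uAt α β y j :=
  (differentiable_yAt β j).sub (differentiable_yAt α j)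

/-- `kapNum` as an entire function of the dynamical variables. -/
def kapNumE (τ : UpperHalfPlane) (c : ℂ) (α β : EIdx m) (t : ℕ) : Entire (YIdx m) :=
  ⟨fun y => kapNum τ c (eqAt α β) (uAt α β y) t, by
    have h1 := differentiable_theta τ
    have h2 := differentiable_uAt α β
    change Differentiable ℂ fun y => kapNum τ c (eqAt α β) (uAt α β y) t
    unfold kapNum
    split_ifs
    · fun_prop
    · exact (h1.comp ((h2 _).sub_const _)).const_mul _
    · exact h1.comp ((h2 _).const_sub _)
    · exact (h1.comp ((h2 _).sub (h2 _))).const_mul _⟩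

/-- `kapDen` as an entire function of the dynamical variables. -/
def kapDenE (τ : UpperHalfPlane) (α β : EIdx m) (t : ℕ) : Entire (YIdx m) :=
  ⟨fun y => kapDen τ (eqAt α β) (uAt α β y) t, by
    have h1 := differentiable_theta τ
    have h2 := differentiable_uAt α β
    change Differentiable ℂ fun y => kapDen τ (eqAt α β) (uAt α β y) t
    unfold kapDen
    refine Differentiable.mul ?_ ?_ <;> split_ifs
    · fun_prop
    · exact h1.comp (h2 _).neg
    · fun_prop
    · exact h1.comp (h2 _)⟩

/-- The coefficients of the exchange identity. -/
def kap (τ : UpperHalfPlane) (c : ℂ) (α β : EIdx m) (t : ℕ) : Mero (YIdx m) :=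
  toMero (kapNumE τ c α β t) / toMero (kapDenE τ α β t)

theorem thetaOf_sub_add_ne_zero (τ : UpperHalfPlane) {α β : EIdx m} {ν : Fin q} (h : α ν ≠ β ν)
    (c : ℂ) : thetaOf τ (yv β ν - yv α ν + cst c) ≠ 0 := by
  intro h0
  obtain ⟨x, hx⟩ := exists_theta_ne_zero τ
  have h1 := congrFun (congrArg Subtype.val h0) (Pi.single ⟨ν, β ν⟩ (x - c))
  change theta τ ((Pi.single (⟨ν, β ν⟩ : YIdx m) (x - c) : YIdx m → ℂ) ⟨ν, β ν⟩ -
    (Pi.single (⟨ν, β ν⟩ : YIdx m) (x - c) : YIdx m → ℂ) ⟨ν, α ν⟩ + c) = 0 at h1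
  rw [Pi.single_eq_same, Pi.single_eq_of_ne, sub_zero, sub_add_cancel] at h1
  · exact hx h1
  · intro h2
    exact h (eq_of_heq (Sigma.mk.inj h2).2)

theorem cst_zero {ι : Type} [Fintype ι] : (cst 0 : Entire ι) = 0 := map_zero _

theorem cst_neg {ι : Type} [Fintype ι] (c : ℂ) : (cst (-c) : Entire ι) = -cst c := map_neg _ c

theorem thetaOf_sub_ne_zero (τ : UpperHalfPlane) {α β : EIdx m} {ν : Fin q} (h : α ν ≠ β ν) :
    thetaOf τ (yv β ν - yv α ν) ≠ 0 := by
  have := thetaOf_sub_add_ne_zero τ h 0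
  rwa [cst_zero, add_zero] at this

theorem thetaOf_sub_sub_ne_zero (τ : UpperHalfPlane) {α β : EIdx m} {ν : Fin q} (h : α ν ≠ β ν)
    (c : ℂ) : thetaOf τ (yv β ν - yv α ν - cst c) ≠ 0 := by
  have := thetaOf_sub_add_ne_zero τ h (-c)
  rwa [cst_neg, ← sub_eq_add_neg] at this

variable {τ : UpperHalfPlane} {c : ℂ} {α β : EIdx m} {t : ℕ}

theorem kap_eq_zero (h : eqAt α β t) (h' : eqAt α β (t + 1)) : kap τ c α β t = 0 := by
  have h1 : kapNumE τ c α β t = 0 := Subtype.ext (funext fun y => by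
    change kapNum τ c (eqAt α β) (uAt α β y) t = 0
    rw [kapNum, if_pos h, if_pos h'])
  rw [kap, h1, toMero, map_zero, zero_div]

/-- The zero-based `ν` is the place `t + 1`, the first of a block of disagreement. `kap_right`
treats the end of a block, `kap_mid` a cut inside it. -/
theorem kap_left (h : eqAt α β t) {ν : Fin q} (hν : ν.val = t) (h' : α ν ≠ β ν) :
    kap τ c α β t = -(toMero (cst (e c) * thetaOf τ (yv β ν - yv α ν - cst c)) /
      toMero (thetaOf τ (yv β ν - yv α ν))) := by
  subst hν
  have h'' := mt (eqAt_iff α β ν).1 h'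
  rw [kap, ← neg_div, ← toMero_neg]
  congr 2
  · refine Subtype.ext (funext fun y => ?_)
    change kapNum τ c (eqAt α β) (uAt α β y) ν.val = _
    rw [kapNum, if_pos h, if_neg h'', uAt_add_one]
    exact neg_mul _ _
  · refine Subtype.ext (funext fun y => ?_)
    change kapDen τ (eqAt α β) (uAt α β y) ν.val = _
    rw [kapDen, if_pos h, if_neg h'', uAt_add_one, one_mul]
    rfl

theorem kap_right {ν : Fin q} (hν : ν.val + 1 = t) (h' : α ν ≠ β ν) (h : eqAt α β (t + 1)) :
    kap τ c α β t = toMero (thetaOf τ (cst c - (yv β ν - yv α ν))) /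
      toMero (thetaOf τ (-(yv β ν - yv α ν))) := by
  subst hν
  have h'' := mt (eqAt_iff α β ν).1 h'
  rw [kap]
  congr 2
  · refine Subtype.ext (funext fun y => ?_)
    change kapNum τ c (eqAt α β) (uAt α β y) (ν.val + 1) = _
    rw [kapNum, if_neg h'', if_pos h, uAt_add_one]
    rfl
  · refine Subtype.ext (funext fun y => ?_)
    change kapDen τ (eqAt α β) (uAt α β y) (ν.val + 1) = _
    rw [kapDen, if_neg h'', if_pos h, uAt_add_one, mul_one]
    rfl

theorem kap_mid {ν μ : Fin q} (hν : ν.val + 1 = t) (hμ : μ.val = t) (h : α ν ≠ β ν)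
    (h' : α μ ≠ β μ) :
    kap τ c α β t =
      toMero (cst (theta τ c) * thetaOf τ (yv β μ - yv α μ - (yv β ν - yv α ν))) /
      toMero (thetaOf τ (-(yv β ν - yv α ν)) * thetaOf τ (yv β μ - yv α μ)) := by
  have h1 : ¬ eqAt α β t := by rw [← hν]; exact mt (eqAt_iff α β ν).1 h
  have h2 : ¬ eqAt α β (t + 1) := by rw [← hμ]; exact mt (eqAt_iff α β μ).1 h'
  have h3 : ∀ y, uAt α β y t = y ⟨ν, β ν⟩ - y ⟨ν, α ν⟩ := fun y => by rw [← hν, uAt_add_one]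
  have h4 : ∀ y, uAt α β y (t + 1) = y ⟨μ, β μ⟩ - y ⟨μ, α μ⟩ := fun y => by
    rw [← hμ, uAt_add_one]
  rw [kap]
  congr 2
  · refine Subtype.ext (funext fun y => ?_)
    change kapNum τ c (eqAt α β) (uAt α β y) t = _
    rw [kapNum, if_neg h1, if_neg h2, h3, h4]
    rfl
  · refine Subtype.ext (funext fun y => ?_)
    change kapDen τ (eqAt α β) (uAt α β y) t = _
    rw [kapDen, if_neg h1, if_neg h2, h3, h4]
    rfl

theorem kapDenE_ne_zero (τ : UpperHalfPlane) (α β : EIdx m) (t : ℕ) : kapDenE τ α β t ≠ 0 := by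
  have h1 : ∃ D : Entire (YIdx m), D ≠ 0 ∧
      ∀ y, D.1 y = if eqAt α β t then 1 else theta τ (-uAt α β y t) := by
    by_cases h : eqAt α β t
    · exact ⟨1, one_ne_zero, fun y => by rw [if_pos h]; rfl⟩
    · obtain ⟨ν, hν, hne⟩ := exists_of_not_eqAt h
      refine ⟨thetaOf τ (yv α ν - yv β ν), thetaOf_sub_ne_zero τ hne.symm, fun y => ?_⟩
      rw [if_neg h, ← hν, uAt_add_one, neg_sub]
      rfl
  have h2 : ∃ D : Entire (YIdx m), D ≠ 0 ∧
      ∀ y, D.1 y = if eqAt α β (t + 1) then 1 else theta τ (uAt α β y (t + 1)) := by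
    by_cases h : eqAt α β (t + 1)
    · exact ⟨1, one_ne_zero, fun y => by rw [if_pos h]; rfl⟩
    · obtain ⟨ν, hν, hne⟩ := exists_of_not_eqAt h
      refine ⟨thetaOf τ (yv β ν - yv α ν), thetaOf_sub_ne_zero τ hne, fun y => ?_⟩
      rw [if_neg h, ← hν, uAt_add_one]
      rfl
  obtain ⟨D1, hD1, h1⟩ := h1
  obtain ⟨D2, hD2, h2⟩ := h2
  have h3 : kapDenE τ α β t = D1 * D2 := Subtype.ext (funext fun y => by
    change kapDen τ (eqAt α β) (uAt α β y) t = D1.1 y * D2.1 y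
    rw [h1, h2, kapDen])
  rw [h3]
  exact mul_ne_zero hD1 hD2

end Dynamical

section Identity

variable {n k : ℕ} [NeZero n] {ns : List ℕ} {τ : UpperHalfPlane} {m : Fin ns.length → ℕ}
  {w : ZMod n → Entire (Fin ns.length)}

/-- The product of theta functions with the places `1, …, t` exchanged. -/
def exchProd (ns : List ℕ) {m : Fin ns.length → ℕ} (c η : ℂ) (f g : Entire (Fin ns.length))
    (α β : EIdx m) (t : ℕ) : Entire (YIdx m) :=
  ⟨fun y => ev f (xLim ns c η (eqAt α β) (yAt α y) (uAt α β y) t) *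
    ev g (yLim ns c η (eqAt α β) (yAt α y) (uAt α β y) t), by
    have h1 := fun j => differentiable_yAt α j
    have h2 := fun j => differentiable_uAt α β j
    refine Differentiable.mul (Differentiable.comp (g := f.1) f.2 (differentiable_pi.2 fun ν => ?_))
      (Differentiable.comp (g := g.1) g.2 (differentiable_pi.2 fun ν => ?_))
    · unfold xLim
      split_ifs <;> fun_prop
    · unfold yLim
      split_ifs <;> fun_prop⟩

/-- This is the coefficient of `e_α e_β` in the image of a relation, rewritten by the exchange
identity. -/
theorem sum_toMero_eq (hw : IsThetaBasis n k ns τ w) (hd : d ns = n)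
    (hk : dR ns 1 = k) (hns : ∀ x ∈ ns, 2 ≤ x) (hq : 0 < ns.length)
    (i j : ZMod n) {η : ℂ} {c : ZMod n → ℂ}
    (hc : ∀ r : ZMod n, Tendsto (fun t : ℂ => theta τ (n * t) *
        (thetaN n τ (j - i + r * ((k : ZMod n) - 1)) 0 /
          (thetaN n τ ((k : ZMod n) * r) t * thetaN n τ (j - i - r) (-t)))) (𝓝[≠] η) (𝓝 (c r)))
    (α β : EIdx m) :
    toMero (cst (thetaRes τ)) * ∑ r : ZMod n, toMero (cst (c r)) *
        toMero (subst (fun ν => (⟨ν, α ν⟩ : YIdx m)) (w (-(j - r))) *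
          translate (dynShift n ns η α) (subst (fun ν => (⟨ν, β ν⟩ : YIdx m)) (w (-(i + r))))) =
    toMero (cst (thetaNRes n τ)) * ∑ t ∈ Finset.range (ns.length + 1),
      kap τ (n * η) α β t * toMero (exchProd ns (n * η) η (w (-i)) (w (-j)) α β t) := by
  have key := toMero_eq_sum_div (Finset.range (ns.length + 1))
    (cst (thetaRes τ) * ∑ r : ZMod n, cst (c r) *
        (subst (fun ν => (⟨ν, α ν⟩ : YIdx m)) (w (-(j - r))) *
          translate (dynShift n ns η α) (subst (fun ν => (⟨ν, β ν⟩ : YIdx m)) (w (-(i + r))))))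
    (kapNumE τ (n * η) α β) (kapDenE τ α β)
    (fun t => cst (thetaNRes n τ) * exchProd ns (n * η) η (w (-i)) (w (-j)) α β t)
    (fun t _ => kapDenE_ne_zero τ α β t) ?_
  · simp only [toMero_mul, toMero_sum] at key ⊢
    rw [key, Finset.mul_sum]
    refine Finset.sum_congr rfl fun t _ => ?_
    rw [kap]
    ring
  · intro y hy
    have hu : ∀ j, ¬ eqAt α β j → uAt α β y j ∉ lattice τ := by
      intro j hj hmem
      obtain ⟨ν, hν, -⟩ := exists_of_not_eqAt hj
      apply hy j (Finset.mem_range.2 (by omega))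
      change kapDen τ (eqAt α β) (uAt α β y) j = 0
      rw [kapDen, if_neg hj, theta_lattice (neg_mem_lattice hmem), zero_mul]
    have h := exchange_limit hw hd hk hns hq (yAt_zero α y) (yAt_length_add_one α y)
      (eqAt_zero α β) (eqAt_add_one α β) hu i j hc
    have hz : ∀ f : Entire (Fin ns.length), ev f (yAt α y) = f.1 fun ν => y ⟨ν, α ν⟩ := by
      intro f
      exact congrArg f.1 (funext fun ν => yAt_add_one α y ν)
    -- The replacement of `u_j` by `nη` at the agreeing places is exactly the exceptional value of
    -- the dynamical shift there.
    have hv : ∀ f : Entire (Fin ns.length),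
        ev f (vLim ns (n * η) η (eqAt α β) (yAt α y) (uAt α β y))
          = f.1 fun ν => (y + dynShift n ns η α) ⟨ν, β ν⟩ := by
      intro f
      refine congrArg f.1 (funext fun ν => ?_)
      rw [vLim, yAt_add_one, uAt_add_one, ← dLeft_eq, ← dRight_eq, Pi.add_apply, dynShift]
      by_cases hν : α ν = β ν
      · rw [if_pos ((eqAt_iff α β ν).2 hν), if_pos hν, hν]; ring
      · rw [if_neg (mt (eqAt_iff α β ν).1 hν), if_neg hν]; ring
    change thetaRes τ * (∑ r : ZMod n, cst (c r) *
        (subst (fun ν => (⟨ν, α ν⟩ : YIdx m)) (w (-(j - r))) *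
          translate (dynShift n ns η α) (subst (fun ν => (⟨ν, β ν⟩ : YIdx m)) (w (-(i + r)))))).1 y
        = _
    rw [entire_sum_apply]
    simp only [hz, hv] at h
    refine h.trans ?_
    rw [Finset.mul_sum]
    refine Finset.sum_congr rfl fun t _ => ?_
    exact mul_left_comm _ _ _

end Identity

/-! ### Exchanging blocks of places -/

section Flip

variable {q : ℕ} {m : Fin q → ℕ}

/-- The multi-index that agrees with `β` at the places `s + 1, …, t` and with `α` elsewhere. -/
def flip (α β : EIdx m) (s t : ℕ) : EIdx m := fun ν => if s < ν.val + 1 ∧ ν.val + 1 ≤ t then β ν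
  else α ν

theorem flip_self (α β : EIdx m) (s : ℕ) : flip α β s s = α := by
  funext ν
  rw [flip, if_neg (by omega)]

theorem flip_of_mem {α β : EIdx m} {s t : ℕ} {ν : Fin q} (h : s < ν.val + 1) (h' : ν.val + 1 ≤ t) :
    flip α β s t ν = β ν := if_pos ⟨h, h'⟩

theorem flip_of_lt {α β : EIdx m} {s t : ℕ} {ν : Fin q} (h : t < ν.val + 1) :
    flip α β s t ν = α ν := if_neg (by omega)

theorem eqAt_flip (α β : EIdx m) (s t j : ℕ) :
    eqAt (flip α β s t) (flip β α s t) j ↔ eqAt α β j := by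
  refine forall_congr' fun ν => imp_congr_right fun _ => ?_
  rw [flip, flip]
  split_ifs
  · exact eq_comm
  · rfl

theorem flip_flip (α β : EIdx m) (s t : ℕ) : flip (flip α β s t) (flip β α s t) s t = α := by
  funext ν
  simp only [flip]
  split_ifs <;> rfl

/-- The largest place `≤ t` at which the multi-indices agree. -/
def lastEq (α β : EIdx m) (t : ℕ) : ℕ := Nat.findGreatest (eqAt α β) t

theorem lastEq_le (α β : EIdx m) (t : ℕ) : lastEq α β t ≤ t := Nat.findGreatest_le t

theorem eqAt_lastEq (α β : EIdx m) (t : ℕ) : eqAt α β (lastEq α β t) :=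
  Nat.findGreatest_spec (Nat.zero_le t) (eqAt_zero α β)

theorem not_eqAt_of_lastEq_lt {α β : EIdx m} {t j : ℕ} (h : lastEq α β t < j) (h' : j ≤ t) :
    ¬ eqAt α β j := Nat.findGreatest_is_greatest h h'

theorem lastEq_eq_iff {α β : EIdx m} {s t : ℕ} (hs : eqAt α β s) :
    lastEq α β t = s ↔ s ≤ t ∧ ∀ j, s < j → j ≤ t → ¬ eqAt α β j := by
  constructor
  · rintro rfl
    exact ⟨lastEq_le α β t, fun j h h' => not_eqAt_of_lastEq_lt h h'⟩
  · rintro ⟨h1, h2⟩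
    refine le_antisymm ?_ (Nat.le_findGreatest h1 hs)
    by_contra h
    exact h2 _ (not_le.1 h) (lastEq_le α β t) (eqAt_lastEq α β t)

/-- An exchange does not alter the set of agreeing places; therefore the exchange in `flipEquiv` is
its own inverse. -/
theorem lastEq_flip (α β : EIdx m) (s t t' : ℕ) :
    lastEq (flip α β s t) (flip β α s t) t' = lastEq α β t' :=
  (lastEq_eq_iff ((eqAt_flip α β s t _).2 (eqAt_lastEq α β t'))).2
    ⟨lastEq_le α β t', fun _ h h' => mt (eqAt_flip α β s t _).1 (not_eqAt_of_lastEq_lt h h')⟩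

/-- The involution that exchanges the places after the last one, up to `t`, at which the
multi-indices agree. -/
def flipEquiv (m : Fin q → ℕ) (t : ℕ) : Equiv.Perm (EIdx m × EIdx m) :=
  Function.Involutive.toPerm
    (fun p => (flip p.1 p.2 (lastEq p.1 p.2 t) t, flip p.2 p.1 (lastEq p.1 p.2 t) t))
    fun p => by
      dsimp only
      rw [lastEq_flip, flip_flip, flip_flip]

theorem flipEquiv_apply (t : ℕ) (p : EIdx m × EIdx m) : flipEquiv m t p =
    (flip p.1 p.2 (lastEq p.1 p.2 t) t, flip p.2 p.1 (lastEq p.1 p.2 t) t) := rfl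

end Flip

/-! ### The exchange algebra -/

section Algebra

variable {n : ℕ} {ns : List ℕ} {m : Fin ns.length → ℕ} {τ : UpperHalfPlane} {η : ℂ}

namespace CAlg

theorem fn_add (f g : Mero (YIdx m)) :
    (fn (f + g) : CAlg n ns m τ η) = fn f + fn g := by
  rw [fn, fn, fn, ← map_add]
  exact RingQuot.mkAlgHom_rel ℂ (CRel.add f g)

theorem fn_mul (f g : Mero (YIdx m)) :
    (fn (f * g) : CAlg n ns m τ η) = fn f * fn g := by
  rw [fn, fn, fn, ← map_mul]
  exact RingQuot.mkAlgHom_rel ℂ (CRel.mul f g)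

theorem fn_cst (c : ℂ) : (fn (toMero (cst c)) : CAlg n ns m τ η) = algebraMap ℂ _ c := by
  rw [fn, RingQuot.mkAlgHom_rel ℂ (CRel.const c), AlgHom.commutes]

variable (n ns m τ η) in
/-- The homomorphism from the meromorphic functions to the exchange algebra. -/
def fnHom : Mero (YIdx m) →+* CAlg n ns m τ η where
  toFun := fn
  map_one' := by
    have := fn_cst (n := n) (ns := ns) (m := m) (τ := τ) (η := η) 1
    rwa [cst, map_one, toMero, map_one, map_one] at this
  map_mul' := fn_mul
  map_zero' := by
    have := fn_cst (n := n) (ns := ns) (m := m) (τ := τ) (η := η) 0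
    rwa [cst, map_zero, toMero, map_zero, map_zero] at this
  map_add' := fn_add

theorem fn_zero : (fn 0 : CAlg n ns m τ η) = 0 := map_zero (fnHom n ns m τ η)

theorem fn_neg_mul (f : Mero (YIdx m)) (x : CAlg n ns m τ η) : fn (-f) * x = -(fn f * x) := by
  have h : (fn (-f) : CAlg n ns m τ η) = -fn f := map_neg (fnHom n ns m τ η) f
  rw [h]
  exact neg_mul (fn f) x

theorem fn_sum {κ : Type*} (S : Finset κ) (f : κ → Mero (YIdx m)) :
    (fn (∑ t ∈ S, f t) : CAlg n ns m τ η) = ∑ t ∈ S, fn (f t) :=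
  map_sum (fnHom n ns m τ η) f S

theorem fn_cst_mul (c : ℂ) (x : CAlg n ns m τ η) : fn (toMero (cst c)) * x = c • x := by
  rw [fn_cst, Algebra.smul_def]

theorem gen_mul_fn (α : EIdx m) (f : Mero (YIdx m)) : (gen α * fn f : CAlg n ns m τ η) =
    fn (translateMero (dynShift n ns η α) f) * gen α := by
  rw [fn, fn, gen, ← map_mul, ← map_mul]
  exact RingQuot.mkAlgHom_rel ℂ (CRel.dyn α f)

theorem gen_mul_gen (α β : EIdx m) (a b : Fin ns.length) (hab : a ≤ b)
    (hne : ∀ t, a ≤ t → t ≤ b → α t ≠ β t)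
    (hleft : ∀ t : Fin ns.length, t.val + 1 = a.val → α t = β t)
    (hright : ∀ t : Fin ns.length, b.val + 1 = t.val → α t = β t) :
    (gen α * gen β : CAlg n ns m τ η) =
      fn (Lam n τ η α β a b) * (gen (replaceOn α β a b) * gen (replaceOn β α a b)) +
      ∑ p : Fin ns.length × Fin ns.length with a ≤ p.1 ∧ p.1.val + 1 = p.2.val ∧ p.2 ≤ b,
        fn (LamStep n τ η α β a p.1 p.2) *
          (gen (replaceOn α β a p.1) * gen (replaceOn β α a p.1)) := by
  simp only [fn, gen, ← mul_assoc, ← map_mul, ← map_sum, ← map_add]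
  exact RingQuot.mkAlgHom_rel ℂ (CRel.quad α β a b hab hne hleft hright)

theorem sum_mul_sum (f g : Entire (Fin ns.length)) :
    (CAlg.sum f * CAlg.sum g : CAlg n ns m τ η) = ∑ p : EIdx m × EIdx m,
      fn (toMero (subst (fun ν => (⟨ν, p.1 ν⟩ : YIdx m)) f *
        translate (dynShift n ns η p.1) (subst (fun ν => (⟨ν, p.2 ν⟩ : YIdx m)) g))) *
      (gen p.1 * gen p.2) := by
  rw [CAlg.sum, CAlg.sum, Finset.sum_mul_sum, Fintype.sum_prod_type]
  refine Finset.sum_congr rfl fun α _ => Finset.sum_congr rfl fun β _ => ?_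
  dsimp only
  rw [mul_assoc, ← mul_assoc (gen α), gen_mul_fn, translateMero_toMero, toMero_mul, fn_mul]
  simp only [mul_assoc]

/-- The summands of the exchange relation for the block of the places `s + 1, …, b`. -/
def blockTerm (n : ℕ) (ns : List ℕ) {m : Fin ns.length → ℕ} (τ : UpperHalfPlane) (η : ℂ)
    (α β : EIdx m) (s t : ℕ) : CAlg n ns m τ η :=
  fn (kap τ (n * η) (flip α β s t) (flip β α s t) t) *
    (gen (flip α β s t) * gen (flip β α s t))

/-- For a nonempty block this is its quadratic relation multiplied by the first coefficient `kap` at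
`s`: that factor turns `Lam` and `LamStep` into minus the coefficients of the exchanged pairs. For
`s = b` the block is empty and the only coefficient is zero. -/
theorem sum_blockTerm_eq_zero (α β : EIdx m) {s b : ℕ} (hsb : s ≤ b) (hb : b ≤ ns.length)
    (hs : eqAt α β s) (hb' : eqAt α β (b + 1)) (hne : ∀ j, s < j → j ≤ b → ¬ eqAt α β j) :
    ∑ t ∈ Finset.Ico s (b + 1), blockTerm n ns τ η α β s t = 0 := by
  rcases hsb.eq_or_lt with rfl | hlt
  · rw [Nat.Ico_succ_singleton, Finset.sum_singleton, blockTerm, flip_self, flip_self,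
      kap_eq_zero hs hb', fn_zero, zero_mul]
  obtain ⟨b, rfl⟩ : ∃ b', b = b' + 1 := ⟨b - 1, by omega⟩
  set c : ℂ := n * η with hc
  -- The block of the places `s + 1, …, b + 1` consists of the zero-based places `s, …, b`.
  set a' : Fin ns.length := ⟨s, by omega⟩ with ha'
  set b' : Fin ns.length := ⟨b, by omega⟩ with hb''
  have hne' : ∀ ν : Fin ns.length, a' ≤ ν → ν ≤ b' → α ν ≠ β ν := fun ν h1 h2 h3 =>
    hne (ν.val + 1) (Nat.lt_succ_of_le h1) (Nat.succ_le_succ h2) ((eqAt_iff α β ν).2 h3)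
  have hab : a' ≤ b' := Nat.le_of_lt_succ hlt
  have hrep : ∀ (α β : EIdx m) (t : Fin ns.length), replaceOn α β a' t = flip α β s (t.val + 1) := by
    intro α β t
    funext ν
    rw [replaceOn, flip]
    refine if_congr (and_congr Nat.lt_succ_iff.symm Nat.succ_le_succ_iff.symm) rfl rfl
  have hquad := gen_mul_gen (n := n) (τ := τ) (η := η) α β a' b' hab hne'
    (fun t ht => hs t ht) (fun t ht => hb' t (by rw [← ht]))
  simp only [hrep] at hquad
  have hE : toMero (cst (e c)) * toMero (cst (e (-c))) = (1 : Mero (YIdx m)) := by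
    rw [← toMero_mul, cst, cst, ← map_mul, ← e_add, add_neg_cancel, e_zero, map_one, toMero,
      map_one]
  have hA := toMero_ne_zero (thetaOf_sub_ne_zero τ (hne' a' le_rfl hab))
  have hA' := toMero_ne_zero (thetaOf_sub_sub_ne_zero τ (hne' a' le_rfl hab) c)
  have hK := kap_left (τ := τ) (c := c) hs (ν := a') rfl (hne' a' le_rfl hab)
  have hflip : ∀ (α β : EIdx m) (t : ℕ) (ν : Fin ns.length), a' ≤ ν → ν.val + 1 ≤ t →
      flip α β s t ν = β ν := fun α β t ν h1 h2 => flip_of_mem (Nat.lt_succ_of_le h1) h2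
  have hyv : ∀ {α β : EIdx m} {ν : Fin ns.length}, α ν = β ν → yv α ν = yv β ν := by
    intro α β ν h
    rw [yv, yv, h]
  -- The theta quotient at the first place and the factor `e(-nη)` cancel against `kap` at `s`; the
  -- remaining quotient is `kap_right` for the exchanged pair.
  have hlast : kap τ c α β s * Lam n τ η α β a' b'
      = -kap τ c (flip α β s (b + 1)) (flip β α s (b + 1)) (b + 1) := by
    have h1 := hflip α β (b + 1) b' hab le_rfl
    have h2 := hflip β α (b + 1) b' hab le_rfl
    have hB := toMero_ne_zero (thetaOf_sub_ne_zero τ (hne' b' hab le_rfl))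
    rw [kap_right (ν := b') rfl (by rw [h1, h2]; exact (hne' b' hab le_rfl).symm)
      ((eqAt_flip _ _ _ _ _).2 hb'), hyv h1, hyv h2, hK, Lam,
      show cst c - (yv α b' - yv β b') = yv β b' - yv α b' + cst c by ring, neg_sub]
    simp only [toMero_mul]
    rw [← hc]
    field_simp
    linear_combination -toMero (thetaOf τ (yv β b' - yv α b' + cst c)) * hE
  have hstep : ∀ ν μ : Fin ns.length, a' ≤ ν → ν.val + 1 = μ.val → μ ≤ b' →
      kap τ c α β s * LamStep n τ η α β a' ν μ
        = -kap τ c (flip α β s (ν.val + 1)) (flip β α s (ν.val + 1)) (ν.val + 1) := by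
    intro ν μ h1 h2 h3
    have hνb : ν ≤ b' := le_trans (by rw [Fin.le_def]; omega) h3
    have haμ : a' ≤ μ := le_trans h1 (by rw [Fin.le_def]; omega)
    have f1 := hflip α β (ν.val + 1) ν h1 le_rfl
    have f2 := hflip β α (ν.val + 1) ν h1 le_rfl
    have f3 : flip α β s (ν.val + 1) μ = α μ := flip_of_lt (by omega)
    have f4 : flip β α s (ν.val + 1) μ = β μ := flip_of_lt (by omega)
    have hN := toMero_ne_zero (thetaOf_sub_ne_zero τ (hne' ν h1 hνb))
    have hM := toMero_ne_zero (thetaOf_sub_ne_zero τ (hne' μ haμ h3))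
    rw [kap_mid (ν := ν) (μ := μ) rfl h2.symm (by rw [f1, f2]; exact (hne' ν h1 hνb).symm)
      (by rw [f3, f4]; exact hne' μ haμ h3), hyv f1, hyv f2, hyv f3, hyv f4, hK, LamStep, neg_sub,
      show yv β μ - yv α μ - (yv α ν - yv β ν) = yv β ν + yv β μ - yv α ν - yv α μ by ring,
      ← hc, show cst (e (-c) * theta τ c) = (cst (e (-c)) * cst (theta τ c) :
        Entire (YIdx m)) from map_mul _ _ _]
    simp only [toMero_mul]
    field_simp
    linear_combination -toMero (cst (theta τ c)) *
      toMero (thetaOf τ (yv β ν + yv β μ - yv α ν - yv α μ)) * hE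
  have hsum : ∑ p : Fin ns.length × Fin ns.length with a' ≤ p.1 ∧ p.1.val + 1 = p.2.val ∧ p.2 ≤ b',
        fn (kap τ c α β s) * (fn (LamStep n τ η α β a' p.1 p.2) *
          (gen (flip α β s (p.1.val + 1)) * gen (flip β α s (p.1.val + 1))))
      = -∑ t ∈ Finset.Ico (s + 1) (b + 1), blockTerm n ns τ η α β s t := by
    rw [← Finset.sum_neg_distrib]
    -- A pair of consecutive zero-based places is the cut after the place `p.1 + 1`.
    refine Finset.sum_bij (fun p _ => p.1.val + 1) ?_ ?_ ?_ ?_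
    · intro p hp
      obtain ⟨h1, h2, h3⟩ := (Finset.mem_filter.1 hp).2
      rw [Fin.le_def] at h1 h3
      rw [Finset.mem_Ico]
      simp only [ha', hb''] at h1 h3
      omega
    · intro p hp p' hp' h
      obtain ⟨-, h2, -⟩ := (Finset.mem_filter.1 hp).2
      obtain ⟨-, h2', -⟩ := (Finset.mem_filter.1 hp').2
      exact Prod.ext (Fin.ext (by omega)) (Fin.ext (by omega))
    · intro t ht
      rw [Finset.mem_Ico] at ht
      refine ⟨(⟨t - 1, by omega⟩, ⟨t, by omega⟩), ?_, ?_⟩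
      · simp only [Finset.mem_filter, Finset.mem_univ, true_and, Fin.le_def, ha', hb'']
        omega
      · dsimp only
        omega
    · intro p hp
      obtain ⟨h1, h2, h3⟩ := (Finset.mem_filter.1 hp).2
      rw [← mul_assoc, ← fn_mul, hstep p.1 p.2 h1 h2 h3, fn_neg_mul]
      rfl
  rw [Finset.sum_eq_sum_Ico_succ_bot (by omega), Finset.sum_Ico_succ_top (by omega)]
  have h0 : blockTerm n ns τ η α β s s = fn (kap τ c α β s) * (gen α * gen β) := by
    rw [blockTerm, flip_self, flip_self]
  rw [h0, hquad, mul_add, Finset.mul_sum, hsum, ← mul_assoc (fn _) (fn _), ← fn_mul, hlast, fn_neg_mul]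
  change -blockTerm n ns τ η α β s (b + 1) + _ + _ = _
  abel

/-- The `t` with the same last agreement `s` form an interval ending just before the next agreement,
which exists because `q + 1` counts as one. Each interval contributes zero. -/
theorem sum_blockTerm_lastEq (α β : EIdx m) (H : ℕ → CAlg n ns m τ η) :
    ∑ t ∈ Finset.range (ns.length + 1),
      H (lastEq α β t) * blockTerm n ns τ η α β (lastEq α β t) t = 0 := by
  rw [← Finset.sum_fiberwise_of_maps_to (t := Finset.range (ns.length + 1)) (g := lastEq α β)
    (fun t ht => Finset.mem_range.2 ((lastEq_le α β t).trans_lt (Finset.mem_range.1 ht)))]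
  refine Finset.sum_eq_zero fun s hs => ?_
  have hs' := Finset.mem_range.1 hs
  by_cases hE : eqAt α β s
  · have hex : ∃ j, s < j ∧ eqAt α β j := ⟨ns.length + 1, hs', eqAt_add_one α β⟩
    obtain ⟨b, hb⟩ : ∃ b, Nat.find hex = b + 1 :=
      ⟨Nat.find hex - 1, by have := (Nat.find_spec hex).1; omega⟩
    have h1 := Nat.find_spec hex
    rw [hb] at h1
    have h2 : b ≤ ns.length := by
      have := Nat.find_min' hex ⟨hs', eqAt_add_one α β⟩
      omega
    have h3 : ∀ j, s < j → j ≤ b → ¬ eqAt α β j := fun j hj hj' h =>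
      Nat.find_min hex (m := j) (by omega) ⟨hj, h⟩
    have h4 : (Finset.range (ns.length + 1)).filter (fun t => lastEq α β t = s)
        = Finset.Ico s (b + 1) := by
      ext t
      rw [Finset.mem_filter, Finset.mem_range, Finset.mem_Ico, lastEq_eq_iff hE]
      constructor
      · rintro ⟨_, h5, h6⟩
        refine ⟨h5, ?_⟩
        by_contra h7
        exact h6 (b + 1) h1.1 (by omega) h1.2
      · rintro ⟨h5, h6⟩
        exact ⟨by omega, h5, fun j hj hj' => h3 j hj (by omega)⟩
    have h5 : ∑ t ∈ (Finset.range (ns.length + 1)).filter (fun t => lastEq α β t = s),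
        H (lastEq α β t) * blockTerm n ns τ η α β (lastEq α β t) t
        = H s * ∑ t ∈ Finset.Ico s (b + 1), blockTerm n ns τ η α β s t := by
      rw [← h4, Finset.mul_sum]
      refine Finset.sum_congr rfl fun t ht => ?_
      rw [(Finset.mem_filter.1 ht).2]
    rw [h5, sum_blockTerm_eq_zero α β (by omega) h2 hE h1.2 h3, mul_zero]
  · refine Finset.sum_eq_zero fun t ht => ?_
    exfalso
    apply hE
    rw [← (Finset.mem_filter.1 ht).2]
    exact eqAt_lastEq α β t

/-- At the places `s + 1, …, t` the exchange of the indices undoes the exchange of the variables.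
Disagreement at these places is needed, since at an agreement the variables differ by `c` and not by
`u_j`. -/
theorem exchProd_flip (c : ℂ) (f g : Entire (Fin ns.length)) (α β : EIdx m) {s t : ℕ}
    (hst : s ≤ t) (hne : ∀ j, s < j → j ≤ t → ¬ eqAt α β j) :
    exchProd ns c η f g (flip α β s t) (flip β α s t) t = exchProd ns c η f g α β s := by
  refine Subtype.ext (funext fun y => ?_)
  have hf : ∀ (α β : EIdx m) (ν : Fin ns.length), yAt (flip α β s t) y (ν.val + 1)
      = if s < ν.val + 1 ∧ ν.val + 1 ≤ t then yAt β y (ν.val + 1) else yAt α y (ν.val + 1) := by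
    intro α β ν
    rw [yAt_add_one, yAt_add_one, yAt_add_one, flip]
    split_ifs <;> rfl
  have hLim : ∀ j < ns.length,
      xLim ns c η (eqAt (flip α β s t) (flip β α s t))
        (yAt (flip α β s t) y) (uAt (flip α β s t) (flip β α s t) y) t (j + 1)
        = xLim ns c η (eqAt α β) (yAt α y) (uAt α β y) s (j + 1) ∧
      yLim ns c η (eqAt (flip α β s t) (flip β α s t))
        (yAt (flip α β s t) y) (uAt (flip α β s t) (flip β α s t) y) t (j + 1)
        = yLim ns c η (eqAt α β) (yAt α y) (uAt α β y) s (j + 1) := by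
    intro j hj
    have h1 := hf α β ⟨j, hj⟩
    have h2 := hf β α ⟨j, hj⟩
    dsimp only at h1 h2
    by_cases hjs : j + 1 ≤ s
    · have hjt : j + 1 ≤ t := hjs.trans hst
      rw [if_neg (by omega)] at h1 h2
      simp only [xLim, yLim, uAt, h1, h2, eqAt_flip, hjs, hjt, if_true, and_self]
    · by_cases hjt : j + 1 ≤ t
      · rw [if_pos ⟨by omega, hjt⟩] at h1 h2
        have hE := hne _ (not_le.1 hjs) hjt
        simp only [xLim, yLim, uAt, h1, h2, eqAt_flip, hjs, hjt, hE, if_true, if_false]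
        constructor <;> ring
      · rw [if_neg (by omega)] at h1 h2
        simp only [xLim, yLim, uAt, h1, h2, eqAt_flip, hjs, hjt, if_false, and_self]
  change ev f _ * ev g _ = ev f _ * ev g _
  rw [ev_congr f fun j hj => (hLim j hj).1, ev_congr g fun j hj => (hLim j hj).2]

/-- For each `t` the pairs are reindexed by `flipEquiv`; then the theta factor depends on `t` only
through `lastEq`, and the sum over `t` for a fixed pair vanishes. -/
theorem sum_kap_mul_exchProd_eq_zero (f g : Entire (Fin ns.length)) :
    ∑ p : EIdx m × EIdx m, ∑ t ∈ Finset.range (ns.length + 1),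
      (fn (kap τ (n * η) p.1 p.2 t * toMero (exchProd ns (n * η) η f g p.1 p.2 t)) *
        (gen p.1 * gen p.2) : CAlg n ns m τ η) = 0 := by
  rw [Finset.sum_comm]
  have h : ∀ t ∈ Finset.range (ns.length + 1), ∑ p : EIdx m × EIdx m,
      (fn (kap τ (n * η) p.1 p.2 t * toMero (exchProd ns (n * η) η f g p.1 p.2 t)) *
        (gen p.1 * gen p.2) : CAlg n ns m τ η)
      = ∑ p : EIdx m × EIdx m, fn (toMero (exchProd ns (n * η) η f g p.1 p.2 (lastEq p.1 p.2 t))) *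
        blockTerm n ns τ η p.1 p.2 (lastEq p.1 p.2 t) t := by
    intro t _
    rw [← Equiv.sum_comp (flipEquiv m t)]
    refine Finset.sum_congr rfl fun p _ => ?_
    simp only [flipEquiv_apply]
    rw [exchProd_flip _ _ _ _ _ (lastEq_le _ _ _) fun j => not_eqAt_of_lastEq_lt,
      mul_comm (kap _ _ _ _ _), fn_mul, mul_assoc, blockTerm]
  rw [Finset.sum_congr rfl h, Finset.sum_comm]
  exact Finset.sum_eq_zero fun p _ => sum_blockTerm_lastEq p.1 p.2 fun s =>
    fn (toMero (exchProd ns (n * η) η f g p.1 p.2 s))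

theorem sum_smul_sum_mul_sum_eq_zero {k : ℕ} [NeZero n] {w : ZMod n → Entire (Fin ns.length)}
    (hw : IsThetaBasis n k ns τ w) (hd : d ns = n)
    (hk : dR ns 1 = k) (hns : ∀ x ∈ ns, 2 ≤ x) (hq : 0 < ns.length)
    (i j : ZMod n) {c : ZMod n → ℂ}
    (hc : ∀ r : ZMod n, Tendsto (fun t : ℂ => theta τ (n * t) *
        (thetaN n τ (j - i + r * ((k : ZMod n) - 1)) 0 /
          (thetaN n τ ((k : ZMod n) * r) t * thetaN n τ (j - i - r) (-t)))) (𝓝[≠] η) (𝓝 (c r))) :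
    ∑ r : ZMod n, c r • (CAlg.sum (w (-(j - r))) * CAlg.sum (w (-(i + r))) : CAlg n ns m τ η)
      = 0 := by
  -- The exchange identity carries the constant `thetaRes` on this side, so the relation is proved
  -- after multiplication by it.
  rw [← smul_right_injective _ (thetaRes_ne_zero τ) |>.eq_iff, smul_zero]
  have h : ∀ r : ZMod n, c r • (CAlg.sum (w (-(j - r))) * CAlg.sum (w (-(i + r))) : CAlg n ns m τ η)
      = ∑ p : EIdx m × EIdx m, fn (toMero (cst (c r)) *
        toMero (subst (fun ν => (⟨ν, p.1 ν⟩ : YIdx m)) (w (-(j - r))) *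
          translate (dynShift n ns η p.1) (subst (fun ν => (⟨ν, p.2 ν⟩ : YIdx m)) (w (-(i + r)))))) *
        (gen p.1 * gen p.2) := by
    intro r
    rw [sum_mul_sum, Finset.smul_sum]
    refine Finset.sum_congr rfl fun p _ => ?_
    rw [fn_mul, mul_assoc, fn_cst_mul]
  simp only [h]
  rw [Finset.sum_comm, ← fn_cst_mul, Finset.mul_sum]
  have h2 : ∀ p : EIdx m × EIdx m, fn (toMero (cst (thetaRes τ))) * ∑ r : ZMod n,
      fn (toMero (cst (c r)) *
        toMero (subst (fun ν => (⟨ν, p.1 ν⟩ : YIdx m)) (w (-(j - r))) *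
          translate (dynShift n ns η p.1) (subst (fun ν => (⟨ν, p.2 ν⟩ : YIdx m)) (w (-(i + r)))))) *
        (gen p.1 * gen p.2)
      = fn (toMero (cst (thetaNRes n τ))) * ∑ t ∈ Finset.range (ns.length + 1),
        (fn (kap τ (n * η) p.1 p.2 t * toMero (exchProd ns (n * η) η (w (-i)) (w (-j)) p.1 p.2 t)) *
        (gen p.1 * gen p.2) : CAlg n ns m τ η) := by
    intro p
    rw [← Finset.sum_mul, ← fn_sum, ← mul_assoc, ← fn_mul,
      sum_toMero_eq hw hd hk hns hq i j hc p.1 p.2, fn_mul, fn_sum, mul_assoc, Finset.sum_mul]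
  rw [Finset.sum_congr rfl fun p _ => h2 p, ← Finset.mul_sum, sum_kap_mul_exchProd_eq_zero,
    mul_zero]

end CAlg

end Algebra

/-! ### The homomorphisms -/

section Hom

variable {n k : ℕ} [NeZero n] {ns : List ℕ} {m : Fin ns.length → ℕ} {τ : UpperHalfPlane} {η : ℂ}
  {w : ZMod n → Entire (Fin ns.length)}

theorem d_eq_and_dR_one_eq (hk : 1 ≤ k) (hcop : Nat.Coprime n k)
    (hns : ∀ a ∈ ns, 2 ≤ a) (hcf : (n : ℚ) / k = negContFrac ns) :
    d ns = n ∧ dR ns 1 = k ∧ 0 < ns.length := by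
  cases ns with
  | nil =>
    exfalso
    have hn : (n : ℚ) ≠ 0 := by exact_mod_cast NeZero.ne n
    have hk' : (k : ℚ) ≠ 0 := by exact_mod_cast (by omega : k ≠ 0)
    exact div_ne_zero hn hk' hcf
  | cons a l =>
    obtain ⟨h1, h2⟩ := d_eq_of_negContFrac hk hcop hns hcf
    refine ⟨h1, ?_, Nat.succ_pos _⟩
    rw [dR, if_pos (by simp)]
    exact h2

/-- A homomorphism given by elements that satisfy the relations. -/
theorem exists_algHom {A : Type*} [Ring A] [Algebra ℂ A] (X : ZMod n → A)
    (hX : ∀ (i j : ZMod n) (c : ZMod n → ℂ), (∀ r : ZMod n, Tendsto (fun t : ℂ => theta τ (n * t) *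
        (thetaN n τ (j - i + r * ((k : ZMod n) - 1)) 0 /
          (thetaN n τ ((k : ZMod n) * r) t * thetaN n τ (j - i - r) (-t)))) (𝓝[≠] η) (𝓝 (c r))) →
      ∑ r : ZMod n, c r • (X (j - r) * X (i + r)) = 0) :
    ∃ φ : QAlg n k τ η →ₐ[ℂ] A, ∀ i : ZMod n, φ (QAlg.x i) = X i := by
  refine ⟨RingQuot.liftAlgHom ℂ ⟨FreeAlgebra.lift ℂ X, ?_⟩, fun i => ?_⟩
  · rintro _ _ ⟨i, j, c, hc⟩
    simp only [map_sum, map_smul, map_mul, FreeAlgebra.lift_ι_apply, map_zero]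
    exact hX i j c hc
  · rw [QAlg.x, RingQuot.liftAlgHom_mkAlgHom_apply, FreeAlgebra.lift_ι_apply]

/-- The symmetry of the coefficients of the relations of `Q_{n,k}(ℰ, η)`. -/
theorem coefficient_neg (i j r : ZMod n) (t : ℂ) :
    thetaN n τ (-j - -i + -r * ((k : ZMod n) - 1)) 0 /
      (thetaN n τ ((k : ZMod n) * -r) (-t) * thetaN n τ (-j - -i - -r) (- -t)) =
    -(thetaN n τ (j - i + r * ((k : ZMod n) - 1)) 0 /
      (thetaN n τ ((k : ZMod n) * r) t * thetaN n τ (j - i - r) (-t))) := by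
  have h1 := thetaN_neg n τ (j - i + r * ((k : ZMod n) - 1)) 0
  have h2 := thetaN_neg n τ ((k : ZMod n) * r) t
  have h3 := thetaN_neg n τ (j - i - r) (-t)
  have h4 : chi n (-(j - i + r * ((k : ZMod n) - 1))) =
      chi n (-((k : ZMod n) * r)) * chi n (-(j - i - r)) := by
    rw [← chi_add]; congr 1; ring
  have h5 : e (-(n * t)) * e (-(n * -t)) = 1 := by
    rw [← e_add, mul_neg, neg_neg, neg_add_cancel, e_zero]
  rw [mul_zero, neg_zero, e_zero, one_mul, h4] at h1
  rw [show -j - -i + -r * ((k : ZMod n) - 1) = -(j - i + r * ((k : ZMod n) - 1)) by ring,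
    show (k : ZMod n) * -r = -((k : ZMod n) * r) by ring, show -j - -i - -r = -(j - i - r) by ring,
    h1, h2, h3, neg_mul_neg, neg_div]
  congr 1
  have h6 := chi_ne_zero n (-((k : ZMod n) * r))
  have h7 := chi_ne_zero n (-(j - i - r))
  rw [show e (-(n * t)) * chi n (-((k : ZMod n) * r)) * thetaN n τ ((k : ZMod n) * r) t *
      (e (-(n * -t)) * chi n (-(j - i - r)) * thetaN n τ (j - i - r) (-t)) =
      chi n (-((k : ZMod n) * r)) * chi n (-(j - i - r)) *
        (thetaN n τ ((k : ZMod n) * r) t * thetaN n τ (j - i - r) (-t)) by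
    linear_combination chi n (-((k : ZMod n) * r)) * chi n (-(j - i - r)) *
        (thetaN n τ ((k : ZMod n) * r) t * thetaN n τ (j - i - r) (-t)) * h5,
    mul_div_mul_left _ _ (mul_ne_zero h6 h7)]

/-- The two minus signs, from `coefficient_neg` and from `θ(-nt) = -e(-nt) θ(nt)`, cancel. The
remaining factor `e(nη)` does not depend on `r`, so it only rescales the relation. -/
theorem tendsto_coefficient_neg (i j r : ZMod n) {c : ℂ}
    (hc : Tendsto (fun t : ℂ => theta τ (n * t) *
      (thetaN n τ (j - i + r * ((k : ZMod n) - 1)) 0 /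
        (thetaN n τ ((k : ZMod n) * r) t * thetaN n τ (j - i - r) (-t)))) (𝓝[≠] (-η)) (𝓝 c)) :
    Tendsto (fun t : ℂ => theta τ (n * t) *
      (thetaN n τ (-j - -i + -r * ((k : ZMod n) - 1)) 0 /
        (thetaN n τ ((k : ZMod n) * -r) t * thetaN n τ (-j - -i - -r) (-t)))) (𝓝[≠] η)
      (𝓝 (e (n * η) * c)) := by
  have h1 : Tendsto (fun t : ℂ => -t) (𝓝[≠] η) (𝓝[≠] (-η)) := by
    refine tendsto_nhdsWithin_of_tendsto_nhds_of_eventually_within _ ?_ ?_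
    · exact (continuous_neg.tendsto η).mono_left nhdsWithin_le_nhds
    · filter_upwards [self_mem_nhdsWithin] with x hx h
      exact hx (neg_injective h)
  have h2 : Tendsto (fun t : ℂ => e (n * t)) (𝓝[≠] η) (𝓝 (e (n * η))) :=
    ((continuous_e.comp (by fun_prop : Continuous fun t : ℂ => (n : ℂ) * t)).tendsto η).mono_left
      nhdsWithin_le_nhds
  refine (h2.mul (hc.comp h1)).congr fun t => ?_
  have h3 := coefficient_neg (n := n) (k := k) (τ := τ) i j r (-t)
  have h4 := theta_neg τ (n * t)
  have h5 : e (n * t) * e (-(n * t)) = 1 := by rw [← e_add, add_neg_cancel, e_zero]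
  rw [neg_neg] at h3
  rw [h3, Function.comp_apply, mul_neg, h4, neg_neg]
  linear_combination (-theta τ (n * t)) * (thetaN n τ (j - i + r * ((k : ZMod n) - 1)) 0 /
    (thetaN n τ ((k : ZMod n) * r) (-t) * thetaN n τ (j - i - r) t)) * h5

end Hom

end EllipticAlg

end

theorem proposition13 (n k : ℕ) [NeZero n] (hk : 1 ≤ k) (hkn : k < n) (hcop : Nat.Coprime n k)
    (ns : List ℕ) (hns : ∀ a ∈ ns, 2 ≤ a) (hcf : (n : ℚ) / k = EllipticAlg.negContFrac ns)
    (m : Fin ns.length → ℕ) (τ : UpperHalfPlane) (η : ℂ)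
    (w : ZMod n → EllipticAlg.Entire (Fin ns.length))
    (hw : EllipticAlg.IsThetaBasis n k ns τ w) :
    (∃ φ : EllipticAlg.QAlg n k τ η →ₐ[ℂ] EllipticAlg.CAlg n ns m τ η,
      ∀ i : ZMod n, φ (EllipticAlg.QAlg.x i) = EllipticAlg.CAlg.sum (w (-i))) ∧
    (∃ φ : EllipticAlg.QAlg n k τ (-η) →ₐ[ℂ] EllipticAlg.CAlg n ns m τ η,
      ∀ i : ZMod n, φ (EllipticAlg.QAlg.x i) = EllipticAlg.CAlg.sum (w i)) := by
  obtain ⟨hd, hd1, hq⟩ := EllipticAlg.d_eq_and_dR_one_eq hk hcop hns hcf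
  refine ⟨EllipticAlg.exists_algHom _ fun i j c hc => ?_,
    EllipticAlg.exists_algHom _ fun i j c hc => ?_⟩
  · exact EllipticAlg.CAlg.sum_smul_sum_mul_sum_eq_zero hw hd hd1 hns hq i j hc
  -- The relation `(i, j)` at `-η` is, up to the factor `e(nη)` and the substitution `r ↦ -r`, the
  -- relation `(-i, -j)` at `η`.
  · have h := EllipticAlg.CAlg.sum_smul_sum_mul_sum_eq_zero (m := m) hw hd hd1 hns hq (-i) (-j)
      (η := η) (c := fun r => EllipticAlg.e (n * η) * c (-r)) fun r => by
        have h := EllipticAlg.tendsto_coefficient_neg i j (-r) (hc (-r))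
        rwa [neg_neg] at h
    rw [← Equiv.sum_comp (Equiv.neg (ZMod n))] at h
    simp only [Equiv.neg_apply, neg_neg, mul_smul, ← Finset.smul_sum] at h
    have h1 := (smul_eq_zero_iff_right (EllipticAlg.e_ne_zero (n * η))).1 h
    rw [← h1]
    refine Finset.sum_congr rfl fun r _ => ?_
    rw [show -(-j - -r) = j - r by ring, show -(-i + -r) = i + r by ring]
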